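/- **Theorem.** Let $0<a<b$ be coprime integers. An *$a,b$-Dyck path* is a lattice path $D$ of unit north and east steps from $(0,0)$ to $(b,a)$ that stays weakly above the line $y=\frac{a}{b}x$. A *valley* of $D$ is a lattice point of $D$ immediately preceded by an east step and succeeded by a north step. From every valley fire a *laser*: the segment of slope $\frac{a}{b}$ going northeast from the valley until it next meets $D$ (which happens in the interior of an east step). Label the east ends of the non-terminal east steps of $D$ from left to right by $1,\dots,b-1$, each label lying slightly below its lattice point, and let $\pi(D)$ be the set partition of $[b-1]$ in which $i\sim j$ if and only if $i$ and $j$ are not separated by a laser. Put $\mathsf{NC}(a,b)=\{\pi(D) : D \text{ an } a,b\text{-Dyck path}\}$. For $\pi\in\mathsf{NC}(a,b)$, the integers $\mathrm{rank}(B)$, $B$ a block of $\pi$, are determined recursively by $$\sum_{B'\,:\,[\min B',\max B']\subseteq[\min B,\max B]}\mathrm{rank}(B')=\Big\lceil(\max B-\min B+1)\frac{a}{b}\Big\rceil\qquad\text{for all blocks } B\in\pi .$$ Let $\mathsf{Park}^{NC}(a,b)$ be the set of pairs $(\pi,f)$, where $\pi\in\mathsf{NC}(a,b)$ and $f$ assigns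 to each block $B$ of $\pi$ a subset $f(B)\subseteq[a]$ with $|f(B)|=\mathrm{rank}(B)$ and $[a]=\biguplus_{B\in\pi}f(B)$. Then $\mathsf{Park}^{NC}(a,b)$ carries an action of $\mathfrak{S}_a\times\mathbb{Z}_{b-1}$ in which $w\in\mathfrak{S}_a$ permutes labels, $(\pi,f)\mapsto(\pi,\,B\mapsto w(f(B)))$, and the element $1\in\mathbb{Z}_{b-1}$ acts by rotation, $(\pi,f)\mapsto(\mathrm{rot}(\pi),\,\mathrm{rot}(B)\mapsto f(B))$, where $\mathrm{rot}$ is the permutation $i\mapsto i+1$ $(1\le i<b-1)$, $b-1\mapsto 1$ of $[b-1]$. Let $\chi$ be the permutation character of this action. For every $w\in\mathfrak{S}_a$, every generator $g$ of $\mathbb{Z}_{b-1}$ and every integer $d\ge 0$, $$\chi(w,g^d)=b^{\,\mathrm{mult}_w(\zeta^d)},$$ where $\zeta=e^{2\pi i/(b-1)}$ and $\mathrm{mult}_w(\zeta^d)$ is the multiplicity of $\zeta^d$ as an eigenvalue of $w$ on the reflection representation $V=\mathbb{C}^a/\langle(1,\dots,1)\rangle$ of $\mathfrak{S}_a$. 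-/

import Mathlib

/-- A step of a lattice path in `ℤ²`: one unit north or one unit east. -/
inductive LatticeStep where
  | north
  | east
  deriving DecidableEq

/-- An `a,b`-Dyck path: a lattice path of north and east steps from `(0,0)` to `(b,a)` that stays
(weakly) above the line `y = (a/b) x`. The lattice points of the path are the endpoints of the
prefixes `u` of its word, with coordinates (number of east steps, number of north steps). -/
structure RationalDyckPath (a b : ℕ) where
  steps : List LatticeStep
  count_east : steps.count LatticeStep.east = b
  count_north : steps.count LatticeStep.north = a
  above : ∀ u : List LatticeStep, u <+: steps →
    a * u.count LatticeStep.east ≤ b * u.count LatticeStep.north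

namespace RationalDyckPath

variable {a b : ℕ}

/-- The path has an east step from `(x, y)` to `(x + 1, y)`. -/
def HasEastStep (D : RationalDyckPath a b) (x y : ℕ) : Prop :=
  ∃ u v : List LatticeStep, D.steps = u ++ LatticeStep.east :: v ∧
    u.count LatticeStep.east = x ∧ u.count LatticeStep.north = y

/-- `(x, y)` is a valley of the path: a lattice point of the path immediately preceded by an
east step and succeeded by a north step. -/
def IsValley (D : RationalDyckPath a b) (x y : ℕ) : Prop :=
  ∃ u v : List LatticeStep, D.steps = (u ++ [LatticeStep.east]) ++ LatticeStep.north :: v ∧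
    (u ++ [LatticeStep.east]).count LatticeStep.east = x ∧
    (u ++ [LatticeStep.east]).count LatticeStep.north = y

/-- The height at abscissa `x` of the line of slope `a/b` through `(p, y)`. -/
def laserHeight (a b p y x : ℕ) : ℚ :=
  (y : ℚ) + (a : ℚ) / (b : ℚ) * ((x : ℚ) - (p : ℚ))

/-- The laser set of the path: the pairs `(p, j)` such that the laser of slope `a/b` fired
northeast from a valley with `x`-coordinate `p` first meets the path again in the interior of the
east step with west `x`-coordinate `j`. That is, the laser is strictly below the path at the east
end of every earlier east step, and it crosses the height of the `j`-th east step strictly between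
the abscissas `j` and `j + 1`. -/
def lasers (D : RationalDyckPath a b) : Set (ℕ × ℕ) :=
  {l | ∃ y z : ℕ, D.IsValley l.1 y ∧ l.1 ≤ l.2 ∧ D.HasEastStep l.2 z ∧
    (∀ k c : ℕ, l.1 ≤ k → k < l.2 → D.HasEastStep k c → laserHeight a b l.1 y (k + 1) < c) ∧
    laserHeight a b l.1 y l.2 < z ∧ (z : ℚ) < laserHeight a b l.1 y (l.2 + 1)}

/-- The label `i : Fin (b - 1)` stands for `i + 1 ∈ {1, …, b - 1}` and sits slightly below the
east end of the east step that ends at abscissa `i + 1`. The laser `(p, j)` together with the path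
encloses exactly the labels at the abscissas `x` with `p < x ≤ j` (the label at the valley itself
is below the laser). -/
def Encloses (l : ℕ × ℕ) (i : Fin (b - 1)) : Prop :=
  l.1 < (i : ℕ) + 1 ∧ (i : ℕ) + 1 ≤ l.2

/-- Two labels see each other if no valley laser separates them. -/
def visibility (D : RationalDyckPath a b) : Setoid (Fin (b - 1)) where
  r i i' := ∀ l ∈ D.lasers, (Encloses l i ↔ Encloses l i')
  iseqv :=
    { refl := fun _ _ _ => Iff.rfl
      symm := fun h l hl => (h l hl).symm
      trans := fun h h' l hl => (h l hl).trans (h' l hl) }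

open Classical in
/-- The set partition `π(D)` of the label set. -/
noncomputable def toPartition (D : RationalDyckPath a b) :
    Finpartition (Finset.univ : Finset (Fin (b - 1))) :=
  Finpartition.ofSetoid D.visibility

end RationalDyckPath

/-- The set of `a,b`-noncrossing partitions of `{1, …, b - 1}`. -/
def RationalNC (a b : ℕ) : Set (Finpartition (Finset.univ : Finset (Fin (b - 1)))) :=
  Set.range (RationalDyckPath.toPartition (a := a) (b := b))

section Rank

variable {n : ℕ}

/-- The interval `[min B, max B]`. -/
def blockHull (B : Finset (Fin n)) : Finset (Fin n) :=
  Finset.univ.filter fun x => ∃ i ∈ B, ∃ j ∈ B, i ≤ x ∧ x ≤ j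

theorem blockHull_eq_Icc (B : Finset (Fin n)) (h : B.Nonempty) :
    blockHull B = Finset.Icc (B.min' h) (B.max' h) := by
  ext x
  simp only [blockHull, Finset.mem_filter, Finset.mem_univ, true_and, Finset.mem_Icc]
  constructor
  · rintro ⟨i, hi, j, hj, h1, h2⟩
    exact ⟨(B.min'_le i hi).trans h1, h2.trans (B.le_max' j hj)⟩
  · rintro ⟨h1, h2⟩
    exact ⟨_, B.min'_mem h, _, B.max'_mem h, h1, h2⟩

/-- The `a,b`-rank of a block `B` of the partition `P`. The number of elements of the interval
`[min B, max B]` is `max B - min B + 1`; the recursion is restated in `sum_blockRank`. -/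
noncomputable def blockRank (a b : ℕ) (P : Finpartition (Finset.univ : Finset (Fin n)))
    (B : Finset (Fin n)) : ℤ :=
  ⌈((blockHull B).card : ℚ) * ((a : ℚ) / (b : ℚ))⌉ -
    ∑ B' ∈ (P.parts.filter fun B' => blockHull B' ⊂ blockHull B).attach, blockRank a b P B'.1
termination_by (blockHull B).card
decreasing_by exact Finset.card_lt_card (Finset.mem_filter.1 B'.2).2

/-- The implicit description of rank: the ranks of all blocks `B'` with
`[min B', max B'] ⊆ [min B, max B]` add up to `⌈(max B - min B + 1) a / b⌉`. -/
theorem sum_blockRank (a b : ℕ) (P : Finpartition (Finset.univ : Finset (Fin n)))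
    (B : Finset (Fin n)) (hB : B ∈ P.parts) :
    ∑ B' ∈ P.parts.filter (fun B' => blockHull B' ⊆ blockHull B), blockRank a b P B' =
      ⌈((blockHull B).card : ℚ) * ((a : ℚ) / (b : ℚ))⌉ := by
  have key : P.parts.filter (fun B' => blockHull B' ⊆ blockHull B) =
      insert B (P.parts.filter fun B' => blockHull B' ⊂ blockHull B) := by
    ext C
    simp only [Finset.mem_filter, Finset.mem_insert]
    constructor
    · rintro ⟨hC, h⟩
      rcases h.eq_or_ssubset with h | h
      · left
        have hCne := P.nonempty_of_mem_parts hC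
        have hBne := P.nonempty_of_mem_parts hB
        rw [blockHull_eq_Icc C hCne, blockHull_eq_Icc B hBne] at h
        have hmin : C.min' hCne = B.min' hBne := by
          have h1 : C.min' hCne ∈ Finset.Icc (B.min' hBne) (B.max' hBne) := by
            rw [← h]; exact Finset.left_mem_Icc.2 (C.min'_le_max' hCne)
          have h2 : B.min' hBne ∈ Finset.Icc (C.min' hCne) (C.max' hCne) := by
            rw [h]; exact Finset.left_mem_Icc.2 (B.min'_le_max' hBne)
          exact le_antisymm (Finset.mem_Icc.1 h2).1 (Finset.mem_Icc.1 h1).1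
        exact P.eq_of_mem_parts hC hB (C.min'_mem hCne) (hmin ▸ B.min'_mem hBne)
      · exact Or.inr ⟨hC, h⟩
    · rintro (rfl | ⟨hC, h⟩)
      · exact ⟨hB, subset_rfl⟩
      · exact ⟨hC, h.subset⟩
  rw [key, Finset.sum_insert (by simp), blockRank,
    Finset.sum_attach _ (fun C => blockRank a b P C)]
  ring

end Rank

/-- An `a,b`-noncrossing parking function `(π, f)`: the partition `π` is `a,b`-noncrossing and the
labeling `f` attaches to every block `B` of `π` a set `f B` of `rank B` labels, so that the label
set `[a]` (here `Fin a`) is the disjoint union of the `f B`. The labeling is extended by `∅` to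
subsets that are not blocks, so that it carries no other information than its values on blocks. -/
@[ext]
structure NCParkingFunction (a b : ℕ) where
  part : Finpartition (Finset.univ : Finset (Fin (b - 1)))
  label : Finset (Fin (b - 1)) → Finset (Fin a)
  part_mem : part ∈ RationalNC a b
  label_cover : ∀ i : Fin a, ∃! B, B ∈ part.parts ∧ i ∈ label B
  label_card : ∀ B ∈ part.parts, ((label B).card : ℤ) = blockRank a b part B
  label_of_notMem : ∀ B, B ∉ part.parts → label B = ∅

/-- The rotation `i ↦ i + 1`, `n ↦ 1` acting on subsets. -/
def rotSubset {n : ℕ} (B : Finset (Fin n)) : Finset (Fin n) :=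
  B.map (finRotate n).toEmbedding

/-- The representation of the symmetric group on `ℂ^a` that permutes the standard basis:
`w e_i = e_{w i}`. -/
noncomputable def coordinateRep (a : ℕ) :
    Representation ℂ (Equiv.Perm (Fin a)) (Fin a → ℂ) where
  toFun w := LinearMap.funLeft ℂ ℂ (w⁻¹ : Equiv.Perm (Fin a))
  map_one' := by ext; simp [LinearMap.funLeft]
  map_mul' w w' := by ext; simp [LinearMap.funLeft]

/-- The reflection representation `V = ℂ^a / ⟨(1, …, 1)⟩` of the symmetric group. -/
noncomputable def reflectionRep (a : ℕ) :
    Representation ℂ (Equiv.Perm (Fin a))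
      ((Fin a → ℂ) ⧸ Submodule.span ℂ {(fun _ => 1 : Fin a → ℂ)}) :=
  (coordinateRep a).quotient (Submodule.span ℂ {(fun _ => 1 : Fin a → ℂ)}) (by
    intro w
    rw [Submodule.span_le, Set.singleton_subset_iff]
    exact Submodule.subset_span rfl)

/-- The multiplicity of `μ` as an eigenvalue of `w` on the reflection representation (the action
of `w` has finite order, hence is diagonalizable, and this is the dimension of the eigenspace). -/
noncomputable def reflectionMult {a : ℕ} (w : Equiv.Perm (Fin a)) (μ : ℂ) : ℕ :=
  Module.finrank ℂ (Module.End.eigenspace (reflectionRep a w) μ)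

/-!
Write `n = b - 1`, and let a *labelling* give each of the `a` labels a position modulo `n`, or no
position at all. The walk on `ℤ` that goes up by `b` for each label at a position and down by `a` at
every step codes a plane forest, whose sibling relation is `n`-periodic and noncrossing. For the
parking function of a Dyck path the walk is the height of the path above the diagonal, the laser
fired from a valley encloses the descendants of that position, and the sibling relation is the
partition of the path (`toPartition_eq_treePart`).

The partitions that arise are characterised by the condition `IsRationalNC`: a gap of length `l`
between cyclically consecutive elements of a block carries `⌊l a / b⌋` labels. It makes no reference
to a first label, so rational noncrossing partitions are closed under rotation, and the ranks, which
count the labels of the blocks (`blockRank_eq`), are invariant. This gives the action.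

Conversely, the relation is recovered from any labelling that puts the labels of each block at the
beginning of a suitable cluster of the block (`IsCenter.treeRel_iff`). This is used for two choices
of clusters.

* If the rotation by `e` is nontrivial and fixes the partition, at most one block is invariant, and
  every other block has a gap longer than half a period, after which its cluster begins. The labels
  of the invariant block get no position. So the fixed points of `w` and this rotation are the
  labellings that are equivariant for `w` and the rotation (`card_fixed_of_rotation`).
* If the rotation is trivial, clusters begin at block minima, and the fixed points are the rational
  parking functions that are constant on the cycles of `w` (`card_fixed_of_no_rotation`). By the
  cycle lemma these are the fraction `1 / b` of all labellings that are constant on the cycles of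
  `w` (`card_isDyck_mul`).

Equivariant labellings are chosen cycle by cycle: there are `b` choices on a cycle of length `l` if
`l` rotations are trivial, and one otherwise (`card_equivariant_labelling`). The same decomposition
shows that the cycles of the first kind count the multiplicity of the eigenvalue `ζ ^ d` on `ℂ ^ a`,
and passing to the reflection representation lowers it by one exactly for the eigenvalue `1`
(`reflectionMult_of_ne_one`, `reflectionMult_one`).
-/

/-! ### Periodic walks on the integers -/

/-- The standing assumptions: `a < b` are coprime and positive, and `n = b - 1` is the number of
labels. -/
structure RationalParams (a b n : ℕ) : Prop where
  pos : 0 < a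
  lt : a < b
  coprime : Nat.Coprime a b
  eq : b = n + 1

/-- `V` is a walk with increments `b * c x - a`, where the counts `c` have period `n` and add up
to at most `a` over a period. -/
structure PeriodicWalk (a b n : ℕ) (c : ℤ → ℕ) (V : ℤ → ℤ) : Prop where
  step : ∀ x, V x = V (x - 1) + b * c x - a
  periodic : ∀ x, c (x + n) = c x
  total_le : ∑ z ∈ Finset.Ico (0 : ℤ) n, c z ≤ a

/-- The position `p` encloses the later position `x` if the walk stays above its value at `p` up
to `x`: in terms of paths, `x` lies between the path and the laser fired from `p`. -/
def Enc (V : ℤ → ℤ) (p x : ℤ) : Prop :=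
  p < x ∧ ∀ y, p < y → y ≤ x → V p < V y

/-- Two positions are enclosed by the same positions. -/
def SameEnc (V : ℤ → ℤ) (x y : ℤ) : Prop := ∀ p, Enc V p x ↔ Enc V p y

/-- A position that no position encloses. For a periodic walk these are the strict left-to-right
minima. -/
def IsRoot (V : ℤ → ℤ) (x : ℤ) : Prop := ∀ p, ¬ Enc V p x

/-- `p` is the nearest position on the left of `x` at which the walk is lower: the parent of `x`
in the plane forest that the walk codes. -/
def IsParent (V : ℤ → ℤ) (p x : ℤ) : Prop :=
  p < x ∧ V p < V x ∧ ∀ y, p < y → y < x → V x < V y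

namespace RationalParams

variable {a b n : ℕ}

theorem n_pos (h : RationalParams a b n) : 0 < n := by
  have := h.pos; have := h.lt; have := h.eq; omega

theorem not_dvd (h : RationalParams a b n) {e : ℤ} (he : 0 < e) (heb : e < b) :
    ¬ (b : ℤ) ∣ a * e := by
  intro hd
  have hc : IsCoprime (b : ℤ) (a : ℤ) := (Nat.isCoprime_iff_coprime.2 h.coprime).symm
  have := Int.le_of_dvd he (hc.dvd_of_dvd_mul_left hd)
  omega

theorem ne_mul (h : RationalParams a b n) {e : ℤ} (he : 0 < e) (heb : e < b) (k : ℤ) :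
    b * k ≠ a * e := fun h' => h.not_dvd he heb ⟨k, h'.symm⟩

end RationalParams

theorem Enc.of_le {V : ℤ → ℤ} {p x z : ℤ} (h : Enc V p x) (h1 : p < z) (h2 : z ≤ x) :
    Enc V p z := ⟨h1, fun y hy hyz => h.2 y hy (hyz.trans h2)⟩

theorem IsParent.enc {V : ℤ → ℤ} {p x : ℤ} (h : IsParent V p x) : Enc V p x := by
  refine ⟨h.1, fun y hy hyx => ?_⟩
  rcases hyx.lt_or_eq with h' | rfl
  · exact h.2.1.trans (h.2.2 y hy h')
  · exact h.2.1

theorem IsParent.enc_iff {V : ℤ → ℤ} {p x q : ℤ} (h : IsParent V p x) :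
    Enc V q x ↔ q = p ∨ Enc V q p := by
  constructor
  · intro hq
    rcases lt_trichotomy q p with hqp | rfl | hqp
    · exact Or.inr (hq.of_le hqp h.1.le)
    · exact Or.inl rfl
    · exact absurd (hq.2 x hq.1 le_rfl) (not_lt.2 (h.2.2 q hqp hq.1).le)
  · rintro (rfl | hq)
    · exact h.enc
    · refine ⟨hq.1.trans h.1, fun y hy hyx => ?_⟩
      rcases le_or_gt y p with hyp | hyp
      · exact hq.2 y hy hyp
      · exact (hq.2 p hq.1 le_rfl).trans (h.enc.2 y hyp hyx)

theorem IsParent.le_of_enc {V : ℤ → ℤ} {p x q : ℤ} (h : IsParent V p x) (hq : Enc V q x) :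
    q ≤ p := by
  rcases h.enc_iff.1 hq with rfl | hq
  · exact le_rfl
  · exact hq.1.le

theorem IsParent.unique {V : ℤ → ℤ} {p q x : ℤ} (h : IsParent V p x) (h' : IsParent V q x) :
    p = q := le_antisymm (h'.le_of_enc h.enc) (h.le_of_enc h'.enc)

theorem IsParent.same {V : ℤ → ℤ} {p x y : ℤ} (h : IsParent V p x) (h' : IsParent V p y) :
    SameEnc V x y := fun _ => h.enc_iff.trans h'.enc_iff.symm

theorem IsRoot.same {V : ℤ → ℤ} {x y : ℤ} (h : IsRoot V x) (h' : IsRoot V y) :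
    SameEnc V x y := fun p => iff_of_false (h p) (h' p)

theorem SameEnc.refl (V : ℤ → ℤ) (x : ℤ) : SameEnc V x x := fun _ => Iff.rfl
theorem SameEnc.symm {V : ℤ → ℤ} {x y : ℤ} (h : SameEnc V x y) : SameEnc V y x :=
  fun p => (h p).symm
theorem SameEnc.trans {V : ℤ → ℤ} {x y z : ℤ} (h : SameEnc V x y) (h' : SameEnc V y z) :
    SameEnc V x z := fun p => (h p).trans (h' p)

/-- A position between two equivalent ones that is not equivalent to them only has equivalent
positions between the two. -/
theorem SameEnc.nested {V : ℤ → ℤ} {u v w t : ℤ} (h : SameEnc V u w) (huv : u < v) (hvw : v < w)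
    (hne : ¬ SameEnc V u v) (ht : SameEnc V v t) : u < t ∧ t < w := by
  have h1 : ∀ p, Enc V p u → Enc V p v := fun p hp =>
    ((h p).1 hp).of_le (hp.1.trans huv) hvw.le
  obtain ⟨p, hpv, hpu⟩ : ∃ p, Enc V p v ∧ ¬ Enc V p u := by
    by_contra! hcon
    exact hne fun p => ⟨h1 p, hcon p⟩
  have hup : u ≤ p := by
    by_contra! hlt
    exact hpu (hpv.of_le hlt huv.le)
  have hpt := (ht p).1 hpv
  refine ⟨hup.trans_lt hpt.1, ?_⟩
  by_contra! hwt
  exact hpu ((h p).2 (hpt.of_le (hpv.1.trans hvw) hwt))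

namespace PeriodicWalk

variable {a b n : ℕ} {c : ℤ → ℕ} {V : ℤ → ℤ}

theorem sub_eq (W : PeriodicWalk a b n c V) {y x : ℤ} (hyx : y ≤ x) :
    V x - V y = b * (∑ z ∈ Finset.Ioc y x, c z : ℕ) - a * (x - y) := by
  induction x, hyx using Int.leInduction with
  | base => simp
  | succ x hx ih =>
    have h1 : Finset.Ioc y (x + 1) = insert (x + 1) (Finset.Ioc y x) := by
      ext z; simp only [Finset.mem_Ioc, Finset.mem_insert]; omega
    rw [h1, Finset.sum_insert (by simp), W.step (x + 1), add_sub_cancel_right]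
    push_cast at ih ⊢
    linarith

theorem ne_of_lt (W : PeriodicWalk a b n c V) (h : RationalParams a b n) {y x : ℤ} (hyx : y < x)
    (hx : x - y < b) : V y ≠ V x := by
  intro he
  have := W.sub_eq hyx.le
  exact h.ne_mul (e := x - y) (by omega) hx (∑ z ∈ Finset.Ioc y x, c z : ℕ) (by linarith)

/-- A walk whose counts have a period `e < b` is shifted by a constant over that period. The
constant is nonzero because `a` and `b` are coprime. -/
theorem exists_shift (W : PeriodicWalk a b n c V) (h : RationalParams a b n) {e : ℤ} (he : 0 < e)
    (heb : e < b) (hper : ∀ x, c (x + e) = c x) :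
    ∃ δ : ℤ, δ ≠ 0 ∧ ∀ x, V (x + e) = V x + δ := by
  have hstep : ∀ x, V (x + 1 + e) - V (x + 1) = V (x + e) - V x := by
    intro x
    rw [W.step (x + 1 + e), W.step (x + 1), show x + 1 + e = (x + 1) + e by ring, hper,
      show x + 1 + e - 1 = x + e by ring, show x + 1 - 1 = x by ring]
    ring
  have hconst : ∀ x, V (x + e) - V x = V (0 + e) - V 0 := by
    intro x
    induction x using Int.induction_on with
    | zero => rfl
    | succ i ih => rw [hstep, ih]
    | pred i ih => rw [← ih, ← hstep (-(i : ℤ) - 1)]; simp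
  refine ⟨V (0 + e) - V 0, fun h0 => ?_, fun x => by rw [← hconst x]; ring⟩
  refine W.ne_of_lt h (y := 0) (x := e) he (by omega) ?_
  rw [zero_add] at h0
  omega

theorem exists_shift_n (W : PeriodicWalk a b n c V) (h : RationalParams a b n) :
    ∃ δ : ℤ, δ ≠ 0 ∧ δ ≤ a ∧ ∀ x, V (x + n) = V x + δ := by
  obtain ⟨δ, h0, hδ⟩ := W.exists_shift h (e := n) (by exact_mod_cast h.n_pos)
    (by have := h.eq; omega) W.periodic
  refine ⟨δ, h0, ?_, hδ⟩
  have h1 := W.sub_eq (y := -1) (x := n - 1) (by have := h.n_pos; omega)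
  have h2 := hδ (-1)
  have h3 : Finset.Ioc (-1 : ℤ) (n - 1) = Finset.Ico (0 : ℤ) n := by
    ext z; simp only [Finset.mem_Ioc, Finset.mem_Ico]; omega
  rw [h3] at h1
  have h4 : ((∑ z ∈ Finset.Ico (0 : ℤ) n, c z : ℕ) : ℤ) ≤ a := by exact_mod_cast W.total_le
  have h5 : (b : ℤ) = n + 1 := by exact_mod_cast h.eq
  rw [show (-1 : ℤ) + n = n - 1 by ring] at h2
  have h6 : (b : ℤ) * (∑ z ∈ Finset.Ico (0 : ℤ) n, c z : ℕ) ≤ b * a :=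
    mul_le_mul_of_nonneg_left h4 (by positivity)
  rw [h5] at h1 h6
  linarith

/-- Equal values of the walk do not interfere with nearest smaller values. -/
theorem exists_lt_of_eq (W : PeriodicWalk a b n c V) (h : RationalParams a b n) {z x : ℤ}
    (hzx : z < x) (he : V z = V x) : ∃ y, z < y ∧ y < x ∧ V y < V x := by
  obtain ⟨δ, h0, -, hδ⟩ := W.exists_shift_n h
  have hbig : ¬ x - z < b := fun hlt => W.ne_of_lt h hzx hlt he
  have hn := h.n_pos
  have hb := h.eq
  rcases lt_or_gt_of_ne h0 with hneg | hpos
  · exact ⟨z + n, by omega, by omega, by rw [hδ]; omega⟩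
  · refine ⟨x - n, by omega, by omega, ?_⟩
    have := hδ (x - n)
    rw [sub_add_cancel] at this
    omega

/-- Any earlier position at which the walk is not higher forces a parent: the walk never returns to
the same value without going below it in between. -/
theorem exists_isParent (W : PeriodicWalk a b n c V) (h : RationalParams a b n) {z x : ℤ}
    (hzx : z < x) (hle : V z ≤ V x) : ∃ p, z ≤ p ∧ IsParent V p x := by
  have hne : ((Finset.Ico z x).filter fun p => V p ≤ V x).Nonempty :=
    ⟨z, by simp [hzx, hle]⟩
  obtain ⟨p, hp, hmax⟩ := Finset.exists_max_image _ id hne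
  simp only [Finset.mem_filter, Finset.mem_Ico, id] at hp hmax
  have hafter : ∀ y, p < y → y < x → V x < V y := by
    intro y h1 h2
    by_contra! h3
    have := hmax y ⟨⟨by omega, h2⟩, h3⟩
    omega
  refine ⟨p, hp.1.1, hp.1.2, lt_of_le_of_ne hp.2 fun he => ?_, hafter⟩
  obtain ⟨y, h1, h2, h3⟩ := W.exists_lt_of_eq h hp.1.2 he
  exact absurd h3 (hafter y h1 h2).not_gt

theorem lt_of_same (W : PeriodicWalk a b n c V) (h : RationalParams a b n) {y x z : ℤ}
    (hs : SameEnc V y x) (hz : y ≤ z) (hzx : z < x) : V x < V z := by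
  by_contra! hle
  obtain ⟨p, hzp, hp⟩ := W.exists_isParent h hzx hle
  have := ((hs p).2 hp.enc).1
  omega

theorem isRoot_iff (W : PeriodicWalk a b n c V) (h : RationalParams a b n) {x : ℤ} :
    IsRoot V x ↔ ∀ y, y < x → V x < V y := by
  constructor
  · intro hr y hy
    by_contra! hle
    obtain ⟨p, -, hp⟩ := W.exists_isParent h hy hle
    exact hr p hp.enc
  · intro hr p hp
    exact absurd (hp.2 x hp.1 le_rfl) (hr p hp.1).not_gt

theorem isRoot_or (W : PeriodicWalk a b n c V) (h : RationalParams a b n) (x : ℤ) :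
    IsRoot V x ∨ ∃ p, IsParent V p x := by
  by_cases hr : IsRoot V x
  · exact Or.inl hr
  · simp only [IsRoot, not_forall, not_not] at hr
    obtain ⟨p, hp⟩ := hr
    obtain ⟨q, -, hq⟩ := W.exists_isParent h hp.1 (hp.2 x hp.1 le_rfl).le
    exact Or.inr ⟨q, hq⟩

/-- Equivalent positions are siblings in the forest. -/
theorem isParent_of_same (W : PeriodicWalk a b n c V) (h : RationalParams a b n) {p x y : ℤ}
    (hs : SameEnc V x y) (hp : IsParent V p x) : IsParent V p y := by
  have h1 := (hs p).1 hp.enc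
  obtain ⟨q, hpq, hq⟩ := W.exists_isParent h h1.1 (h1.2 y h1.1 le_rfl).le
  have := hp.le_of_enc ((hs q).2 hq.enc)
  obtain rfl : p = q := by omega
  exact hq

/-- The children of `p` lie at distance at most `e` from `p`, for any period `e < b`. -/
theorem le_add_of_isParent (W : PeriodicWalk a b n c V) (h : RationalParams a b n) {e : ℤ}
    (he : 0 < e) (heb : e < b) (hper : ∀ x, c (x + e) = c x) {p x : ℤ} (hp : IsParent V p x) :
    x ≤ p + e := by
  obtain ⟨δ, h0, hδ⟩ := W.exists_shift h he heb hper
  by_contra! hlt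
  rcases lt_or_gt_of_ne h0 with hneg | hpos
  · have h1 := hp.2.2 (p + e) (by omega) hlt
    have h2 := hp.2.1
    rw [hδ] at h1
    omega
  · have h1 := hp.2.2 (x - e) (by omega) (by omega)
    have h2 := hδ (x - e)
    rw [sub_add_cancel] at h2
    omega

/-- A position that carries a label is the first child of its predecessor. -/
theorem isParent_pred (W : PeriodicWalk a b n c V) (h : RationalParams a b n) {p : ℤ}
    (hc : 0 < c p) : IsParent V (p - 1) p := by
  refine ⟨by omega, ?_, fun y h1 h2 => by omega⟩
  have h1 := W.step p
  have h2 : (b : ℤ) * 1 ≤ b * c p :=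
    mul_le_mul_of_nonneg_left (by exact_mod_cast hc) (by positivity)
  have := h.lt
  omega

theorem count_eq_zero (W : PeriodicWalk a b n c V) (h : RationalParams a b n) {x : ℤ}
    (hlt : V x < V (x - 1)) : c x = 0 := by
  by_contra h0
  have := (W.isParent_pred h (Nat.pos_of_ne_zero h0)).2.1
  omega

section Translate

theorem enc_translate {e δ : ℤ} (hδ : ∀ x, V (x + e) = V x + δ) {p x : ℤ} :
    Enc V (p + e) (x + e) ↔ Enc V p x := by
  constructor
  · rintro ⟨h1, h2⟩
    refine ⟨by omega, fun y hy hyx => ?_⟩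
    have := h2 (y + e) (by omega) (by omega)
    rw [hδ, hδ] at this
    omega
  · rintro ⟨h1, h2⟩
    refine ⟨by omega, fun y hy hyx => ?_⟩
    have := h2 (y - e) (by omega) (by omega)
    have h3 := hδ (y - e)
    rw [sub_add_cancel] at h3
    rw [hδ, h3]
    omega

end Translate

theorem shift_mul {e δ : ℤ} (hδ : ∀ x, V (x + e) = V x + δ) (k : ℤ) :
    ∀ x, V (x + k * e) = V x + k * δ := by
  induction k using Int.induction_on with
  | zero => simp
  | succ i ih => intro x; rw [add_mul, one_mul, ← add_assoc, hδ, ih]; ring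
  | pred i ih =>
    intro x
    have := hδ (x + (-(i : ℤ) - 1) * e)
    rw [show x + (-(i : ℤ) - 1) * e + e = x + (-(i : ℤ)) * e by ring, ih] at this
    linarith

theorem enc_add (W : PeriodicWalk a b n c V) (h : RationalParams a b n) (k : ℤ) {p x : ℤ} :
    Enc V (p + k * n) (x + k * n) ↔ Enc V p x := by
  obtain ⟨δ, -, -, hδ⟩ := W.exists_shift_n h
  exact enc_translate (shift_mul hδ k)

theorem same_add (W : PeriodicWalk a b n c V) (h : RationalParams a b n) (k : ℤ) {x y : ℤ} :
    SameEnc V (x + k * n) (y + k * n) ↔ SameEnc V x y := by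
  constructor
  · intro hs p
    rw [← W.enc_add h k, hs, W.enc_add h k]
  · intro hs p
    have := hs (p - k * n)
    rwa [← W.enc_add h k, ← W.enc_add h k (x := y), sub_add_cancel] at this

theorem isParent_add (W : PeriodicWalk a b n c V) (h : RationalParams a b n) (k : ℤ) {p x : ℤ}
    (hp : IsParent V p x) : IsParent V (p + k * n) (x + k * n) := by
  obtain ⟨δ, -, -, hδ⟩ := W.exists_shift_n h
  have h1 := shift_mul hδ k
  refine ⟨by have := hp.1; omega, by rw [h1, h1]; have := hp.2.1; omega, fun y hy hyx => ?_⟩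
  have h2 := hp.2.2 (y - k * n) (by omega) (by omega)
  have h3 := h1 (y - k * n)
  rw [sub_add_cancel] at h3
  rw [h1, h3]
  omega

theorem isRoot_add (W : PeriodicWalk a b n c V) (h : RationalParams a b n) (k : ℤ) {x : ℤ}
    (hx : IsRoot V x) : IsRoot V (x + k * n) := by
  intro p hp
  rw [← sub_add_cancel p (k * n), W.enc_add h] at hp
  exact hx _ hp

end PeriodicWalk

/-! ### Rational noncrossing relations on the integers -/

open Classical in
/-- The number of labels in the classes that meet the open interval from `y` to `x`; the label `i`
belongs to the class of `κ i`. -/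
noncomputable def gapCount {a : ℕ} (R : ℤ → ℤ → Prop) (κ : Fin a → ℤ) (y x : ℤ) : ℕ :=
  (Finset.univ.filter fun i => ∃ z, y < z ∧ z < x ∧ R (κ i) z).card

open Classical in
/-- The number of labels in the classes that meet the closed interval from `y` to `x`. -/
noncomputable def hullCount {a : ℕ} (R : ℤ → ℤ → Prop) (κ : Fin a → ℤ) (y x : ℤ) : ℕ :=
  (Finset.univ.filter fun i => ∃ z, y ≤ z ∧ z ≤ x ∧ R (κ i) z).card

/-- An `n`-periodic equivalence relation on `ℤ` that descends to a noncrossing partition of the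
cyclically ordered set `ℤ / n`. -/
structure IsNoncrossing (n : ℕ) (R : ℤ → ℤ → Prop) : Prop where
  equiv : Equivalence R
  per : ∀ x : ℤ, R x (x + n)
  noncrossing : ∀ y z x t : ℤ, y < z → z < x → x < t → t < y + n → R y x → R z t → R y z

/-- The rotation-invariant description of a rational noncrossing partition with `a` labels
distributed over its classes: the gap between two cyclically consecutive elements `y < x` of a
class carries exactly `⌊(x - y) a / b⌋` labels. -/
structure IsRationalNC (a b n : ℕ) (R : ℤ → ℤ → Prop) (κ : Fin a → ℤ) : Prop
    extends IsNoncrossing n R where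
  gap_le : ∀ y x : ℤ, y < x → R y x → (∀ z, y < z → z < x → ¬ R y z) →
    (b : ℤ) * gapCount R κ y x ≤ a * (x - y)
  gap_lt : ∀ y x : ℤ, y < x → R y x → (∀ z, y < z → z < x → ¬ R y z) →
    a * (x - y) < (b : ℤ) * gapCount R κ y x + b

namespace IsNoncrossing

variable {a n : ℕ} {R : ℤ → ℤ → Prop}

theorem rel_add (G : IsNoncrossing n R) (k x : ℤ) : R x (x + k * n) := by
  induction k using Int.induction_on with
  | zero => simpa using G.equiv.refl x
  | succ i ih =>
    have := G.equiv.trans ih (G.per _)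
    rwa [show x + (i : ℤ) * n + n = x + ((i : ℤ) + 1) * n by ring] at this
  | pred i ih =>
    have := G.per (x + (-(i : ℤ) - 1) * n)
    rw [show x + (-(i : ℤ) - 1) * n + n = x + (-(i : ℤ)) * n by ring] at this
    exact G.equiv.trans ih (G.equiv.symm this)

theorem le_add_of_gap (G : IsNoncrossing n R) (hn : 0 < n) {y x : ℤ}
    (hgap : ∀ z, y < z → z < x → ¬ R y z) : x ≤ y + n := by
  by_contra! hlt
  exact hgap (y + n) (by omega) hlt (G.per y)

/-- A class that meets the gap between consecutive elements of another class lies in that gap, up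
to translation. -/
theorem exists_translate_mem_gap (G : IsNoncrossing n R) (hn : 0 < n) {y x z t : ℤ}
    (hyx : R y x) (hgap : ∀ z, y < z → z < x → ¬ R y z) (h1 : y < z)
    (h2 : z < x) (hzt : R z t) : ∃ k : ℤ, y < t + k * n ∧ t + k * n < x := by
  have hxn := G.le_add_of_gap hn hgap
  have hn' : (0 : ℤ) < n := by exact_mod_cast hn
  refine ⟨-((t - y) / n), ?_⟩
  have h3 : t + -((t - y) / n) * n = y + (t - y) % n := by
    have := Int.emod_add_mul_ediv (t - y) n
    linarith
  have h4 : R z (y + (t - y) % n) := h3 ▸ G.equiv.trans hzt (G.rel_add _ t)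
  have h5 := Int.emod_nonneg (t - y) hn'.ne'
  have h6 := Int.emod_lt_of_pos (t - y) hn'
  rw [h3]
  set u := y + (t - y) % n
  refine ⟨lt_of_le_of_ne (by omega) fun he => ?_, ?_⟩
  · exact hgap z h1 h2 (G.equiv.symm (he ▸ h4))
  · by_contra! hxu
    rcases hxu.lt_or_eq with hlt | he
    · exact hgap z h1 h2 (G.noncrossing y z x u h1 h2 hlt (by omega) hyx h4)
    · exact hgap z h1 h2 (G.equiv.trans hyx (he ▸ G.equiv.symm h4))

/-- Cyclically, the classes outside the gap that follows `y` are those that meet the interval from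
the first element `f` to the last element `y` of a period of the class. -/
theorem gapCount_add_hullCount (G : IsNoncrossing n R) (κ : Fin a → ℤ) (hn : 0 < n) {f y : ℤ}
    (hfy : f ≤ y) (hR : R f y) (hgap : ∀ z, y < z → z < f + n → ¬ R y z) :
    gapCount R κ y (f + n) + hullCount R κ f y = a := by
  classical
  have hn' : (0 : ℤ) < n := by exact_mod_cast hn
  have key : (Finset.univ.filter fun i => ∃ z, f ≤ z ∧ z ≤ y ∧ R (κ i) z) =
      Finset.univ.filter fun i => ¬ ∃ z, y < z ∧ z < f + n ∧ R (κ i) z := by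
    ext i
    simp only [Finset.mem_filter, Finset.mem_univ, true_and]
    constructor
    · rintro ⟨z, h1, h2, h3⟩ ⟨t, h4, h5, h6⟩
      obtain ⟨k, h7, h8⟩ := G.exists_translate_mem_gap hn
        (G.equiv.trans (G.equiv.symm hR) (G.per f)) hgap h4 h5
        (G.equiv.trans (G.equiv.symm h6) h3)
      rcases lt_trichotomy k 0 with hk | rfl | hk
      · nlinarith
      · omega
      · nlinarith
    · intro hno
      have h3 : κ i + -((κ i - f) / n) * n = f + (κ i - f) % n := by
        have := Int.emod_add_mul_ediv (κ i - f) n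
        linarith
      have h4 : R (κ i) (f + (κ i - f) % n) := h3 ▸ G.rel_add _ _
      have h5 := Int.emod_nonneg (κ i - f) hn'.ne'
      have h6 := Int.emod_lt_of_pos (κ i - f) hn'
      refine ⟨_, by omega, ?_, h4⟩
      by_contra! hlt
      exact hno ⟨_, hlt, by omega, h4⟩
  have h1 := Finset.card_filter_add_card_filter_not (s := (Finset.univ : Finset (Fin a)))
    (fun i => ∃ z, y < z ∧ z < f + n ∧ R (κ i) z)
  rw [gapCount, hullCount, key, h1, Finset.card_univ, Fintype.card_fin]

end IsNoncrossing

namespace IsRationalNC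

variable {a b n : ℕ} {R : ℤ → ℤ → Prop} {κ : Fin a → ℤ}

/-- The condition on the gap from `y` to `f + n`, read on the complementary interval from `f` to
`y`, which then carries `⌈(y - f + 1) a / b⌉` labels. This uses that `n + 1 = b`. -/
theorem lt_hullCount (h : RationalParams a b n) (G : IsRationalNC a b n R κ) {f y : ℤ}
    (hfy : f ≤ y) (hyn : y < f + n) (hR : R f y) (hgap : ∀ z, y < z → z < f + n → ¬ R y z) :
    a * (y - f + 1) < (b : ℤ) * hullCount R κ f y ∧
    (b : ℤ) * hullCount R κ f y < a * (y - f + 1) + b := by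
  have h1 := G.gapCount_add_hullCount κ h.n_pos hfy hR hgap
  have hR' := G.equiv.trans (G.equiv.symm hR) (G.per f)
  have h2 := G.gap_le y (f + n) (by omega) hR' hgap
  have h3 := G.gap_lt y (f + n) (by omega) hR' hgap
  have h4 := h.ne_mul (e := f + n - y) (by omega) (by have := h.eq; omega)
    (gapCount R κ y (f + n))
  have h5 : (hullCount R κ f y : ℤ) = a - gapCount R κ y (f + n) := by omega
  have h6 : (b : ℤ) = n + 1 := by exact_mod_cast h.eq
  have h7 := lt_of_le_of_ne h2 h4
  rw [h5]
  have h8 : (b : ℤ) * a = n * a + a := by rw [h6]; ring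
  constructor <;> nlinarith

end IsRationalNC

/-! ### The noncrossing relation of a labelling -/

/-- Reduction of an integer to a label. -/
def lab (n : ℕ) [NeZero n] (x : ℤ) : Fin n := Fin.ofNat n (x % n).toNat

section Lab

variable {n : ℕ} [NeZero n]

theorem lab_val (x : ℤ) : ((lab n x : ℕ) : ℤ) = x % n := by
  have hn : (0 : ℤ) < n := by exact_mod_cast Nat.pos_of_ne_zero (NeZero.ne n)
  have h1 := Int.emod_nonneg x hn.ne'
  have h2 := Int.emod_lt_of_pos x hn
  rw [lab, Fin.val_ofNat, Nat.mod_eq_of_lt (by omega), Int.toNat_of_nonneg h1]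

@[simp] theorem lab_coe (i : Fin n) : lab n ((i : ℕ) : ℤ) = i := by
  apply Fin.ext
  have h := lab_val (n := n) ((i : ℕ) : ℤ)
  rw [Int.emod_eq_of_lt (by positivity) (by exact_mod_cast i.2)] at h
  exact_mod_cast h

theorem lab_eq_iff {x y : ℤ} : lab n x = lab n y ↔ ∃ k : ℤ, x = y + k * n := by
  rw [Fin.ext_iff, ← Int.natCast_inj, lab_val, lab_val]
  constructor
  · intro h
    have h1 := Int.emod_add_mul_ediv x n
    have h2 := Int.emod_add_mul_ediv y n
    exact ⟨x / n - y / n, by rw [h] at h1; linarith⟩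
  · rintro ⟨k, rfl⟩
    simp

theorem lab_eq_coe_iff {x : ℤ} {i : Fin n} : lab n x = i ↔ ∃ k : ℤ, x = (i : ℕ) + k * n := by
  rw [← lab_eq_iff, lab_coe]

theorem lab_add_mul (x k : ℤ) : lab n (x + k * n) = lab n x := lab_eq_iff.2 ⟨k, rfl⟩

theorem lab_add (x : ℤ) : lab n (x + n) = lab n x := lab_eq_iff.2 ⟨1, by ring⟩

theorem lab_injOn {x y : ℤ} (h : lab n x = lab n y) (h1 : x - y < n) (h2 : y - x < n) :
    x = y := by
  obtain ⟨k, rfl⟩ := lab_eq_iff.1 h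
  rcases lt_trichotomy k 0 with hk | rfl | hk
  · nlinarith
  · simp
  · nlinarith

end Lab

section Labelling

variable {a n : ℕ} [NeZero n]

/-- A labelling sends each of the `a` labels to a position modulo `n`, or to no position: then
it will be attached to the central block. This is the number of labels at `x`. -/
def labelCount (F : Fin a → Option (Fin n)) (x : ℤ) : ℕ :=
  (Finset.univ.filter fun i => F i = some (lab n x)).card

/-- The walk of a labelling, with value `0` at `-1`. -/
noncomputable def labelWalk (b : ℕ) (F : Fin a → Option (Fin n)) (x : ℤ) : ℤ :=
  b * ((∑ z ∈ Finset.Ioc (-1) x, labelCount F z : ℕ) -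
    (∑ z ∈ Finset.Ioc x (-1), labelCount F z : ℕ)) - a * (x + 1)

theorem sum_labelCount (F : Fin a → Option (Fin n)) {s : Finset ℤ}
    (hs : ∀ x ∈ s, ∀ y ∈ s, x - y < n) :
    ∑ z ∈ s, labelCount F z =
      (Finset.univ.filter fun i => ∃ z ∈ s, F i = some (lab n z)).card := by
  have h1 : (Finset.univ.filter fun i => ∃ z ∈ s, F i = some (lab n z)) =
      s.biUnion fun z => Finset.univ.filter fun i => F i = some (lab n z) := by
    ext i; simp
  rw [h1, Finset.card_biUnion]
  · rfl
  · intro x hx y hy hxy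
    rw [Function.onFun, Finset.disjoint_filter]
    intro i _ h2 h3
    exact hxy (lab_injOn (Option.some.inj (h2.symm.trans h3)) (hs x hx y hy) (hs y hy x hx))

theorem labelWalk_isWalk (b : ℕ) (F : Fin a → Option (Fin n)) :
    PeriodicWalk a b n (labelCount F) (labelWalk b F) where
  step x := by
    rw [labelWalk, labelWalk]
    rcases le_or_gt 0 x with hx | hx
    · have h1 : Finset.Ioc (-1) x = insert x (Finset.Ioc (-1) (x - 1)) := by
        ext z; simp only [Finset.mem_Ioc, Finset.mem_insert]; omega
      rw [h1, Finset.sum_insert (by simp), Finset.Ioc_eq_empty (a := x) (by omega),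
        Finset.Ioc_eq_empty (a := x - 1) (by omega)]
      push_cast
      ring
    · have h1 : Finset.Ioc (x - 1) (-1) = insert x (Finset.Ioc x (-1)) := by
        ext z; simp only [Finset.mem_Ioc, Finset.mem_insert]; omega
      rw [h1, Finset.sum_insert (by simp), Finset.Ioc_eq_empty (a := -1) (b := x) (by omega),
        Finset.Ioc_eq_empty (a := -1) (b := x - 1) (by omega)]
      push_cast
      ring
  periodic x := by rw [labelCount, lab_add]; rfl
  total_le := by
    rw [sum_labelCount F (by intro x hx y hy; rw [Finset.mem_Ico] at hx hy; omega)]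
    exact (Finset.card_le_univ _).trans_eq (Fintype.card_fin a)

theorem labelWalk_neg_one (b : ℕ) (F : Fin a → Option (Fin n)) : labelWalk b F (-1) = 0 := by
  simp [labelWalk]

end Labelling

/-! ### The noncrossing relation of a labelling satisfies the gap conditions -/

/-- Two positions are related if translates of them by multiples of `n` are enclosed by the same
positions. -/
def TreeRel (n : ℕ) (V : ℤ → ℤ) (x y : ℤ) : Prop := ∃ k : ℤ, SameEnc V x (y + k * n)

namespace PeriodicWalk

variable {a b n : ℕ} {c : ℤ → ℕ} {V : ℤ → ℤ}

theorem treeRel_of_same {x y : ℤ} (hs : SameEnc V x y) : TreeRel n V x y := ⟨0, by simpa using hs⟩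

theorem treeRel_of_lab_eq [NeZero n] {x y : ℤ} (hl : lab n x = lab n y) : TreeRel n V x y := by
  obtain ⟨k, rfl⟩ := lab_eq_iff.1 hl
  exact ⟨k, .refl V _⟩

theorem treeRel_equivalence (W : PeriodicWalk a b n c V) (h : RationalParams a b n) :
    Equivalence (TreeRel n V) where
  refl x := treeRel_of_same (.refl V x)
  symm := by
    rintro x y ⟨k, hk⟩
    refine ⟨-k, ?_⟩
    rw [← W.same_add h k, show x + -k * n + k * n = x by ring]
    exact hk.symm
  trans := by
    rintro x y z ⟨k, hk⟩ ⟨l, hl⟩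
    refine ⟨l + k, ?_⟩
    rw [add_mul, ← add_assoc]
    exact hk.trans ((W.same_add h k).2 hl)

theorem isRoot_of_treeRel (W : PeriodicWalk a b n c V) (h : RationalParams a b n) {x y : ℤ}
    (hx : IsRoot V x) (hR : TreeRel n V x y) : IsRoot V y := by
  obtain ⟨k, hk⟩ := hR
  have h1 : IsRoot V (y + k * n) := fun p hp => hx p ((hk p).2 hp)
  have := W.isRoot_add h (-k) h1
  rwa [show y + k * n + -k * n = y by ring] at this

theorem le_add_n_of_isParent (W : PeriodicWalk a b n c V) (h : RationalParams a b n) {p x : ℤ}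
    (hp : IsParent V p x) : x ≤ p + n :=
  W.le_add_of_isParent h (by exact_mod_cast h.n_pos) (by have := h.eq; omega) W.periodic hp

/-- Two related positions within one period are equivalent, unless they are only so after moving the
later one back by a period. -/
theorem same_or_same_of_treeRel (W : PeriodicWalk a b n c V) (h : RationalParams a b n) {y x : ℤ}
    (hyx : y < x) (hxn : x ≤ y + n) (hR : TreeRel n V y x) :
    SameEnc V y x ∨ SameEnc V (x - n) y := by
  obtain ⟨k, hk⟩ := hR
  have hn : (0 : ℤ) < n := by exact_mod_cast h.n_pos
  rcases W.isRoot_or h y with hy | ⟨p, hp⟩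
  · exact Or.inl (hy.same (W.isRoot_of_treeRel h hy ⟨k, hk⟩))
  · have hp' := W.isParent_of_same h hk hp
    have h1 := W.le_add_n_of_isParent h hp
    have h2 := W.le_add_n_of_isParent h hp'
    have h3 := hp.1
    have h4 := hp'.1
    have h5 : k < 1 := by
      by_contra! hk1
      nlinarith
    have h6 : -2 < k := by
      by_contra! hk1
      have : k * (n : ℤ) ≤ -2 * n := mul_le_mul_of_nonneg_right hk1 hn.le
      omega
    obtain rfl | rfl : k = 0 ∨ k = -1 := by omega
    · left; simpa using hk
    · right
      rw [neg_one_mul, ← sub_eq_add_neg] at hk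
      exact hk.symm

theorem treeRel_isNoncrossing (W : PeriodicWalk a b n c V) (h : RationalParams a b n) :
    IsNoncrossing n (TreeRel n V) where
  equiv := W.treeRel_equivalence h
  per x := ⟨-1, by rw [neg_one_mul, add_neg_cancel_right]; exact .refl V x⟩
  noncrossing y z x t hyz hzx hxt htn hyx hzt := by
    have E := W.treeRel_equivalence h
    by_contra hne
    obtain ⟨l, hl⟩ := hzt
    have hn : (0 : ℤ) < n := by exact_mod_cast h.n_pos
    rcases W.same_or_same_of_treeRel h (hyz.trans hzx) (by omega) hyx with hs | hs
    · obtain ⟨h1, h2⟩ := hs.nested hyz hzx (fun h' => hne (treeRel_of_same h')) hl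
      rcases lt_trichotomy l 0 with h0 | rfl | h0
      · nlinarith
      · omega
      · nlinarith
    · have hl' : SameEnc V (t - n) (z + (-l - 1) * n) := by
        have := (W.same_add h (-l - 1)).2 hl
        rw [show t + l * n + (-l - 1) * n = t - n by ring] at this
        exact this.symm
      have hno : ¬ SameEnc V (x - n) (t - n) := by
        intro h'
        have h3 : TreeRel n V y (t - n) :=
          E.trans (E.symm (treeRel_of_same hs)) (treeRel_of_same h')
        exact hne (E.trans h3 (E.trans (treeRel_of_same hl') ⟨-l - 1, .refl V _⟩))
      obtain ⟨h1, h2⟩ := hs.nested (v := t - n) (by omega) (by omega) hno hl'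
      rcases lt_trichotomy (-l - 1) 0 with h0 | h0 | h0
      · nlinarith
      · rw [h0] at h1 h2; omega
      · nlinarith

/-- The first position after `y` at which the walk is lower than at `y` is lower by at most
`a`. -/
theorem exists_first_lt (W : PeriodicWalk a b n c V) {y x : ℤ} (hyx : y < x) (hV : V x < V y) :
    ∃ z, y < z ∧ z ≤ x ∧ V z < V y ∧ (∀ w, y < w → w < z → V y ≤ V w) ∧ V y ≤ V z + a := by
  have hne : ((Finset.Ioc y x).filter fun z => V z < V y).Nonempty := ⟨x, by simp [hyx, hV]⟩
  obtain ⟨z, hz, hmin⟩ := Finset.exists_min_image _ id hne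
  simp only [Finset.mem_filter, Finset.mem_Ioc, id] at hz hmin
  have hw : ∀ w, y < w → w < z → V y ≤ V w := by
    intro w h1 h2
    by_contra! h3
    have := hmin w ⟨⟨h1, by omega⟩, h3⟩
    omega
  refine ⟨z, hz.1.1, hz.1.2, hz.2, hw, ?_⟩
  have h1 : V y ≤ V (z - 1) := by
    rcases (show y ≤ z - 1 by omega).lt_or_eq with h2 | h2
    · exact hw _ h2 (by omega)
    · rw [← h2]
  have h3 := W.step z
  have h4 : (0 : ℤ) ≤ b * c z := by positivity
  omega

/-- Consecutive children of the same parent differ by at most one downward step. -/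
theorem le_add_of_consecutive (W : PeriodicWalk a b n c V) (h : RationalParams a b n) {y x : ℤ}
    (hyx : y < x) (hs : SameEnc V y x) (hgap : ∀ z, y < z → z < x → ¬ SameEnc V y z) :
    V y ≤ V x + a := by
  obtain ⟨z, h1, h2, h3, h4, h5⟩ := W.exists_first_lt hyx (W.lt_of_same h hs le_rfl hyx)
  rcases h2.lt_or_eq with h6 | rfl
  · refine absurd (fun q => ⟨fun hq => ((hs q).1 hq).of_le (hq.1.trans h1) h2, fun hq => ?_⟩)
      (hgap z h1 h6)
    refine hq.of_le ?_ h1.le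
    by_contra! hyq
    have h7 := hq.2 z hq.1 le_rfl
    rcases hyq.lt_or_eq with h8 | rfl
    · have := h4 q h8 hq.1
      omega
    · omega
  · exact h5

/-- The last child of `p` is higher than `p` by at most one downward step. -/
theorem le_add_of_last (W : PeriodicWalk a b n c V) (h : RationalParams a b n) {p y : ℤ}
    (hp : IsParent V p y) (hlast : ∀ z, y < z → z ≤ p + n → ¬ SameEnc V y z) :
    V y ≤ V p + a := by
  by_contra! hlt
  obtain ⟨δ, -, hδa, hδ⟩ := W.exists_shift_n h
  have h1 := W.le_add_n_of_isParent h hp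
  have h2 := hδ p
  have h3 : y < p + n := lt_of_le_of_ne h1 (by rintro rfl; omega)
  obtain ⟨z, h4, h5, h6, h7, h8⟩ := W.exists_first_lt h3 (by omega)
  refine hlast z h4 h5 (hp.same ⟨hp.1.trans h4, by omega, fun w hw hwz => ?_⟩)
  rcases lt_trichotomy w y with hwy | rfl | hwy
  · exact h6.trans (hp.2.2 w hw hwy)
  · exact h6
  · exact h6.trans_le (h7 w hwy hwz)

end PeriodicWalk

section Labelling

variable {a b n : ℕ} [NeZero n]

/-- The labels in the classes that meet a gap are those with a position in it. -/
theorem mem_gap_iff {F : Fin a → Option (Fin n)} {κ : Fin a → ℤ}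
    (h : RationalParams a b n)
    (hsome : ∀ i p, F i = some p → lab n (κ i) = p)
    (hnone : ∀ i, F i = none → IsRoot (labelWalk b F) (κ i)) {y x : ℤ}
    (hs : SameEnc (labelWalk b F) y x)
    (hgap : ∀ z, y < z → z < x → ¬ TreeRel n (labelWalk b F) y z) (i : Fin a) :
    (∃ z, y < z ∧ z < x ∧ TreeRel n (labelWalk b F) (κ i) z) ↔
      ∃ z ∈ Finset.Ioo y x, F i = some (lab n z) := by
  have W := labelWalk_isWalk b F
  have E := W.treeRel_equivalence h
  constructor
  · rintro ⟨z, h1, h2, h3⟩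
    cases hF : F i with
    | none =>
      have hz := W.isRoot_of_treeRel h (hnone i hF) h3
      rcases W.isRoot_or h y with hy | ⟨p, hp⟩
      · exact absurd (PeriodicWalk.treeRel_of_same (hy.same hz)) (hgap z h1 h2)
      · exact absurd (((hs p).1 hp.enc).of_le (hp.1.trans h1) h2.le) (hz p)
    | some p =>
      obtain ⟨k, hk⟩ := E.symm h3
      obtain ⟨h4, h5⟩ := hs.nested h1 h2
        (fun h' => hgap z h1 h2 (PeriodicWalk.treeRel_of_same h')) hk
      exact ⟨_, Finset.mem_Ioo.2 ⟨h4, h5⟩, by rw [lab_add_mul, hsome i p hF]⟩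
  · rintro ⟨z, hz, hF⟩
    rw [Finset.mem_Ioo] at hz
    exact ⟨z, hz.1, hz.2, PeriodicWalk.treeRel_of_lab_eq (hsome i _ hF)⟩

/-- The labels in the classes that meet the interval from the first to the last child of `p` are
those with a position in it. -/
theorem mem_hull_iff {F : Fin a → Option (Fin n)} {κ : Fin a → ℤ}
    (h : RationalParams a b n)
    (hsome : ∀ i p, F i = some p → lab n (κ i) = p)
    (hnone : ∀ i, F i = none → IsRoot (labelWalk b F) (κ i)) {p y : ℤ}
    (hp : IsParent (labelWalk b F) p y)
    (hlast : ∀ z, y < z → z ≤ p + n → ¬ SameEnc (labelWalk b F) y z) (i : Fin a) :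
    (∃ z, p + 1 ≤ z ∧ z ≤ y ∧ TreeRel n (labelWalk b F) (κ i) z) ↔
      ∃ z ∈ Finset.Icc (p + 1) y, F i = some (lab n z) := by
  have W := labelWalk_isWalk b F
  have E := W.treeRel_equivalence h
  constructor
  · rintro ⟨z, h1, h2, h3⟩
    cases hF : F i with
    | none =>
      exact absurd (hp.enc.of_le (by omega) h2) (W.isRoot_of_treeRel h (hnone i hF) h3 p)
    | some q =>
      have hlab : ∀ k : ℤ, lab n (κ i + k * n) = q := fun k => by rw [lab_add_mul, hsome i q hF]
      obtain ⟨k, hk⟩ := E.symm h3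
      by_cases hzy : SameEnc (labelWalk b F) z y
      · have hu := W.isParent_of_same h (hzy.symm.trans hk) hp
        have h4 := W.le_add_n_of_isParent h hu
        have h5 := hu.1
        refine ⟨κ i + k * n, Finset.mem_Icc.2 ⟨by omega, ?_⟩, by rw [hlab]⟩
        by_contra! hlt
        exact hlast _ hlt h4 (hzy.symm.trans hk)
      · have hpe := hp.enc
        have hp1 : IsParent (labelWalk b F) p (p + 1) :=
          ⟨by omega, hpe.2 _ (by omega) (by omega), fun w _ _ => by omega⟩
        have hz1 : p + 1 ≠ z := by rintro rfl; exact hzy (hp1.same hp)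
        have hz2 : z ≠ y := by rintro rfl; exact hzy (.refl _ _)
        obtain ⟨h4, h5⟩ := (hp1.same hp).nested (v := z) (by omega) (by omega)
          (fun h' => hzy (h'.symm.trans (hp1.same hp))) hk
        exact ⟨_, Finset.mem_Icc.2 ⟨h4.le, h5.le⟩, by rw [hlab]⟩
  · rintro ⟨z, hz, hF⟩
    rw [Finset.mem_Icc] at hz
    exact ⟨z, hz.1, hz.2, PeriodicWalk.treeRel_of_lab_eq (hsome i _ hF)⟩

/-- The gap conditions hold. Between consecutive siblings the walk makes at most one downward step,
and this bounds the number of labels between them; around the last gap of a family the same bound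
holds for the complement. -/
theorem treeRel_gap (h : RationalParams a b n) {F : Fin a → Option (Fin n)} {κ : Fin a → ℤ}
    (hsome : ∀ i p, F i = some p → lab n (κ i) = p)
    (hnone : ∀ i, F i = none → IsRoot (labelWalk b F) (κ i)) {y x : ℤ} (hyx : y < x)
    (hR : TreeRel n (labelWalk b F) y x)
    (hgap : ∀ z, y < z → z < x → ¬ TreeRel n (labelWalk b F) y z) :
    (b : ℤ) * gapCount (TreeRel n (labelWalk b F)) κ y x ≤ a * (x - y) ∧
    a * (x - y) < (b : ℤ) * gapCount (TreeRel n (labelWalk b F)) κ y x + b := by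
  have W := labelWalk_isWalk b F
  have N := W.treeRel_isNoncrossing h
  have hxn := N.le_add_of_gap h.n_pos hgap
  have hab := h.lt
  have hgap' : ∀ z, y < z → z < x → ¬ SameEnc (labelWalk b F) y z := fun z h1 h2 h3 =>
    hgap z h1 h2 (PeriodicWalk.treeRel_of_same h3)
  by_cases hs : SameEnc (labelWalk b F) y x
  · have h1 : gapCount (TreeRel n (labelWalk b F)) κ y x =
        ∑ z ∈ Finset.Ioo y x, labelCount F z := by
      rw [sum_labelCount F (by intro u hu v hv; rw [Finset.mem_Ioo] at hu hv; omega), gapCount]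
      congr 1
      ext i
      simp only [Finset.mem_filter, Finset.mem_univ, true_and]
      exact mem_gap_iff h hsome hnone hs hgap i
    have h2 := W.lt_of_same h hs le_rfl hyx
    have h3 := W.le_add_of_consecutive h hyx hs hgap'
    have h4 := W.sub_eq hyx.le
    have h5 : Finset.Ioc y x = insert x (Finset.Ioo y x) := by
      ext z; simp only [Finset.mem_Ioc, Finset.mem_insert, Finset.mem_Ioo]; omega
    rw [h5, Finset.sum_insert (by simp),
      W.count_eq_zero h (W.lt_of_same h hs (by omega) (by omega)), zero_add, ← h1] at h4
    constructor <;> linarith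
  · have hs' := (W.same_or_same_of_treeRel h hyx hxn hR).resolve_left hs
    rcases W.isRoot_or h y with hy | ⟨p, hp⟩
    · exact absurd (hy.same (W.isRoot_of_treeRel h hy hR)) hs
    have hpe := hp.enc
    have hpy := hp.1
    have hpn := W.le_add_n_of_isParent h hp
    have hpx := (W.isParent_of_same h hs'.symm hp).1
    have hp1 : IsParent (labelWalk b F) p (p + 1) :=
      ⟨by omega, hpe.2 _ (by omega) (by omega), fun w _ _ => by omega⟩
    -- the next element of the class is the translate of the first child of `p`
    obtain rfl : x = p + 1 + n := by
      by_contra hne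
      refine hgap (p + 1 + n) (by omega) (by omega) (N.equiv.trans ?_ (N.per _))
      exact PeriodicWalk.treeRel_of_same (hp.same hp1)
    have hlast : ∀ z, y < z → z ≤ p + n → ¬ SameEnc (labelWalk b F) y z := fun z h1 h2 =>
      hgap' z h1 (by omega)
    have h1 : hullCount (TreeRel n (labelWalk b F)) κ (p + 1) y =
        ∑ z ∈ Finset.Icc (p + 1) y, labelCount F z := by
      rw [sum_labelCount F (by intro u hu v hv; rw [Finset.mem_Icc] at hu hv; omega), hullCount]
      congr 1
      ext i
      simp only [Finset.mem_filter, Finset.mem_univ, true_and]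
      exact mem_hull_iff h hsome hnone hp hlast i
    have hR1 := PeriodicWalk.treeRel_of_same (n := n) (hp1.same hp)
    have h2 := N.gapCount_add_hullCount κ h.n_pos (f := p + 1) (y := y) (by omega) hR1
      (fun z h1 h2 h3 => hgap z h1 h2 (N.equiv.trans h3 (N.equiv.refl z)))
    have h3 := W.sub_eq hpy.le
    have h4 := W.le_add_of_last h hp hlast
    have h5 := hp.2.1
    have h6 : Finset.Ioc p y = Finset.Icc (p + 1) y := by
      ext z; simp only [Finset.mem_Ioc, Finset.mem_Icc]; omega
    rw [h6, ← h1] at h3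
    have h7 : (b : ℤ) = n + 1 := by exact_mod_cast h.eq
    have h8 : (b : ℤ) * gapCount (TreeRel n (labelWalk b F)) κ y (p + 1 + n) =
        b * a - b * hullCount (TreeRel n (labelWalk b F)) κ (p + 1) y := by
      rw [← mul_sub]; congr 1; omega
    have h9 : (b : ℤ) * a = n * a + a := by rw [h7]; ring
    constructor <;> nlinarith

/-- The relation of a labelling is rational noncrossing, if `κ` places each label in the class of
its position, or in the class of the roots if it has none. -/
theorem treeRel_isRationalNC (h : RationalParams a b n) {F : Fin a → Option (Fin n)}
    {κ : Fin a → ℤ} (hsome : ∀ i p, F i = some p → lab n (κ i) = p)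
    (hnone : ∀ i, F i = none → IsRoot (labelWalk b F) (κ i)) :
    IsRationalNC a b n (TreeRel n (labelWalk b F)) κ where
  toIsNoncrossing := (labelWalk_isWalk b F).treeRel_isNoncrossing h
  gap_le _ _ hyx hR hgap := (treeRel_gap h hsome hnone hyx hR hgap).1
  gap_lt _ _ hyx hR hgap := (treeRel_gap h hsome hnone hyx hR hgap).2

theorem sum_labelCount_lt {F : Fin a → Option (Fin n)} {i : Fin a} (hi : F i = none)
    {s : Finset ℤ} (hs : ∀ x ∈ s, ∀ y ∈ s, x - y < n) : ∑ z ∈ s, labelCount F z < a := by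
  rw [sum_labelCount F hs]
  conv_rhs => rw [← Fintype.card_fin a, ← Finset.card_univ]
  refine Finset.card_lt_card (Finset.filter_ssubset.2 ⟨i, Finset.mem_univ _, ?_⟩)
  simp [hi]

/-- A label without position gives the walk a negative drift. -/
theorem labelWalk_add_lt (h : RationalParams a b n) {F : Fin a → Option (Fin n)} {i : Fin a}
    (hi : F i = none) : ∃ δ : ℤ, δ < 0 ∧ ∀ x, labelWalk b F (x + n) = labelWalk b F x + δ := by
  have W := labelWalk_isWalk b F
  obtain ⟨δ, -, -, hδ⟩ := W.exists_shift_n h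
  refine ⟨δ, ?_, hδ⟩
  have hn := h.n_pos
  have h1 := W.sub_eq (y := -1) (x := -1 + n) (by omega)
  rw [hδ] at h1
  have h2 := sum_labelCount_lt hi (s := Finset.Ioc (-1 : ℤ) (-1 + n))
    (by intro u hu v hv; rw [Finset.mem_Ioc] at hu hv; omega)
  set m := ∑ z ∈ Finset.Ioc (-1 : ℤ) (-1 + n), labelCount F z
  have h3 : (b : ℤ) * m ≤ b * (a - 1) :=
    mul_le_mul_of_nonneg_left (by omega) (by positivity)
  have h4 : (b : ℤ) = n + 1 := by exact_mod_cast h.eq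
  have h5 := h.lt
  have h6 : (b : ℤ) * (a - 1) = a * n + a - b := by rw [h4]; ring
  have h7 : (a : ℤ) * (-1 + n - -1) = a * n := by ring
  omega

theorem exists_isRoot (h : RationalParams a b n) {F : Fin a → Option (Fin n)} {i : Fin a}
    (hi : F i = none) : ∃ x, IsRoot (labelWalk b F) x := by
  have W := labelWalk_isWalk b F
  obtain ⟨δ, hδ0, hδ⟩ := labelWalk_add_lt h hi
  have hn := h.n_pos
  have hb := h.eq
  obtain ⟨x, hx, hmin⟩ := Finset.exists_min_image (Finset.Ico (0 : ℤ) n) (labelWalk b F)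
    ⟨0, by simp [hn]⟩
  rw [Finset.mem_Ico] at hx
  refine ⟨x, (W.isRoot_iff h).2 fun y hy => ?_⟩
  have h1 := PeriodicWalk.shift_mul hδ (y / n) (y % n)
  rw [Int.emod_add_ediv_mul] at h1
  have h2 := Int.emod_nonneg y (b := n) (by omega)
  have h3 := Int.emod_lt_of_pos y (b := n) (by omega)
  have h4 := hmin (y % n) (Finset.mem_Ico.2 ⟨h2, h3⟩)
  have h5 := Int.emod_add_mul_ediv y n
  rcases lt_trichotomy (y / n) 0 with h0 | h0 | h0
  · nlinarith
  · rw [h0] at h5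
    have : y % n = y := by omega
    rw [this] at h4
    exact lt_of_le_of_ne h4 fun he => W.ne_of_lt h hy (by omega) he.symm
  · nlinarith

end Labelling

/-! ### Reconstruction of a noncrossing relation from the first elements of its clusters -/

/-- A centre of an `n`-periodic noncrossing relation: at most one class is distinguished as
central, and each other class is cut, periodically, into clusters, so that the clusters are nested
like the blocks of a linearly ordered noncrossing partition. Here `s x` is the first element of
the cluster of `x`. -/
structure IsCenter (n : ℕ) (R : ℤ → ℤ → Prop) (central : ℤ → Prop) (s : ℤ → ℤ) : Prop where
  rel_of_central : ∀ x y, central x → central y → R x y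
  central_of_rel : ∀ x y, R x y → central x → central y
  start_le : ∀ x, ¬ central x → s x ≤ x
  lt_start_add : ∀ x, ¬ central x → x < s x + n
  rel_start : ∀ x, ¬ central x → R (s x) x
  nested : ∀ x z, ¬ central x → s x ≤ z → z ≤ x → ¬ central z ∧ s x ≤ s z
  start_of_rel : ∀ x y, ¬ central x → R x y → ∃ k : ℤ, s y = s x + k * n
  start_add : ∀ x, ¬ central x → ∀ k : ℤ, s (x + k * n) = s x + k * n

theorem exists_last {Q : ℤ → Prop} {z x : ℤ} (hzx : z < x) (hz : Q z) :
    ∃ y, z ≤ y ∧ y < x ∧ Q y ∧ ∀ w, y < w → w < x → ¬ Q w := by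
  classical
  have hne : ((Finset.Ico z x).filter Q).Nonempty := ⟨z, by simp [hzx, hz]⟩
  obtain ⟨y, hy, hmax⟩ := Finset.exists_max_image _ id hne
  simp only [Finset.mem_filter, Finset.mem_Ico, id] at hy hmax
  refine ⟨y, hy.1.1, hy.1.2, hy.2, fun w h1 h2 h3 => ?_⟩
  have := hmax w ⟨⟨by omega, h2⟩, h3⟩
  omega

namespace IsCenter

variable {a b n : ℕ} {R : ℤ → ℤ → Prop} {κ : Fin a → ℤ} {central : ℤ → Prop} {s : ℤ → ℤ}

theorem not_central_of_rel (C : IsCenter n R central s) (N : IsNoncrossing n R) {x z : ℤ}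
    (hx : ¬ central x) (hR : R x z) : ¬ central z :=
  fun hz => hx (C.central_of_rel _ _ (N.equiv.symm hR) hz)

theorem start_eq (C : IsCenter n R central s) (N : IsNoncrossing n R) {x z : ℤ}
    (hx : ¬ central x) (hR : R x z) (h1 : s x ≤ z) (h2 : z < s x + n) : s z = s x := by
  obtain ⟨k, hk⟩ := C.start_of_rel x z hx hR
  have hz := C.not_central_of_rel N hx hR
  have h3 := C.start_le z hz
  have h4 := C.lt_start_add z hz
  rcases lt_trichotomy k 0 with h0 | rfl | h0
  · nlinarith
  · simpa using hk
  · nlinarith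

/-- The clusters that meet a gap between consecutive elements of a cluster start in that gap. -/
theorem lt_start_of_mem_gap (C : IsCenter n R central s) (N : IsNoncrossing n R)
    {y x z : ℤ} (hR : R y x) (hc : central x ∨ (¬ central x ∧ s x ≤ y))
    (hgap : ∀ w, y < w → w < x → ¬ R y w) (h1 : y < z) (h2 : z < x) :
    ¬ central z ∧ y < s z := by
  rcases hc with hc | ⟨hc, hsy⟩
  · have hcy := C.central_of_rel _ _ (N.equiv.symm hR) hc
    have hz : ¬ central z := fun hz => hgap z h1 h2 (C.rel_of_central _ _ hcy hz)
    refine ⟨hz, ?_⟩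
    by_contra! hle
    exact (C.nested z y hz hle h1.le).1 hcy
  · obtain ⟨hz, hsz⟩ := C.nested x z hc (hsy.trans h1.le) h2.le
    refine ⟨hz, ?_⟩
    by_contra! hle
    rcases hle.lt_or_eq with hlt | he
    · have h3 := C.lt_start_add x hc
      have h4 := N.noncrossing z x (s z + n) (y + n) h2 (by omega) (by omega) (by omega)
        (N.equiv.trans (N.equiv.symm (C.rel_start z hz)) (N.per _))
        (N.equiv.trans (N.equiv.symm hR) (N.per y))
      exact hgap z h1 h2 (N.equiv.trans hR (N.equiv.symm h4))
    · exact hgap z h1 h2 (he ▸ C.rel_start z hz)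

variable [NeZero n] {F : Fin a → Option (Fin n)}

theorem rel_of_lab_eq (N : IsNoncrossing n R) {x y : ℤ} (hl : lab n x = lab n y) : R x y := by
  obtain ⟨k, rfl⟩ := lab_eq_iff.1 hl
  induction k using Int.induction_on with
  | zero => simpa using N.equiv.refl y
  | succ i ih =>
    refine N.equiv.trans (N.equiv.symm ?_) (ih (lab_add_mul _ _))
    rw [add_mul, one_mul, ← add_assoc]
    exact N.per _
  | pred i ih =>
    refine N.equiv.trans ?_ (ih (lab_add_mul _ _))
    have := N.per (y + (-(i : ℤ) - 1) * n)
    rwa [show y + (-(i : ℤ) - 1) * n + n = y + -(i : ℤ) * n by ring] at this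

/-- Labels sit only at the first elements of noncentral clusters. -/
theorem labelCount_eq_zero (C : IsCenter n R central s) (N : IsNoncrossing n R)
    (hF1 : ∀ i, central (κ i) → F i = none)
    (hF2 : ∀ i, ¬ central (κ i) → F i = some (lab n (s (κ i)))) {x : ℤ}
    (hx : central x ∨ (¬ central x ∧ s x < x)) : labelCount F x = 0 := by
  rw [labelCount, Finset.card_eq_zero, Finset.filter_eq_empty_iff]
  intro i _ hi
  by_cases hκ : central (κ i)
  · rw [hF1 i hκ] at hi; simp at hi
  · rw [hF2 i hκ, Option.some_inj] at hi
    have hR : R (κ i) x :=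
      N.equiv.trans (N.equiv.symm (C.rel_start _ hκ)) (rel_of_lab_eq N hi)
    rcases hx with hx | ⟨hx, hsx⟩
    · exact hκ (C.central_of_rel _ _ (N.equiv.symm hR) hx)
    · obtain ⟨k, hk⟩ := lab_eq_iff.1 hi.symm
      have h1 := C.start_le _ hκ
      have h2 := C.lt_start_add _ hκ
      have h3 := C.start_eq N hκ (N.equiv.symm (C.rel_start _ hκ)) le_rfl (by omega)
      have h4 := C.start_add (s (κ i)) (C.not_central_of_rel N hκ
        (N.equiv.symm (C.rel_start _ hκ))) k
      rw [h3, ← hk] at h4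
      omega

theorem exists_some_iff (C : IsCenter n R central s) (N : IsNoncrossing n R)
    (hF1 : ∀ i, central (κ i) → F i = none)
    (hF2 : ∀ i, ¬ central (κ i) → F i = some (lab n (s (κ i)))) {t : Finset ℤ}
    (ht : ∀ z ∈ t, ¬ central z ∧ s z ∈ t) (i : Fin a) :
    (∃ z ∈ t, F i = some (lab n z)) ↔ ∃ z ∈ t, R (κ i) z := by
  constructor
  · rintro ⟨z, hz, hi⟩
    by_cases hκ : central (κ i)
    · rw [hF1 i hκ] at hi; simp at hi
    · rw [hF2 i hκ, Option.some_inj] at hi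
      exact ⟨z, hz, N.equiv.trans (N.equiv.symm (C.rel_start _ hκ)) (rel_of_lab_eq N hi)⟩
  · rintro ⟨z, hz, hR⟩
    obtain ⟨hcz, hsz⟩ := ht z hz
    have hκ := C.not_central_of_rel N hcz (N.equiv.symm hR)
    obtain ⟨k, hk⟩ := C.start_of_rel _ _ hκ hR
    exact ⟨s z, hsz, by rw [hF2 i hκ, hk, lab_add_mul]⟩

/-- Along a cluster, or along the central class, the walk goes down: the gap carries at most
`⌊(x - y) a / b⌋` labels. -/
theorem lt_of_consecutive (C : IsCenter n R central s) (h : RationalParams a b n)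
    (G : IsRationalNC a b n R κ) (hF1 : ∀ i, central (κ i) → F i = none)
    (hF2 : ∀ i, ¬ central (κ i) → F i = some (lab n (s (κ i)))) {y x : ℤ}
    (hyx : y < x) (hR : R y x) (hc : central x ∨ (¬ central x ∧ s x ≤ y))
    (hgap : ∀ w, y < w → w < x → ¬ R y w) : labelWalk b F x < labelWalk b F y := by
  have N := G.toIsNoncrossing
  have W := labelWalk_isWalk b F
  have hxn := N.le_add_of_gap h.n_pos hgap
  have h1 : gapCount R κ y x = ∑ z ∈ Finset.Ioo y x, labelCount F z := by
    rw [sum_labelCount F (by intro u hu v hv; rw [Finset.mem_Ioo] at hu hv; omega), gapCount]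
    congr 1
    ext i
    simp only [Finset.mem_filter, Finset.mem_univ, true_and]
    rw [C.exists_some_iff N hF1 hF2]
    · simp only [Finset.mem_Ioo, and_assoc]
    · intro z hz
      rw [Finset.mem_Ioo] at hz
      obtain ⟨h2, h3⟩ := C.lt_start_of_mem_gap N hR hc hgap hz.1 hz.2
      exact ⟨h2, Finset.mem_Ioo.2 ⟨h3, (C.start_le z h2).trans_lt hz.2⟩⟩
  have h5 : Finset.Ioc y x = insert x (Finset.Ioo y x) := by
    ext z; simp only [Finset.mem_Ioc, Finset.mem_insert, Finset.mem_Ioo]; omega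
  have h4 := W.sub_eq hyx.le
  rw [h5, Finset.sum_insert (by simp), C.labelCount_eq_zero N hF1 hF2
    (hc.imp_right fun hc => ⟨hc.1, hc.2.trans_lt hyx⟩), zero_add, ← h1] at h4
  have h6 := G.gap_le y x hyx hR hgap
  exact lt_of_le_of_ne (by linarith)
    (W.ne_of_lt h hyx (by have := h.eq; omega)).symm

theorem lt_of_rel (C : IsCenter n R central s) (h : RationalParams a b n)
    (G : IsRationalNC a b n R κ) (hF1 : ∀ i, central (κ i) → F i = none)
    (hF2 : ∀ i, ¬ central (κ i) → F i = some (lab n (s (κ i)))) {z x : ℤ}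
    (hzx : z < x) (hR : R z x) (hc : central x ∨ (¬ central x ∧ s x ≤ z)) :
    labelWalk b F x < labelWalk b F z := by
  have N := G.toIsNoncrossing
  obtain ⟨m, hm⟩ : ∃ m : ℕ, (x - z).toNat = m := ⟨_, rfl⟩
  induction m using Nat.strong_induction_on generalizing x with
  | _ m ih =>
    obtain ⟨y, h1, h2, h3, h4⟩ := exists_last (Q := fun w => R w x) hzx hR
    have h5 : labelWalk b F x < labelWalk b F y :=
      C.lt_of_consecutive h G hF1 hF2 h2 h3 (hc.imp_right fun hc => ⟨hc.1, hc.2.trans h1⟩)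
        fun w hw1 hw2 hw3 => h4 w hw1 hw2 (N.equiv.trans (N.equiv.symm hw3) h3)
    rcases h1.lt_or_eq with h6 | rfl
    · refine h5.trans (ih _ (by omega) h6 (N.equiv.trans hR (N.equiv.symm h3)) ?_ rfl)
      refine hc.imp (C.central_of_rel _ _ (N.equiv.symm h3)) fun hc => ?_
      have h7 := C.lt_start_add x hc.1
      exact ⟨C.not_central_of_rel N hc.1 (N.equiv.symm h3),
        (C.start_eq N hc.1 (N.equiv.symm h3) (hc.2.trans h1) (by omega)).trans_le hc.2⟩
    · exact h5

/-- The walk stays above its value just before a cluster: the hull of the cluster carries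
`⌈(y - s x + 1) a / b⌉` labels. -/
theorem lt_of_start (C : IsCenter n R central s) (h : RationalParams a b n)
    (G : IsRationalNC a b n R κ) (hF1 : ∀ i, central (κ i) → F i = none)
    (hF2 : ∀ i, ¬ central (κ i) → F i = some (lab n (s (κ i)))) {x : ℤ} (hx : ¬ central x) :
    labelWalk b F (s x - 1) < labelWalk b F x := by
  have N := G.toIsNoncrossing
  have W := labelWalk_isWalk b F
  obtain ⟨y, h1, h2, h3, h4⟩ := exists_last (Q := fun w => R x w) (C.lt_start_add x hx)
    (N.equiv.refl x)
  have hsx := C.start_le x hx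
  have hy := C.not_central_of_rel N hx h3
  have hsy := C.start_eq N hx h3 (by omega) h2
  have hle : labelWalk b F y ≤ labelWalk b F x := by
    rcases h1.lt_or_eq with h5 | rfl
    · exact (C.lt_of_rel h G hF1 hF2 h5 h3 (Or.inr ⟨hy, by omega⟩)).le
    · exact le_rfl
  refine lt_of_lt_of_le ?_ hle
  have h5 : hullCount R κ (s x) y = ∑ z ∈ Finset.Icc (s x) y, labelCount F z := by
    rw [sum_labelCount F (by intro u hu v hv; rw [Finset.mem_Icc] at hu hv; omega), hullCount]
    congr 1
    ext i
    simp only [Finset.mem_filter, Finset.mem_univ, true_and]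
    rw [C.exists_some_iff N hF1 hF2]
    · simp only [Finset.mem_Icc, and_assoc]
    · intro z hz
      rw [Finset.mem_Icc] at hz
      obtain ⟨h6, h7⟩ := C.nested y z hy (by omega) hz.2
      exact ⟨h6, Finset.mem_Icc.2 ⟨by omega, (C.start_le z h6).trans hz.2⟩⟩
  have h6 : Finset.Ioc (s x - 1) y = Finset.Icc (s x) y := by
    ext z; simp only [Finset.mem_Ioc, Finset.mem_Icc]; omega
  have h7 := W.sub_eq (y := s x - 1) (x := y) (by omega)
  rw [h6, ← h5] at h7
  have h8 := (G.lt_hullCount h (f := s x) (y := y) (by omega) h2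
    (N.equiv.trans (C.rel_start x hx) h3)
    fun z hz1 hz2 hz3 => h4 z hz1 hz2 (N.equiv.trans h3 hz3)).1
  have h9 : y - (s x - 1) = y - s x + 1 := by ring
  rw [h9] at h7
  linarith

theorem isParent_start (C : IsCenter n R central s) (h : RationalParams a b n)
    (G : IsRationalNC a b n R κ) (hF1 : ∀ i, central (κ i) → F i = none)
    (hF2 : ∀ i, ¬ central (κ i) → F i = some (lab n (s (κ i)))) {x : ℤ} (hx : ¬ central x) :
    IsParent (labelWalk b F) (s x - 1) x := by
  have N := G.toIsNoncrossing
  have hsx := C.start_le x hx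
  refine ⟨by omega, C.lt_of_start h G hF1 hF2 hx, fun z hz hzx => ?_⟩
  obtain ⟨m, hm⟩ : ∃ m : ℕ, (z - s x).toNat = m := ⟨_, rfl⟩
  induction m using Nat.strong_induction_on generalizing z with
  | _ m ih =>
    by_cases hR : R z x
    · exact C.lt_of_rel h G hF1 hF2 hzx hR (Or.inr ⟨hx, by omega⟩)
    · obtain ⟨h1, h2⟩ := C.nested x z hx (by omega) hzx.le
      have h3 : s x ≠ s z := fun he =>
        hR (N.equiv.trans (N.equiv.symm (C.rel_start z h1)) (he ▸ C.rel_start x hx))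
      have h4 := C.start_le z h1
      exact (ih _ (by omega) (s z - 1) (by omega) (by omega) rfl).trans
        (C.lt_of_start h G hF1 hF2 h1)

theorem isRoot_of_central (C : IsCenter n R central s) (h : RationalParams a b n)
    (G : IsRationalNC a b n R κ) (hF1 : ∀ i, central (κ i) → F i = none)
    (hF2 : ∀ i, ¬ central (κ i) → F i = some (lab n (s (κ i)))) {x : ℤ} (hx : central x) :
    IsRoot (labelWalk b F) x := by
  have N := G.toIsNoncrossing
  have hn := h.n_pos
  rw [(labelWalk_isWalk b F).isRoot_iff h]
  -- central elements exist arbitrarily far to the left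
  have hleft : ∀ k : ℕ, central (x - k * n) := fun k =>
    C.central_of_rel _ _ (rel_of_lab_eq N (lab_eq_iff.2 ⟨k, by ring⟩)) hx
  have key : ∀ w, central w → w < x → ∀ m : ℕ, w + m < x →
      labelWalk b F x < labelWalk b F (w + m) := by
    intro w hw hwx m
    induction m using Nat.strong_induction_on with
    | _ m ih =>
      intro hm
      by_cases hc : central (w + m)
      · exact C.lt_of_rel h G hF1 hF2 hm (C.rel_of_central _ _ hc hx) (Or.inl hx)
      · have h1 : w < s (w + m) := by
          by_contra! hle
          exact (C.nested _ w hc hle (by omega)).1 hw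
        have h2 := C.start_le _ hc
        have h3 := ih (s (w + m) - 1 - w).toNat (by omega) (by omega)
        rw [show w + ((s (w + m) - 1 - w).toNat : ℤ) = s (w + m) - 1 by omega] at h3
        exact h3.trans (C.lt_of_start h G hF1 hF2 hc)
  intro y hy
  have hle : x - (x - y).toNat * n ≤ y := by
    have : ((x - y).toNat : ℤ) * 1 ≤ (x - y).toNat * n :=
      mul_le_mul_of_nonneg_left (by exact_mod_cast hn) (by positivity)
    omega
  have := key _ (hleft (x - y).toNat) (by omega)
    (y - (x - (x - y).toNat * n)).toNat (by omega)
  rwa [show x - (x - y).toNat * n + ((y - (x - (x - y).toNat * n)).toNat : ℤ) = y by omega]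
    at this

/-- The relation is recovered from the labelling that sends each label to the first element of its
cluster. -/
theorem treeRel_iff (C : IsCenter n R central s) (h : RationalParams a b n)
    (G : IsRationalNC a b n R κ) (hF1 : ∀ i, central (κ i) → F i = none)
    (hF2 : ∀ i, ¬ central (κ i) → F i = some (lab n (s (κ i)))) {x y : ℤ} :
    TreeRel n (labelWalk b F) x y ↔ R x y := by
  have N := G.toIsNoncrossing
  have W := labelWalk_isWalk b F
  constructor
  · rintro ⟨k, hk⟩
    refine N.equiv.trans ?_ (rel_of_lab_eq N (lab_add_mul y k))
    by_cases hx : central x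
    · refine C.rel_of_central _ _ hx ?_
      by_contra hy
      exact (C.isRoot_of_central h G hF1 hF2 hx) _
        ((hk _).2 (C.isParent_start h G hF1 hF2 hy).enc)
    · have h1 := W.isParent_of_same h hk (C.isParent_start h G hF1 hF2 hx)
      have hy : ¬ central (y + k * n) := fun hy =>
        (C.isRoot_of_central h G hF1 hF2 hy) _ h1.enc
      have h2 := (C.isParent_start h G hF1 hF2 hy).unique h1
      have h3 := C.rel_start _ hy
      rw [show s (y + k * n) = s x by omega] at h3
      exact N.equiv.trans (N.equiv.symm (C.rel_start x hx)) h3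
  · intro hR
    by_cases hx : central x
    · exact PeriodicWalk.treeRel_of_same ((C.isRoot_of_central h G hF1 hF2 hx).same
        (C.isRoot_of_central h G hF1 hF2 (C.central_of_rel _ _ hR hx)))
    · have hy := C.not_central_of_rel N hx hR
      obtain ⟨k, hk⟩ := C.start_of_rel y x hy (N.equiv.symm hR)
      refine ⟨k, (C.isParent_start h G hF1 hF2 hx).same ?_⟩
      have := W.isParent_add h k (C.isParent_start h G hF1 hF2 hy)
      rwa [show s y - 1 + k * n = s x - 1 by omega] at this

end IsCenter

/-! ### Dyck paths and the heights of their east steps -/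

namespace RationalDyckPath

open LatticeStep

theorem exists_east_split : ∀ (L : List LatticeStep) (x : ℕ), x < L.count east →
    ∃ u v : List LatticeStep, L = u ++ east :: v ∧ u.count east = x
  | [], x, h => by simp at h
  | north :: L, x, h => by
    rw [List.count_cons_of_ne (by decide)] at h
    obtain ⟨u, v, rfl, hu⟩ := exists_east_split L x h
    exact ⟨north :: u, v, rfl, by rw [List.count_cons_of_ne (by decide), hu]⟩
  | east :: L, 0, _ => ⟨[], L, rfl, rfl⟩
  | east :: L, x + 1, h => by
    rw [List.count_cons_self] at h
    obtain ⟨u, v, rfl, hu⟩ := exists_east_split L x (by omega)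
    exact ⟨east :: u, v, rfl, by rw [List.count_cons_self, hu]⟩

theorem prefix_of_count_le {u v u' v' : List LatticeStep} (h : u ++ east :: v = u' ++ east :: v')
    (hc : u.count east ≤ u'.count east) : u <+: u' := by
  rcases List.append_eq_append_iff.1 h with ⟨t, rfl, -⟩ | ⟨t, rfl, ht⟩
  · exact List.prefix_append _ _
  · cases t with
    | nil => simp
    | cons s t =>
      rw [List.cons_append, List.cons.injEq] at ht
      rw [← ht.1, List.count_append, List.count_cons_self] at hc
      omega

variable {a b : ℕ}

theorem HasEastStep.le {D : RationalDyckPath a b} {x x' y y' : ℕ} (h : D.HasEastStep x y)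
    (h' : D.HasEastStep x' y') (hx : x ≤ x') : y ≤ y' := by
  obtain ⟨u, v, h1, rfl, rfl⟩ := h
  obtain ⟨u', v', h2, rfl, rfl⟩ := h'
  exact (prefix_of_count_le (h1.symm.trans h2) hx).sublist.count_le _

theorem HasEastStep.unique {D : RationalDyckPath a b} {x y y' : ℕ} (h : D.HasEastStep x y)
    (h' : D.HasEastStep x y') : y = y' := le_antisymm (h.le h' le_rfl) (h'.le h le_rfl)

theorem HasEastStep.lt {D : RationalDyckPath a b} {x y : ℕ} (h : D.HasEastStep x y) : x < b := by
  obtain ⟨u, v, h1, rfl, rfl⟩ := h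
  rw [← D.count_east, h1, List.count_append, List.count_cons_self]
  omega

theorem HasEastStep.above {D : RationalDyckPath a b} {x y : ℕ} (h : D.HasEastStep x y) :
    a * (x + 1) ≤ b * y := by
  obtain ⟨u, v, h1, rfl, rfl⟩ := h
  have := D.above (u ++ [east]) ⟨v, by simp [h1]⟩
  simpa using this

theorem HasEastStep.le_north {D : RationalDyckPath a b} {x y : ℕ} (h : D.HasEastStep x y) :
    y ≤ a := by
  obtain ⟨u, v, h1, rfl, rfl⟩ := h
  rw [← D.count_north, h1, List.count_append]
  omega

theorem exists_hasEastStep (D : RationalDyckPath a b) (x : ℕ) (hx : x < b) :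
    ∃ y, D.HasEastStep x y := by
  obtain ⟨u, v, h, hu⟩ := exists_east_split D.steps x (by rwa [D.count_east])
  exact ⟨_, u, v, h, hu, rfl⟩

theorem isValley_iff (D : RationalDyckPath a b) (hb : 0 < b) {p y : ℕ} :
    D.IsValley p y ↔ 0 < p ∧ D.HasEastStep (p - 1) y ∧ ∃ z, D.HasEastStep p z ∧ y < z := by
  constructor
  · rintro ⟨u, v, h, hp, hy⟩
    have hp' : u.count east + 1 = p := by simpa using hp
    have hy' : u.count north = y := by simpa using hy
    have hE : u.count east + (1 + v.count east) = b := by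
      rw [← D.count_east, h]; simp; omega
    have hN : u.count north + (v.count north + 1) = a := by
      rw [← D.count_north, h]; simp
    have ha : a * p ≤ b * y := by
      have := D.above (u ++ [east]) ⟨north :: v, h.symm⟩
      rwa [hp, hy] at this
    have hpb : p < b := by
      by_contra! hle
      have h1 : b * (y + 1) ≤ b * a := mul_le_mul_of_nonneg_left (by omega) (by omega)
      have h2 : a * b ≤ a * p := Nat.mul_le_mul_left _ hle
      nlinarith
    refine ⟨by omega, ⟨u, north :: v, by simp [h], by omega, hy'⟩, ?_⟩
    obtain ⟨u', v', rfl, hu'⟩ := exists_east_split v 0 (by omega)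
    refine ⟨_, ⟨u ++ east :: north :: u', v', by simp [h], ?_, rfl⟩, ?_⟩
    · simp [hu', hp']
    · simp; omega
  · rintro ⟨hp, ⟨u, v, h, hu, hy⟩, z, hz, hyz⟩
    cases v with
    | nil =>
      have hE := D.count_east
      have := hz.lt
      simp [h] at hE
      omega
    | cons s v =>
      cases s with
      | east =>
        have : D.HasEastStep p y := ⟨u ++ [east], v, by simp [h], by simp; omega, by simpa⟩
        have := this.unique hz
        omega
      | north => exact ⟨u, v, by simp [h], by simp; omega, by simpa⟩

theorem laserHeight_lt_iff (hb : 0 < b) {p y x z : ℕ} :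
    laserHeight a b p y x < z ↔ (b : ℤ) * y + a * (x - p) < b * z := by
  have hb' : (0 : ℚ) < b := by exact_mod_cast hb
  have h1 : laserHeight a b p y x = (b * y + a * (x - p)) / b := by
    rw [laserHeight]; field_simp
  rw [h1, div_lt_iff₀ hb', mul_comm (z : ℚ)]
  exact_mod_cast Iff.rfl

theorem lt_laserHeight_iff (hb : 0 < b) {p y x z : ℕ} :
    (z : ℚ) < laserHeight a b p y x ↔ (b : ℤ) * z < b * y + a * (x - p) := by
  have hb' : (0 : ℚ) < b := by exact_mod_cast hb
  have h1 : laserHeight a b p y x = (b * y + a * (x - p)) / b := by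
    rw [laserHeight]; field_simp
  rw [h1, lt_div_iff₀ hb', mul_comm (z : ℚ)]
  exact_mod_cast Iff.rfl

/-- Lasers in terms of the heights of the east steps. -/
theorem mem_lasers_iff (D : RationalDyckPath a b) (h : a < b) {ht : ℕ → ℕ}
    (hht : ∀ x < b, D.HasEastStep x (ht x)) {q j : ℕ} :
    (q + 1, j) ∈ D.lasers ↔ q + 1 < b ∧ ht q < ht (q + 1) ∧ q < j ∧ j < b ∧
      (∀ k, q < k → k < j → (b : ℤ) * ht q - a * (q + 1) < b * ht k - a * (k + 1)) ∧
      (b : ℤ) * ht j - a * (j + 1) < b * ht q - a * (q + 1) := by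
  have hb : 0 < b := by omega
  constructor
  · rintro ⟨y, z, hv, hqj, hz, hk, h1, h2⟩
    obtain ⟨-, hy, z', hz', hyz⟩ := (D.isValley_iff hb).1 hv
    simp only [Nat.add_sub_cancel] at hy hqj hk h1 h2 hz
    have hq := hz'.lt
    have hj := hz.lt
    obtain rfl := hy.unique (hht q (by omega))
    obtain rfl := hz.unique (hht j hj)
    obtain rfl := hz'.unique (hht _ hq)
    refine ⟨hq, hyz, by omega, hj, fun k h3 h4 => ?_, ?_⟩
    · have := hk k (ht k) (by omega) h4 (hht k (by omega))
      have := (laserHeight_lt_iff (x := k + 1) hb).1 (by exact_mod_cast this)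
      push_cast at this
      linarith
    · have := (lt_laserHeight_iff (x := j + 1) hb).1 h2
      push_cast at this
      linarith
  · rintro ⟨hq, hlt, hqj, hj, hk, h1⟩
    have hlow : ∀ k, q < k → k < j → laserHeight a b (q + 1) (ht q) (k + 1) < ht k := by
      intro k h2 h3
      rw [laserHeight_lt_iff hb]
      have := hk k h2 h3
      push_cast
      linarith
    refine ⟨ht q, ht j, ?_, hqj, hht j hj, ?_, ?_, ?_⟩
    · exact (D.isValley_iff hb).2 ⟨by simp, hht q (by omega), _, hht _ hq, hlt⟩
    · intro k c h2 h3 hc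
      obtain rfl := hc.unique (hht k (by simp at h3; omega))
      exact hlow k h2 h3
    · rcases (show q + 1 ≤ j from hqj).lt_or_eq with h2 | rfl
      · have h3 := hlow (j - 1) (by omega) (by omega)
        rw [Nat.sub_add_cancel (by omega)] at h3
        refine h3.trans_le ?_
        exact_mod_cast (hht (j - 1) (by omega)).le (hht j hj) (by omega)
      · simp only [laserHeight, sub_self, mul_zero, add_zero]
        exact_mod_cast hlt
    · rw [lt_laserHeight_iff hb]
      push_cast
      linarith

/-- The lattice path with `c x` north steps before its east step at abscissa `x`. -/
def columnWord (c : ℕ → ℕ) : ℕ → List LatticeStep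
  | 0 => []
  | k + 1 => columnWord c k ++ (List.replicate (c k) north ++ [east])

theorem count_east_columnWord (c : ℕ → ℕ) (k : ℕ) : (columnWord c k).count east = k := by
  induction k with
  | zero => rfl
  | succ k ih => simp [columnWord, ih, List.count_replicate]

theorem count_north_columnWord (c : ℕ → ℕ) (k : ℕ) :
    (columnWord c k).count north = ∑ i ∈ Finset.range k, c i := by
  induction k with
  | zero => rfl
  | succ k ih => simp [columnWord, ih, Finset.sum_range_succ]

theorem exists_columnWord_eq (c : ℕ → ℕ) {x k : ℕ} (h : x < k) :
    ∃ v, columnWord c k = (columnWord c x ++ List.replicate (c x) north) ++ east :: v := by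
  induction k with
  | zero => omega
  | succ k ih =>
    rcases (Nat.lt_succ_iff.1 h).lt_or_eq with h1 | rfl
    · obtain ⟨v, hv⟩ := ih h1
      exact ⟨v ++ (List.replicate (c k) north ++ [east]), by rw [columnWord, hv]; simp⟩
    · exact ⟨[], by simp [columnWord]⟩

theorem count_north_of_columnWord_eq {c : ℕ → ℕ} {k : ℕ} {u v : List LatticeStep}
    (h : columnWord c k = u ++ east :: v) :
    u.count north = ∑ i ∈ Finset.range (u.count east + 1), c i := by
  have hk : u.count east < k := by
    rw [← count_east_columnWord c k, h]
    simp
  obtain ⟨v', hv'⟩ := exists_columnWord_eq c hk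
  have hE : (columnWord c (u.count east) ++ List.replicate (c (u.count east)) north).count east =
      u.count east := by simp [count_east_columnWord, List.count_replicate]
  have h1 := prefix_of_count_le (h.symm.trans hv') hE.ge
  have h2 := prefix_of_count_le (hv'.symm.trans h) hE.le
  rw [h1.eq_of_length (le_antisymm h1.length_le h2.length_le) |> congrArg (List.count north)]
  · simp [count_north_columnWord, Finset.sum_range_succ]

/-- The Dyck path with given numbers of north steps in its columns. -/
def ofColumns (c : ℕ → ℕ) (hsum : ∑ i ∈ Finset.range b, c i = a)
    (habove : ∀ x < b, a * (x + 1) ≤ b * ∑ i ∈ Finset.range (x + 1), c i) :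
    RationalDyckPath a b where
  steps := columnWord c b
  count_east := count_east_columnWord c b
  count_north := (count_north_columnWord c b).trans hsum
  above u hu := by
    rcases Nat.eq_zero_or_pos (u.count east) with h0 | h0
    · simp [h0]
    · obtain ⟨u', v', h1, h2⟩ := exists_east_split u (u.count east - 1) (by omega)
      obtain ⟨v, hv⟩ := hu
      rw [h1, List.append_assoc, List.cons_append] at hv
      have h3 := count_north_of_columnWord_eq hv.symm
      have h4 : u.count east ≤ b := by
        have : (u' ++ east :: (v' ++ v)).count east = b := by rw [hv, count_east_columnWord]
        simp at this
        omega
      have h5 := habove (u'.count east) (by omega)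
      rw [← h3, h2, Nat.sub_add_cancel h0] at h5
      refine h5.trans (Nat.mul_le_mul_left _ ?_)
      conv_rhs => rw [h1]
      simp

theorem ofColumns_hasEastStep (c : ℕ → ℕ) (hsum : ∑ i ∈ Finset.range b, c i = a)
    (habove : ∀ x < b, a * (x + 1) ≤ b * ∑ i ∈ Finset.range (x + 1), c i) {x : ℕ} (hx : x < b) :
    (ofColumns c hsum habove).HasEastStep x (∑ i ∈ Finset.range (x + 1), c i) := by
  obtain ⟨v, hv⟩ := exists_columnWord_eq c hx
  exact ⟨_, v, hv, by simp [count_east_columnWord, List.count_replicate],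
    by simp [count_north_columnWord, Finset.sum_range_succ]⟩

end RationalDyckPath

/-! ### Partitions and their lifts -/

theorem blockHull_injOn {n : ℕ} {P : Finpartition (Finset.univ : Finset (Fin n))}
    {B C : Finset (Fin n)} (hB : B ∈ P.parts) (hC : C ∈ P.parts)
    (hBC : blockHull B = blockHull C) : B = C := by
  have hB' := P.nonempty_of_mem_parts hB
  have hC' := P.nonempty_of_mem_parts hC
  rw [blockHull_eq_Icc B hB', blockHull_eq_Icc C hC'] at hBC
  have h1 : B.min' hB' ∈ Finset.Icc (C.min' hC') (C.max' hC') :=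
    hBC ▸ Finset.left_mem_Icc.2 (B.min'_le_max' hB')
  have h2 : C.min' hC' ∈ Finset.Icc (B.min' hB') (B.max' hB') :=
    hBC ▸ Finset.left_mem_Icc.2 (C.min'_le_max' hC')
  have h3 := le_antisymm (Finset.mem_Icc.1 h2).1 (Finset.mem_Icc.1 h1).1
  exact P.eq_of_mem_parts hB hC (B.min'_mem hB') (h3 ▸ C.min'_mem hC')

section Partition

variable {a b n : ℕ} [NeZero n]

/-- The lift of a partition of the labels to an `n`-periodic relation on `ℤ`. -/
def partRel (P : Finpartition (Finset.univ : Finset (Fin n))) (x y : ℤ) : Prop :=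
  P.part (lab n x) = P.part (lab n y)

theorem partRel_iff_mem {P : Finpartition (Finset.univ : Finset (Fin n))} {x y : ℤ} :
    partRel P x y ↔ lab n x ∈ P.part (lab n y) :=
  (P.mem_part_iff_part_eq_part (Finset.mem_univ _) (Finset.mem_univ _)).symm

theorem partRel_iff_of_mem {P : Finpartition (Finset.univ : Finset (Fin n))} {x y : ℤ}
    {B : Finset (Fin n)} (hB : B ∈ P.parts) (hx : lab n x ∈ B) :
    partRel P x y ↔ lab n y ∈ B := by
  rw [partRel, P.part_eq_of_mem hB hx, eq_comm, P.part_eq_iff_mem hB]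

theorem eq_of_partRel_iff {P Q : Finpartition (Finset.univ : Finset (Fin n))}
    (h : ∀ x y, partRel P x y ↔ partRel Q x y) : P = Q := by
  have h1 : ∀ i, P.part i = Q.part i := by
    intro i
    ext j
    have := h (j : ℕ) (i : ℕ)
    rwa [partRel_iff_mem, partRel_iff_mem, lab_coe, lab_coe] at this
  have h2 : ∀ (P Q : Finpartition (Finset.univ : Finset (Fin n))), (∀ i, P.part i = Q.part i) →
      P.parts ⊆ Q.parts := by
    intro P Q h B hB
    obtain ⟨i, hi⟩ := P.nonempty_of_mem_parts hB
    rw [← P.part_eq_of_mem hB hi, h]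
    exact Q.part_mem.2 (Finset.mem_univ i)
  exact Finpartition.ext ((h2 P Q h1).antisymm (h2 Q P fun i => (h1 i).symm))

/-- The equivalence relation on the labels defined by the walk of a labelling. -/
def treeSetoid (h : RationalParams a b n) (F : Fin a → Option (Fin n)) : Setoid (Fin n) where
  r i j := TreeRel n (labelWalk b F) (i : ℕ) (j : ℕ)
  iseqv :=
    have E := (labelWalk_isWalk b F).treeRel_equivalence h
    ⟨fun _ => E.refl _, E.symm, E.trans⟩

/-- The partition of the labels defined by the walk of a labelling. -/
noncomputable def treePart (h : RationalParams a b n) (F : Fin a → Option (Fin n)) :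
    Finpartition (Finset.univ : Finset (Fin n)) :=
  @Finpartition.ofSetoid _ _ _ (treeSetoid h F) (Classical.decRel _)

theorem partRel_treePart (h : RationalParams a b n) (F : Fin a → Option (Fin n)) {x y : ℤ} :
    partRel (treePart h F) x y ↔ TreeRel n (labelWalk b F) x y := by
  have E := (labelWalk_isWalk b F).treeRel_equivalence h
  have hl : ∀ x : ℤ, TreeRel n (labelWalk b F) x ((lab n x : ℕ) : ℤ) := fun x =>
    PeriodicWalk.treeRel_of_lab_eq (lab_coe _).symm
  have hiff : partRel (treePart h F) x y ↔
      TreeRel n (labelWalk b F) (lab n y : ℕ) (lab n x : ℕ) :=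
    partRel_iff_mem.trans (@Finpartition.mem_part_ofSetoid_iff_rel _ _ _ _ (treeSetoid h F)
      (Classical.decRel _) _)
  rw [hiff]
  exact ⟨fun hR => E.trans (hl x) (E.trans (E.symm hR) (E.symm (hl y))),
    fun hR => E.trans (E.symm (hl y)) (E.trans (E.symm hR) (hl x))⟩

theorem partRel_treePart_isRationalNC (h : RationalParams a b n) {F : Fin a → Option (Fin n)}
    {κ : Fin a → ℤ} (hsome : ∀ i p, F i = some p → lab n (κ i) = p)
    (hnone : ∀ i, F i = none → IsRoot (labelWalk b F) (κ i)) :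
    IsRationalNC a b n (partRel (treePart h F)) κ := by
  have : partRel (treePart h F) = TreeRel n (labelWalk b F) := by
    ext x y; exact partRel_treePart h F
  rw [this]
  exact treeRel_isRationalNC h hsome hnone

theorem labelWalk_eq (b : ℕ) (F : Fin a → Option (Fin n)) {x : ℤ} (hx : -1 ≤ x) :
    labelWalk b F x = b * (∑ z ∈ Finset.Ioc (-1) x, labelCount F z : ℕ) - a * (x + 1) := by
  rw [labelWalk, Finset.Ioc_eq_empty (a := x) (by omega)]
  simp

/-- A labelling is a rational parking function if all labels have positions and the walk stays
positive over one period. -/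
def IsDyck (b : ℕ) (F : Fin a → Option (Fin n)) : Prop :=
  (∀ i, F i ≠ none) ∧ ∀ x : ℤ, 0 ≤ x → x < n → 0 < labelWalk b F x

/-- The first element, in the window `[kn, (k + 1)n)` that contains `x`, of the class of `x`. -/
noncomputable def windowStart (P : Finpartition (Finset.univ : Finset (Fin n))) (x : ℤ) : ℤ :=
  x - x % n + (((P.part (lab n x)).min' (P.part_nonempty.2 (Finset.mem_univ _)) : Fin n) : ℕ)

/-- Cutting the periodic lift back into its windows gives a centre without central class. -/
theorem isCenter_windowStart {P : Finpartition (Finset.univ : Finset (Fin n))}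
    (N : IsNoncrossing n (partRel P)) :
    IsCenter n (partRel P) (fun _ => False) (windowStart P) := by
  have hn : (0 : ℤ) < n := by exact_mod_cast Nat.pos_of_ne_zero (NeZero.ne n)
  have hmod : ∀ x : ℤ, 0 ≤ x % n ∧ x % n < n := fun x =>
    ⟨Int.emod_nonneg x hn.ne', Int.emod_lt_of_pos x hn⟩
  have hle : ∀ x, windowStart P x ≤ x := by
    intro x
    have h1 := (P.part (lab n x)).min'_le _ (P.mem_part (Finset.mem_univ (lab n x)))
    have h2 : (((P.part (lab n x)).min' (P.part_nonempty.2 (Finset.mem_univ _)) : ℕ) : ℤ) ≤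
      (lab n x : ℕ) := by exact_mod_cast h1
    rw [lab_val] at h2
    rw [windowStart]
    omega
  have hge : ∀ x, x - x % n ≤ windowStart P x := by
    intro x
    rw [windowStart]
    omega
  have hlab : ∀ x, lab n (windowStart P x) =
      (P.part (lab n x)).min' (P.part_nonempty.2 (Finset.mem_univ _)) := by
    intro x
    rw [lab_eq_coe_iff]
    refine ⟨x / n, ?_⟩
    have := Int.emod_add_mul_ediv x n
    rw [windowStart]
    linarith
  have hrel : ∀ x, partRel P (windowStart P x) x := by
    intro x
    rw [partRel_iff_mem, hlab]
    exact Finset.min'_mem _ _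
  have hmin : ∀ x z, partRel P z x → x - x % n ≤ z → windowStart P x ≤ z := by
    intro x z hz hxz
    by_cases h1 : x - x % n + n ≤ z
    · have := hle x
      have := hmod x
      omega
    · have h2 := (P.part (lab n x)).min'_le _ (partRel_iff_mem.1 hz)
      have h3 : (((P.part (lab n x)).min' (P.part_nonempty.2 (Finset.mem_univ _)) : ℕ) : ℤ) ≤
        (lab n z : ℕ) := by exact_mod_cast h2
      have h4 : z % n = z - (x - x % n) := by
        have h5 : z = (z - (x - x % n)) + (x / n) * n := by
          have := Int.emod_add_mul_ediv x n
          linarith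
        conv_lhs => rw [h5]
        rw [Int.add_mul_emod_self_right, Int.emod_eq_of_lt (by omega) (by omega)]
      rw [lab_val, h4] at h3
      rw [windowStart]
      omega
  refine ⟨fun _ _ h => h.elim, fun _ _ _ h => h, fun x _ => hle x, fun x _ => ?_,
    fun x _ => hrel x, fun x z _ h1 h2 => ⟨id, ?_⟩, fun x y _ hxy => ?_, fun x _ k => ?_⟩
  · have := hge x
    have := hmod x
    omega
  · by_contra! hlt
    have h3 := hge x
    have h4 := hmod x
    have h5 : z - z % n = x - x % n := by
      have h6 : z = (z - (x - x % n)) + (x / n) * n := by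
        have := Int.emod_add_mul_ediv x n
        linarith
      have h7 : z % n = z - (x - x % n) := by
        conv_lhs => rw [h6]
        rw [Int.add_mul_emod_self_right, Int.emod_eq_of_lt (by omega) (by omega)]
      omega
    have h6 := hge z
    have key : ¬ partRel P (windowStart P z) x := fun hR => by
      have := hmin x _ hR (by omega)
      omega
    have h7 : windowStart P x ≠ z := fun he => key (N.equiv.trans (hrel z) (he ▸ hrel x))
    have h8 : z ≠ x := fun he => key (he ▸ hrel z)
    exact key (N.equiv.trans (N.noncrossing _ (windowStart P x) z x hlt (by omega) (by omega)
      (by omega) (hrel z) (hrel x)) (hrel x))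
  · have h1 : P.part (lab n x) = P.part (lab n y) := hxy
    refine ⟨y / n - x / n, ?_⟩
    have h2 := Int.emod_add_mul_ediv x n
    have h3 := Int.emod_add_mul_ediv y n
    simp only [windowStart, h1]
    linarith
  · simp only [windowStart, lab_add_mul, Int.add_mul_emod_self_right]
    ring

/-- The labelling that sends each label to the least element of its block. -/
noncomputable def minLabelling (P : Finpartition (Finset.univ : Finset (Fin n))) (κ : Fin a → ℤ)
    (i : Fin a) : Option (Fin n) := some (lab n (windowStart P (κ i)))

/-- A rational noncrossing partition is recovered from the labelling by block minima. -/
theorem treePart_minLabelling (h : RationalParams a b n)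
    {P : Finpartition (Finset.univ : Finset (Fin n))} {κ : Fin a → ℤ}
    (G : IsRationalNC a b n (partRel P) κ) : treePart h (minLabelling P κ) = P := by
  refine eq_of_partRel_iff fun x y => ?_
  rw [partRel_treePart, (isCenter_windowStart G.toIsNoncrossing).treeRel_iff h G
    (F := minLabelling P κ) (fun _ hf => hf.elim) (fun _ _ => rfl)]

/-- The labelling by block minima is a rational parking function, since the walk stays above its
value before the first element of each block, down to the value `0` at `-1`. -/
theorem isDyck_minLabelling (h : RationalParams a b n)
    {P : Finpartition (Finset.univ : Finset (Fin n))} {κ : Fin a → ℤ}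
    (G : IsRationalNC a b n (partRel P) κ) : IsDyck b (minLabelling P κ) := by
  refine ⟨fun i => by simp [minLabelling], fun x h0 hx => ?_⟩
  have C := isCenter_windowStart G.toIsNoncrossing
  obtain ⟨m, rfl⟩ := Int.eq_ofNat_of_zero_le h0
  induction m using Nat.strong_induction_on with
  | _ m ih =>
    have h1 := C.lt_of_start h G (F := minLabelling P κ) (fun _ hf => hf.elim) (fun _ _ => rfl)
      (x := m) id
    have h2 := C.start_le m id
    have h3 : 0 ≤ windowStart P m := by
      rw [windowStart, Int.emod_eq_of_lt h0 hx]
      omega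
    rcases h3.lt_or_eq with h4 | h4
    · have h5 := ih (windowStart P m - 1).toNat (by omega) (by omega) (by omega)
      rw [Int.toNat_of_nonneg (by omega)] at h5
      exact h5.trans h1
    · rwa [← h4, zero_sub, labelWalk_neg_one] at h1

/-! ### The rank function -/

/-- The numbers of labels on the blocks satisfy the recursion that determines the ranks. -/
theorem sum_card_hull (h : RationalParams a b n)
    {P : Finpartition (Finset.univ : Finset (Fin n))} {κ : Fin a → ℤ}
    (G : IsRationalNC a b n (partRel P) κ) {B : Finset (Fin n)} (hB : B ∈ P.parts) :
    ∑ B' ∈ P.parts.filter (fun B' => blockHull B' ⊆ blockHull B),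
      ((Finset.univ.filter fun i => lab n (κ i) ∈ B').card : ℤ) =
      ⌈((blockHull B).card : ℚ) * ((a : ℚ) / (b : ℚ))⌉ := by
  have N := G.toIsNoncrossing
  have hBne := P.nonempty_of_mem_parts hB
  set f := B.min' hBne with hf
  set y := B.max' hBne with hy
  have hfB : f ∈ B := B.min'_mem hBne
  have hyB : y ∈ B := B.max'_mem hBne
  have hfy : f ≤ y := B.min'_le_max' hBne
  have hH : blockHull B = Finset.Icc f y := blockHull_eq_Icc B hBne
  have h1 : (∑ B' ∈ P.parts.filter (fun B' => blockHull B' ⊆ blockHull B),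
      (Finset.univ.filter fun i => lab n (κ i) ∈ B').card) =
      hullCount (partRel P) κ ((f : ℕ) : ℤ) ((y : ℕ) : ℤ) := by
    rw [← Finset.card_biUnion]
    · rw [hullCount]
      congr 1
      ext i
      simp only [Finset.mem_biUnion, Finset.mem_filter, Finset.mem_univ, true_and]
      constructor
      · rintro ⟨B', ⟨hB', hsub⟩, hi⟩
        have h2 : lab n (κ i) ∈ blockHull B' := by
          simp only [blockHull, Finset.mem_filter, Finset.mem_univ, true_and]
          exact ⟨_, hi, _, hi, le_rfl, le_rfl⟩
        have h3 := hsub h2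
        rw [hH, Finset.mem_Icc] at h3
        refine ⟨(lab n (κ i) : ℕ), by exact_mod_cast h3.1, by exact_mod_cast h3.2, ?_⟩
        rw [partRel, lab_coe]
      · rintro ⟨z, hz1, hz2, hR⟩
        refine ⟨P.part (lab n (κ i)), ⟨P.part_mem.2 (Finset.mem_univ _), ?_⟩,
          P.mem_part (Finset.mem_univ _)⟩
        suffices hsub : ∀ w ∈ P.part (lab n (κ i)), f ≤ w ∧ w ≤ y by
          intro w hw
          simp only [blockHull, Finset.mem_filter, Finset.mem_univ, true_and] at hw
          obtain ⟨u, hu, v, hv, huw, hwv⟩ := hw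
          rw [hH, Finset.mem_Icc]
          exact ⟨(hsub u hu).1.trans huw, hwv.trans (hsub v hv).2⟩
        intro w hw
        have hzw : partRel P z (w : ℕ) := by
          rw [partRel, ← hR, lab_coe]
          exact (P.part_eq_of_mem (P.part_mem.2 (Finset.mem_univ _)) hw).symm
        have hfy' : partRel P (f : ℕ) (y : ℕ) :=
          (partRel_iff_of_mem hB (by rwa [lab_coe])).2 (by rwa [lab_coe])
        by_cases hzf : partRel P z (f : ℕ)
        · have : w ∈ B := by
            have := (partRel_iff_of_mem hB (x := (f : ℕ)) (y := (w : ℕ)) (by rwa [lab_coe])).1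
              (N.equiv.trans (N.equiv.symm hzf) hzw)
            rwa [lab_coe] at this
          exact ⟨B.min'_le _ this, B.le_max' _ this⟩
        · have hz3 : ((f : ℕ) : ℤ) ≠ z := fun he => hzf (he ▸ N.equiv.refl z)
          have hz4 : z ≠ (y : ℕ) := fun he => hzf (he ▸ N.equiv.symm hfy')
          have hwn := w.2
          have hyn := y.2
          constructor
          · by_contra! hlt
            have hlt' : (w : ℕ) < (f : ℕ) := hlt
            exact hzf (N.equiv.trans hzw (N.noncrossing (w : ℕ) (f : ℕ) z (y : ℕ) (by omega)
              (by omega) (by omega) (by omega) (N.equiv.symm hzw) hfy'))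
          · by_contra! hlt
            have hlt' : (y : ℕ) < (w : ℕ) := hlt
            exact hzf (N.equiv.symm (N.noncrossing (f : ℕ) z (y : ℕ) (w : ℕ) (by omega)
              (by omega) (by omega) (by omega) hfy' hzw))
    · intro B₁ hB₁ B₂ hB₂ hne
      rw [Function.onFun, Finset.disjoint_filter]
      intro i _ hi1 hi2
      exact hne (P.eq_of_mem_parts (Finset.mem_filter.1 hB₁).1 (Finset.mem_filter.1 hB₂).1 hi1 hi2)
  have hfy2 : (f : ℕ) ≤ (y : ℕ) := hfy
  have hyn := y.2
  have h2 := G.lt_hullCount h (f := (f : ℕ)) (y := (y : ℕ)) (by omega) (by omega)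
    ((partRel_iff_of_mem hB (by rwa [lab_coe])).2 (by rwa [lab_coe])) (by
      intro z hz1 hz2 hR
      have hz := (partRel_iff_of_mem hB (by rwa [lab_coe])).1 hR
      have h3 : (((f : ℕ) : ℤ)) ≤ (lab n z : ℕ) := by exact_mod_cast B.min'_le _ hz
      have h4 : ((lab n z : ℕ) : ℤ) ≤ (y : ℕ) := by exact_mod_cast B.le_max' _ hz
      rw [lab_val] at h3 h4
      by_cases hzn : z < n
      · rw [Int.emod_eq_of_lt (by omega) hzn] at h3 h4
        omega
      · have h5 : z % n = z - n := by
          rw [← Int.sub_emod_right, Int.emod_eq_of_lt (by omega) (by have := f.2; omega)]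
        omega)
  have hcard : ((blockHull B).card : ℤ) = (y : ℕ) - (f : ℕ) + 1 := by
    rw [hH, Fin.card_Icc]
    omega
  rw [← Nat.cast_sum, h1, eq_comm, Int.ceil_eq_iff]
  rw [← hcard] at h2
  have hb : (0 : ℚ) < b := by exact_mod_cast h.pos.trans h.lt
  have h3 : ((blockHull B).card : ℚ) * ((a : ℚ) / b) = (a * (blockHull B).card) / b := by ring
  rw [h3, lt_div_iff₀ hb, div_le_iff₀ hb]
  obtain ⟨h4, h5⟩ := h2
  have h4' : (a : ℚ) * (blockHull B).card <
    b * (hullCount (partRel P) κ ((f : ℕ) : ℤ) ((y : ℕ) : ℤ) : ℕ) := by exact_mod_cast h4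
  have h5' : (b : ℚ) * (hullCount (partRel P) κ ((f : ℕ) : ℤ) ((y : ℕ) : ℤ) : ℕ) <
    a * (blockHull B).card + b := by exact_mod_cast h5
  push_cast
  constructor <;> linarith

/-- The rank of a block is the number of labels that it carries. -/
theorem blockRank_eq (h : RationalParams a b n)
    {P : Finpartition (Finset.univ : Finset (Fin n))} {κ : Fin a → ℤ}
    (G : IsRationalNC a b n (partRel P) κ) {B : Finset (Fin n)} (hB : B ∈ P.parts) :
    blockRank a b P B = (Finset.univ.filter fun i => lab n (κ i) ∈ B).card := by
  obtain ⟨m, hm⟩ : ∃ m, (blockHull B).card = m := ⟨_, rfl⟩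
  induction m using Nat.strong_induction_on generalizing B with
  | _ m ih =>
    have h1 := (sum_blockRank a b P B hB).trans (sum_card_hull h G hB).symm
    rw [← sub_eq_zero, ← Finset.sum_sub_distrib,
      Finset.sum_eq_single_of_mem B (by simp [hB])] at h1
    · exact sub_eq_zero.1 h1
    · intro C hC hne
      rw [Finset.mem_filter] at hC
      have h2 : blockHull C ⊂ blockHull B :=
        hC.2.ssubset_of_ne fun he => hne (blockHull_injOn hC.1 hB he)
      rw [ih _ (hm ▸ Finset.card_lt_card h2) hC.1 rfl, sub_self]

end Partition

/-! ### The partition of a Dyck path -/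

section DyckPartition

variable {a b : ℕ}

theorem ofSetoid_congr {n : ℕ} {s t : Setoid (Fin n)} (i₁ : DecidableRel s.r)
    (i₂ : DecidableRel t.r) (e : s = t) :
    @Finpartition.ofSetoid _ _ _ s i₁ = @Finpartition.ofSetoid _ _ _ t i₂ := by
  subst e
  congr!

/-- Over a period on which the walk stays positive, the relation is detected by the enclosing
positions in that period. -/
theorem treeRel_iff_of_pos {n : ℕ} {c : ℤ → ℕ} {V : ℤ → ℤ} (h : RationalParams a b n)
    (W : PeriodicWalk a b n c V) (h0 : V (-1) = 0) (hpos : ∀ x : ℕ, x < n → 0 < V x) {i j : ℕ}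
    (hi : i < n) (hj : j < n) :
    TreeRel n V i j ↔ ∀ q : ℕ, q < n → (Enc V q i ↔ Enc V q j) := by
  have hpos' : ∀ y : ℤ, -1 < y → y < n → 0 < V y := fun y h1 h2 => by
    have := hpos y.toNat (by omega)
    rwa [Int.toNat_of_nonneg (by omega)] at this
  have henc : ∀ x : ℕ, x < n → Enc V (-1) x := fun x hx =>
    ⟨by omega, fun y h1 h2 => by rw [h0]; exact hpos' y h1 (by omega)⟩
  constructor
  · rintro ⟨k, hk⟩ q -
    have h1 := ((hk _).1 (henc i hi)).1
    have h2 := ((hk _).2 ((W.enc_add h k).2 (henc j hj))).1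
    have hn : (0 : ℤ) < n := by exact_mod_cast h.n_pos
    have hk0 : k = 0 := by
      rcases lt_trichotomy k 0 with h3 | h3 | h3
      · nlinarith
      · exact h3
      · nlinarith
    rw [hk0, zero_mul, add_zero] at hk
    exact hk q
  · intro hq
    refine PeriodicWalk.treeRel_of_same fun p => ?_
    have hneg : p < -1 → ∀ x : ℕ, x < n → (Enc V p x ↔ ∀ y, p < y → y ≤ -1 → V p < V y) := by
      intro hp x hx
      refine ⟨fun hE y h1 h2 => hE.2 y h1 (by omega), fun hall => ⟨by omega, fun y h1 h2 => ?_⟩⟩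
      rcases le_or_gt y (-1) with h3 | h3
      · exact hall y h1 h3
      · have := hall (-1) hp le_rfl
        rw [h0] at this
        exact this.trans (hpos' y h3 (by omega))
    rcases lt_trichotomy p (-1) with hp | rfl | hp
    · rw [hneg hp i hi, hneg hp j hj]
    · exact iff_of_true (henc i hi) (henc j hj)
    · by_cases hpn : p < n
      · have := hq p.toNat (by omega)
        rwa [Int.toNat_of_nonneg (by omega)] at this
      · exact iff_of_false (fun hE => by have := hE.1; omega) fun hE => by have := hE.1; omega

variable [NeZero (b - 1)]

/-- The walk of a labelling with the column heights of a Dyck path measures the height of the path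
above the diagonal, so lasers correspond to enclosing positions. -/
theorem toPartition_eq_treePart (h : RationalParams a b (b - 1)) (D : RationalDyckPath a b)
    {ht : ℕ → ℕ} (hht : ∀ x < b, D.HasEastStep x (ht x)) {F : Fin a → Option (Fin (b - 1))}
    (hF : ∀ x : ℕ, x < b - 1 → ht x = ∑ z ∈ Finset.Ioc (-1 : ℤ) x, labelCount F z) :
    D.toPartition = treePart h F := by
  have hab := h.lt
  have hn := h.n_pos
  set V := labelWalk b F with hVdef
  have hV : ∀ x : ℕ, x < b - 1 → V x = b * ht x - a * (x + 1) := fun x hx => by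
    rw [hVdef, labelWalk_eq b F (by omega), ← hF x hx]
  have hpos : ∀ x : ℕ, x < b - 1 → 0 < V x := by
    intro x hx
    rw [hV x hx]
    have h1 := (hht x (by omega)).above
    have h2 := h.ne_mul (e := x + 1) (by omega) (by omega) (ht x)
    have h3 : (a : ℤ) * (x + 1) ≤ b * ht x := by exact_mod_cast h1
    omega
  have hend : (b : ℤ) * ht (b - 1) - a * ((b - 1 : ℕ) + 1) = 0 := by
    have h1 := (hht (b - 1) (by omega)).above
    have h2 := (hht (b - 1) (by omega)).le_north
    rw [Nat.sub_add_cancel (by omega), mul_comm] at h1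
    have h3 : ht (b - 1) = a := le_antisymm h2 (Nat.le_of_mul_le_mul_left h1 (by omega))
    have h4 : ((b - 1 : ℕ) : ℤ) + 1 = b := by omega
    rw [h3, h4]
    ring
  -- the laser fired from a valley encloses the labels that the position of the valley encloses
  have hlaser : ∀ (q j : ℕ) (i : Fin (b - 1)), (q + 1, j) ∈ D.lasers →
      (RationalDyckPath.Encloses (q + 1, j) i ↔ Enc V q (i : ℕ)) := by
    intro q j i hl
    obtain ⟨h1, -, h2, h3, h4, h5⟩ := (D.mem_lasers_iff hab hht).1 hl
    have hi := i.2
    simp only [RationalDyckPath.Encloses]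
    constructor
    · rintro ⟨h6, h7⟩
      refine ⟨by omega, fun y h8 h9 => ?_⟩
      obtain ⟨k, rfl⟩ := Int.eq_ofNat_of_zero_le (show 0 ≤ y by omega)
      rw [hV q (by omega), hV k (by omega)]
      exact h4 k (by omega) (by omega)
    · intro hE
      have h6 := hE.1
      refine ⟨by omega, ?_⟩
      by_contra! hlt
      have h7 := hE.2 j (by omega) (by omega)
      rw [hV q (by omega), hV j (by omega)] at h7
      omega
  have hexists : ∀ (q : ℕ) (i : Fin (b - 1)), Enc V q (i : ℕ) →
      ∃ j, (q + 1, j) ∈ D.lasers := by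
    intro q i hE
    have hi := i.2
    have hqi := hE.1
    have hq : q < b - 1 := by omega
    have hex : ∃ k, q < k ∧ k < b ∧
        (b : ℤ) * ht k - a * (k + 1) < b * ht q - a * (q + 1) := by
      refine ⟨b - 1, hq, by omega, ?_⟩
      rw [hend, ← hV q hq]
      exact hpos q hq
    classical
    obtain ⟨h1, h2, h3⟩ := Nat.find_spec hex
    refine ⟨Nat.find hex, (D.mem_lasers_iff hab hht).2 ⟨by omega, ?_, h1, h2, ?_, h3⟩⟩
    · have h4 := hE.2 (q + 1 : ℕ) (by omega) (by omega)
      rw [hV q hq, hV (q + 1) (by omega)] at h4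
      by_contra! hle
      have h5 : (b : ℤ) * ht (q + 1) ≤ b * ht q :=
        mul_le_mul_of_nonneg_left (by exact_mod_cast hle) (by positivity)
      push_cast at h4
      have h6 : (0 : ℤ) ≤ a := by positivity
      nlinarith
    · intro k hk1 hk2
      have h4 := Nat.find_min hex hk2
      have h5 : (b : ℤ) * ht q - a * (q + 1) ≤ b * ht k - a * (k + 1) := by
        by_contra! hlt
        exact h4 ⟨hk1, by omega, hlt⟩
      refine lt_of_le_of_ne h5 fun he => ?_
      refine h.ne_mul (e := k - q) (by omega) (by omega) (ht k - ht q) ?_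
      linarith
  refine ofSetoid_congr _ _ (Setoid.ext fun i j => ?_)
  change (∀ l ∈ D.lasers, _) ↔ TreeRel (b - 1) V (i : ℕ) (j : ℕ)
  rw [treeRel_iff_of_pos h (labelWalk_isWalk b F) (labelWalk_neg_one b F) hpos i.2 j.2]
  constructor
  · intro hvis q _
    constructor
    · intro hE
      obtain ⟨k, hk⟩ := hexists q i hE
      exact (hlaser q k j hk).1 ((hvis _ hk).1 ((hlaser q k i hk).2 hE))
    · intro hE
      obtain ⟨k, hk⟩ := hexists q j hE
      exact (hlaser q k i hk).1 ((hvis _ hk).2 ((hlaser q k j hk).2 hE))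
  · rintro hq ⟨p, k⟩ hl
    obtain ⟨y, z, hv, -⟩ := id hl
    have hp := ((D.isValley_iff (by omega)).1 hv).1
    obtain ⟨q, rfl⟩ : ∃ q, p = q + 1 := ⟨p - 1, by simp at hp; omega⟩
    rw [hlaser q k i hl, hlaser q k j hl]
    exact hq q (by have := ((D.mem_lasers_iff hab hht).1 hl).1; omega)

theorem sum_range_eq_sum_Ioc (f : ℤ → ℕ) (m : ℕ) :
    ∑ i ∈ Finset.range (m + 1), f i = ∑ z ∈ Finset.Ioc (-1 : ℤ) m, f z := by
  induction m with
  | zero => rfl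
  | succ m ih =>
    have h1 : Finset.Ioc (-1 : ℤ) (m + 1 : ℕ) =
        insert ((m + 1 : ℕ) : ℤ) (Finset.Ioc (-1) (m : ℤ)) := by
      ext z; simp only [Finset.mem_Ioc, Finset.mem_insert]; omega
    rw [Finset.sum_range_succ, ih, h1, Finset.sum_insert (by simp), add_comm]

/-- A rational parking function gives a Dyck path, and hence a rational noncrossing partition. -/
theorem IsDyck.treePart_mem (h : RationalParams a b (b - 1)) {F : Fin a → Option (Fin (b - 1))}
    (hF : IsDyck b F) : treePart h F ∈ RationalNC a b := by
  have hab := h.lt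
  have hn := h.n_pos
  set c : ℕ → ℕ := fun k => if k < b - 1 then labelCount F k else 0 with hc
  have hsum : ∀ x, x < b - 1 →
      ∑ i ∈ Finset.range (x + 1), c i = ∑ z ∈ Finset.Ioc (-1 : ℤ) x, labelCount F z := by
    intro x hx
    rw [← sum_range_eq_sum_Ioc (labelCount F)]
    refine Finset.sum_congr rfl fun i hi => if_pos ?_
    rw [Finset.mem_range] at hi
    omega
  have htot : ∑ i ∈ Finset.range b, c i = a := by
    obtain ⟨m, hm⟩ : ∃ m, b = m + 1 + 1 := ⟨b - 2, by omega⟩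
    have h1 : ∑ i ∈ Finset.range (m + 1), c i =
        ∑ z ∈ Finset.Ioc (-1 : ℤ) m, labelCount F z := hsum m (by omega)
    have h2 : c (m + 1) = 0 := if_neg (by omega)
    rw [hm, Finset.sum_range_succ, h1, h2, add_zero, sum_labelCount F
      (by intro u hu v hv; rw [Finset.mem_Ioc] at hu hv; omega)]
    rw [Finset.filter_true_of_mem, Finset.card_univ, Fintype.card_fin]
    intro i _
    obtain ⟨p, hp⟩ := Option.ne_none_iff_exists'.1 (hF.1 i)
    have := p.2
    exact ⟨(p : ℕ), Finset.mem_Ioc.2 ⟨by omega, by omega⟩, by rw [hp, lab_coe]⟩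
  have habove : ∀ x < b, a * (x + 1) ≤ b * ∑ i ∈ Finset.range (x + 1), c i := by
    intro x hx
    by_cases hxn : x < b - 1
    · have h1 := hF.2 x (by omega) (by omega)
      rw [labelWalk_eq b F (by omega), ← hsum x hxn] at h1
      have h2 : (a : ℤ) * (x + 1) < b * (∑ i ∈ Finset.range (x + 1), c i : ℕ) := by linarith
      exact_mod_cast h2.le
    · obtain rfl : b = x + 1 := by omega
      rw [htot, mul_comm]
  refine ⟨RationalDyckPath.ofColumns c htot habove, ?_⟩
  refine toPartition_eq_treePart h _
    (fun x hx => RationalDyckPath.ofColumns_hasEastStep c htot habove hx) fun x hx => hsum x hx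

/-- Every distribution of `a` labels into boxes is realised by a function. -/
theorem exists_fun_card_fiber {m : ℕ} (c : Fin m → ℕ) (hc : ∑ p, c p = a) :
    ∃ f : Fin a → Fin m, ∀ p, (Finset.univ.filter fun i => f i = p).card = c p := by
  subst hc
  refine ⟨fun i => (finSigmaFinEquiv.symm i).1, fun p => ?_⟩
  rw [← Fintype.card_subtype]
  have e : {i : Fin (∑ p, c p) // (finSigmaFinEquiv.symm i).1 = p} ≃
      {s : (p : Fin m) × Fin (c p) // s.1 = p} :=
    finSigmaFinEquiv.symm.subtypeEquiv fun _ => Iff.rfl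
  exact (Fintype.card_congr (e.trans (Equiv.sigmaSubtype p))).trans (Fintype.card_fin _)

/-- The partition of every Dyck path is the partition of a rational parking function. -/
theorem exists_isDyck (h : RationalParams a b (b - 1)) (D : RationalDyckPath a b) :
    ∃ F : Fin a → Option (Fin (b - 1)), IsDyck b F ∧ D.toPartition = treePart h F := by
  have hab := h.lt
  have hn := h.n_pos
  have hex : ∀ x, ∃ y, x < b → D.HasEastStep x y := fun x => by
    by_cases hx : x < b
    · obtain ⟨y, hy⟩ := D.exists_hasEastStep x hx
      exact ⟨y, fun _ => hy⟩
    · exact ⟨0, fun h' => absurd h' hx⟩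
  choose ht hht using hex
  set c : ℕ → ℕ := fun x => ht x - if x = 0 then 0 else ht (x - 1) with hc
  have hsum : ∀ x, x < b → ∑ i ∈ Finset.range (x + 1), c i = ht x := by
    intro x hx
    induction x with
    | zero => simp [hc]
    | succ x ih =>
      have h1 : c (x + 1) = ht (x + 1) - ht x := by simp [hc]
      have h2 := (hht x (by omega)).le (hht (x + 1) hx) (by omega)
      rw [Finset.sum_range_succ, ih (by omega), h1]
      omega
  -- the last north step precedes the last two east steps
  have htot : ht (b - 2) = a := by
    have h1 := (hht (b - 2) (by omega)).above
    refine le_antisymm (hht (b - 2) (by omega)).le_north ?_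
    by_contra! hlt
    rw [show b - 2 + 1 = b - 1 by omega] at h1
    have h2 : b * ht (b - 2) ≤ b * (a - 1) := Nat.mul_le_mul_left _ (by omega)
    have h3 : b * (a - 1) + b = b * a := by
      rw [← Nat.mul_succ]; congr 1; omega
    have h4 : a * (b - 1) + a = b * a := by
      rw [← Nat.mul_succ, mul_comm]; congr 1; omega
    omega
  obtain ⟨f, hf⟩ := exists_fun_card_fiber (a := a) (fun p : Fin (b - 1) => c p) (by
    rw [Fin.sum_univ_eq_sum_range c, ← htot, ← hsum _ (by omega)]
    congr 2
    omega)
  have hcount : ∀ k, k < b - 1 → labelCount (fun i => some (f i)) (k : ℤ) = c k := by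
    intro k hk
    have h1 : lab (b - 1) (k : ℤ) = ⟨k, hk⟩ := lab_coe (⟨k, hk⟩ : Fin (b - 1))
    simp only [labelCount, h1, Option.some_inj]
    exact hf ⟨k, hk⟩
  have hF : ∀ x : ℕ, x < b - 1 →
      ht x = ∑ z ∈ Finset.Ioc (-1 : ℤ) x, labelCount (fun i => some (f i)) z := by
    intro x hx
    rw [← sum_range_eq_sum_Ioc, ← hsum x (by omega)]
    refine Finset.sum_congr rfl fun i hi => ?_
    rw [Finset.mem_range] at hi
    rw [hcount i (by omega)]
  refine ⟨fun i => some (f i), ⟨fun i => by simp, fun x h0 hx => ?_⟩,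
    toPartition_eq_treePart h D hht hF⟩
  obtain ⟨m, rfl⟩ := Int.eq_ofNat_of_zero_le h0
  rw [labelWalk_eq b _ (by omega), ← hF m (by omega)]
  have h1 := (hht m (by omega)).above
  have h2 := h.ne_mul (e := m + 1) (by omega) (by omega) (ht m)
  have h3 : (a : ℤ) * (m + 1) ≤ b * ht m := by exact_mod_cast h1
  omega

end DyckPartition

/-! ### Noncrossing parking functions and labellings -/

namespace NCParkingFunction

variable {a b : ℕ}

theorem ext_of_common {x y : NCParkingFunction a b} (hp : x.part = y.part)
    (hl : ∀ i, ∃ B ∈ x.part.parts, i ∈ x.label B ∧ i ∈ y.label B) : x = y := by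
  refine NCParkingFunction.ext hp (funext fun B => ?_)
  by_cases hB : B ∈ x.part.parts
  · ext i
    obtain ⟨C, hC, h1, h2⟩ := hl i
    constructor
    · intro hi
      rwa [(x.label_cover i).unique ⟨hB, hi⟩ ⟨hC, h1⟩]
    · intro hi
      rwa [(y.label_cover i).unique ⟨hp ▸ hB, hi⟩ ⟨hp ▸ hC, h2⟩]
  · rw [x.label_of_notMem B hB, y.label_of_notMem B (hp ▸ hB)]

theorem exists_spot (x : NCParkingFunction a b) (i : Fin a) :
    ∃ p : Fin (b - 1), i ∈ x.label (x.part.part p) := by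
  obtain ⟨B, ⟨hB, hi⟩, -⟩ := x.label_cover i
  obtain ⟨p, hp⟩ := x.part.nonempty_of_mem_parts hB
  exact ⟨p, by rwa [x.part.part_eq_of_mem hB hp]⟩

/-- An element of the block that carries the label `i`. -/
noncomputable def spot (x : NCParkingFunction a b) (i : Fin a) : ℤ :=
  ((x.exists_spot i).choose : ℕ)

variable [NeZero (b - 1)]

theorem mem_label_iff (x : NCParkingFunction a b) {i : Fin a} {B : Finset (Fin (b - 1))}
    (hB : B ∈ x.part.parts) : i ∈ x.label B ↔ lab (b - 1) (x.spot i) ∈ B := by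
  have h1 := (x.exists_spot i).choose_spec
  have h2 : x.part.part (x.exists_spot i).choose ∈ x.part.parts :=
    x.part.part_mem.2 (Finset.mem_univ _)
  rw [spot, lab_coe, ← x.part.part_eq_iff_mem hB]
  constructor
  · exact fun hi => (x.label_cover i).unique ⟨h2, h1⟩ ⟨hB, hi⟩
  · rintro rfl
    exact h1

end NCParkingFunction

section Labelling

variable {a b n : ℕ} [NeZero n]

/-- The block `B` meets the open interval from `y` to `x`. -/
def MeetsGap (y x : ℤ) (B : Finset (Fin n)) : Prop := ∃ z, y < z ∧ z < x ∧ lab n z ∈ B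

theorem gapCount_eq_sum (P : Finpartition (Finset.univ : Finset (Fin n))) (κ : Fin a → ℤ)
    (y x : ℤ) [DecidablePred (MeetsGap (n := n) y x)] : gapCount (partRel P) κ y x =
      ∑ B ∈ P.parts.filter (MeetsGap y x),
        (Finset.univ.filter fun i => lab n (κ i) ∈ B).card := by
  rw [← Finset.card_biUnion]
  · rw [gapCount]
    congr 1
    ext i
    simp only [Finset.mem_biUnion, Finset.mem_filter, Finset.mem_univ, true_and, MeetsGap]
    constructor
    · rintro ⟨z, h1, h2, h3⟩
      exact ⟨_, ⟨P.part_mem.2 (Finset.mem_univ (lab n z)), z, h1, h2,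
        P.mem_part (Finset.mem_univ _)⟩, partRel_iff_mem.1 h3⟩
    · rintro ⟨B, ⟨hB, z, h1, h2, h3⟩, h4⟩
      exact ⟨z, h1, h2, (partRel_iff_of_mem hB h4).2 h3⟩
  · intro B₁ hB₁ B₂ hB₂ hne
    rw [Function.onFun, Finset.disjoint_filter]
    intro i _ hi1 hi2
    exact hne (P.eq_of_mem_parts (Finset.mem_filter.1 hB₁).1 (Finset.mem_filter.1 hB₂).1 hi1 hi2)

/-- The gap conditions only depend on the numbers of labels on the blocks. -/
theorem IsRationalNC.congr_card {P : Finpartition (Finset.univ : Finset (Fin n))}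
    {κ κ' : Fin a → ℤ} (G : IsRationalNC a b n (partRel P) κ)
    (hκ : ∀ B ∈ P.parts, (Finset.univ.filter fun i => lab n (κ i) ∈ B).card =
      (Finset.univ.filter fun i => lab n (κ' i) ∈ B).card) :
    IsRationalNC a b n (partRel P) κ' := by
  have key : ∀ y x, gapCount (partRel P) κ' y x = gapCount (partRel P) κ y x := by
    intro y x
    let _ := Classical.decPred (MeetsGap (n := n) y x)
    rw [gapCount_eq_sum, gapCount_eq_sum]
    exact Finset.sum_congr rfl fun B hB => (hκ B (Finset.mem_filter.1 hB).1).symm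
  exact ⟨G.toIsNoncrossing, fun y x h1 h2 h3 => key y x ▸ G.gap_le y x h1 h2 h3,
    fun y x h1 h2 h3 => key y x ▸ G.gap_lt y x h1 h2 h3⟩

open Classical in
/-- A representative of the block to which a labelling attaches the label `i`: its position if it
has one, and otherwise a root. -/
noncomputable def home (b : ℕ) (F : Fin a → Option (Fin n)) (i : Fin a) : ℤ :=
  match F i with
  | some p => (p : ℕ)
  | none => if hx : ∃ x, IsRoot (labelWalk b F) x then hx.choose else 0

theorem lab_home {F : Fin a → Option (Fin n)} {i : Fin a} {p : Fin n} (hi : F i = some p) :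
    lab n (home b F i) = p := by
  simp only [home, hi, lab_coe]

theorem isRoot_home (h : RationalParams a b n) {F : Fin a → Option (Fin n)} {i : Fin a}
    (hi : F i = none) : IsRoot (labelWalk b F) (home b F i) := by
  have hx := exists_isRoot h hi
  simp only [home, hi, dif_pos hx]
  exact hx.choose_spec

theorem isRationalNC_home (h : RationalParams a b n) (F : Fin a → Option (Fin n)) :
    IsRationalNC a b n (partRel (treePart h F)) (home b F) :=
  partRel_treePart_isRationalNC h (fun _ _ hi => lab_home hi) fun _ hi => isRoot_home h hi

end Labelling

section Correspondence

variable {a b : ℕ} [NeZero (b - 1)]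

/-- The gap conditions characterise the rational noncrossing partitions. As they do not refer to a
first label, the set of these partitions is invariant under rotation. -/
theorem IsRationalNC.mem_rationalNC (h : RationalParams a b (b - 1))
    {P : Finpartition (Finset.univ : Finset (Fin (b - 1)))} {κ : Fin a → ℤ}
    (G : IsRationalNC a b (b - 1) (partRel P) κ) : P ∈ RationalNC a b := by
  rw [← treePart_minLabelling h G]
  exact (isDyck_minLabelling h G).treePart_mem h

/-- The blocks of a noncrossing parking function carry as many labels as those of the parking
function of a Dyck path, since both numbers are the ranks. -/
theorem NCParkingFunction.isRationalNC (h : RationalParams a b (b - 1))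
    (x : NCParkingFunction a b) : IsRationalNC a b (b - 1) (partRel x.part) x.spot := by
  obtain ⟨D, hD⟩ := x.part_mem
  obtain ⟨F, -, hF⟩ := exists_isDyck h D
  have G := isRationalNC_home h F
  rw [← hF, hD] at G
  refine G.congr_card fun B hB => ?_
  have h1 := x.label_card B hB
  rw [blockRank_eq h G hB, Nat.cast_inj] at h1
  rw [← h1]
  congr 1
  ext i
  simp [x.mem_label_iff hB]

/-- The noncrossing parking function of a partition with its labels placed by `κ`. -/
def ofPlacement (h : RationalParams a b (b - 1))
    (P : Finpartition (Finset.univ : Finset (Fin (b - 1)))) (κ : Fin a → ℤ)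
    (G : IsRationalNC a b (b - 1) (partRel P) κ) : NCParkingFunction a b where
  part := P
  label B := if B ∈ P.parts then Finset.univ.filter fun i => lab (b - 1) (κ i) ∈ B else ∅
  part_mem := G.mem_rationalNC h
  label_cover i := by
    refine ⟨P.part (lab (b - 1) (κ i)), ⟨P.part_mem.2 (Finset.mem_univ _), ?_⟩, ?_⟩
    · rw [if_pos (P.part_mem.2 (Finset.mem_univ _))]
      simp
    · rintro B ⟨hB, hi⟩
      rw [if_pos hB] at hi
      exact (P.part_eq_of_mem hB (by simpa using hi)).symm
  label_card B hB := by rw [blockRank_eq h G hB, if_pos hB]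
  label_of_notMem B hB := if_neg hB

theorem mem_ofPlacement_label (h : RationalParams a b (b - 1))
    {P : Finpartition (Finset.univ : Finset (Fin (b - 1)))} {κ : Fin a → ℤ}
    (G : IsRationalNC a b (b - 1) (partRel P) κ) {B : Finset (Fin (b - 1))} (hB : B ∈ P.parts)
    (i : Fin a) : i ∈ (ofPlacement h P κ G).label B ↔ lab (b - 1) (κ i) ∈ B := by
  simp [ofPlacement, hB]

/-- A noncrossing parking function is determined by its partition and the blocks of its labels. -/
theorem eq_ofPlacement (h : RationalParams a b (b - 1))
    {P : Finpartition (Finset.univ : Finset (Fin (b - 1)))} {κ : Fin a → ℤ}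
    (G : IsRationalNC a b (b - 1) (partRel P) κ) (x : NCParkingFunction a b) (hx : x.part = P)
    (hκ : ∀ i, partRel P (κ i) (x.spot i)) : x = ofPlacement h P κ G := by
  subst hx
  refine NCParkingFunction.ext_of_common rfl fun i => ?_
  have hB : x.part.part (lab (b - 1) (x.spot i)) ∈ x.part.parts :=
    x.part.part_mem.2 (Finset.mem_univ _)
  exact ⟨_, hB, (x.mem_label_iff hB).2 (x.part.mem_part (Finset.mem_univ _)),
    (mem_ofPlacement_label h G hB i).2 (partRel_iff_mem.1 (hκ i))⟩

/-- The noncrossing parking function of a labelling. -/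
noncomputable def ncOfLabelling (h : RationalParams a b (b - 1))
    (F : Fin a → Option (Fin (b - 1))) : NCParkingFunction a b :=
  ofPlacement h (treePart h F) (home b F) (isRationalNC_home h F)

/-- A noncrossing parking function comes from the labelling defined by any centre of its
partition. -/
theorem ncOfLabelling_eq_of_isCenter (h : RationalParams a b (b - 1)) (x : NCParkingFunction a b)
    {central : ℤ → Prop} {s : ℤ → ℤ} (C : IsCenter (b - 1) (partRel x.part) central s)
    {F : Fin a → Option (Fin (b - 1))} (hF1 : ∀ i, central (x.spot i) → F i = none)
    (hF2 : ∀ i, ¬ central (x.spot i) → F i = some (lab (b - 1) (s (x.spot i)))) :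
    ncOfLabelling h F = x := by
  have G := x.isRationalNC h
  have N := G.toIsNoncrossing
  have hP : x.part = treePart h F := eq_of_partRel_iff fun y z => by
    rw [partRel_treePart, C.treeRel_iff h G hF1 hF2]
  refine (eq_ofPlacement h _ x hP fun i => ?_).symm
  rw [← hP]
  by_cases hc : central (x.spot i)
  · refine C.rel_of_central _ _ ?_ hc
    by_contra hcon
    exact isRoot_home h (hF1 i hc) _ (C.isParent_start h G hF1 hF2 hcon).enc
  · exact N.equiv.trans (IsCenter.rel_of_lab_eq N (lab_home (hF2 i hc))) (C.rel_start _ hc)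

end Correspondence

/-! ### The action -/

section MapPart

variable {n : ℕ}

/-- The image of a partition under a permutation. -/
def mapPart (σ : Equiv.Perm (Fin n)) (P : Finpartition (Finset.univ : Finset (Fin n))) :
    Finpartition (Finset.univ : Finset (Fin n)) :=
  Finpartition.ofExistsUnique (P.parts.image fun B => B.map σ.toEmbedding)
    (fun _ _ => Finset.subset_univ _)
    (fun i _ => by
      obtain ⟨B, ⟨hB, hi⟩, huniq⟩ := P.existsUnique_mem (Finset.mem_univ (σ.symm i))
      refine ⟨B.map σ.toEmbedding, ⟨Finset.mem_image_of_mem _ hB,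
        Finset.mem_map.2 ⟨_, hi, by simp⟩⟩, ?_⟩
      rintro C ⟨hC, hiC⟩
      obtain ⟨B', hB', rfl⟩ := Finset.mem_image.1 hC
      obtain ⟨j, hj, rfl⟩ := Finset.mem_map.1 hiC
      rw [huniq B' ⟨hB', by simpa using hj⟩])
    (fun h0 => by
      obtain ⟨B, hB, h1⟩ := Finset.mem_image.1 h0
      exact P.ne_empty hB (Finset.map_eq_empty.1 h1))

theorem mapPart_parts (σ : Equiv.Perm (Fin n))
    (P : Finpartition (Finset.univ : Finset (Fin n))) :
    (mapPart σ P).parts = P.parts.image fun B => B.map σ.toEmbedding := rfl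

theorem map_mem_mapPart_parts {σ : Equiv.Perm (Fin n)}
    {P : Finpartition (Finset.univ : Finset (Fin n))} {B : Finset (Fin n)} :
    B.map σ.toEmbedding ∈ (mapPart σ P).parts ↔ B ∈ P.parts := by
  rw [mapPart_parts, Finset.mem_image]
  constructor
  · rintro ⟨C, hC, he⟩
    rwa [← Finset.map_injective _ he]
  · exact fun hB => ⟨B, hB, rfl⟩

theorem mapPart_one (P : Finpartition (Finset.univ : Finset (Fin n))) : mapPart 1 P = P := by
  refine Finpartition.ext ?_
  rw [mapPart_parts]
  exact (Finset.image_congr fun B _ => Finset.map_refl).trans Finset.image_id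

theorem map_mul_perm {α : Type*} (σ τ : Equiv.Perm α) (B : Finset α) :
    B.map (σ * τ).toEmbedding = (B.map τ.toEmbedding).map σ.toEmbedding := by
  rw [Finset.map_map]
  rfl

theorem map_one_perm {α : Type*} (B : Finset α) : B.map (1 : Equiv.Perm α).toEmbedding = B :=
  Finset.map_refl

theorem mapPart_mul (σ τ : Equiv.Perm (Fin n))
    (P : Finpartition (Finset.univ : Finset (Fin n))) :
    mapPart (σ * τ) P = mapPart σ (mapPart τ P) := by
  refine Finpartition.ext ?_
  rw [mapPart_parts, mapPart_parts, mapPart_parts, Finset.image_image]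
  refine Finset.image_congr fun B _ => map_mul_perm σ τ B

end MapPart

section Rotate

variable {n : ℕ} [NeZero n]

/-- Translation of the labels by `k`. -/
def rotPerm (n : ℕ) [NeZero n] (k : ℤ) : Equiv.Perm (Fin n) where
  toFun i := lab n ((i : ℕ) + k)
  invFun i := lab n ((i : ℕ) - k)
  left_inv i := by
    obtain ⟨m, hm⟩ := lab_eq_iff.1 (lab_coe (lab n ((i : ℕ) + k)))
    dsimp only
    rw [hm, lab_eq_coe_iff]
    exact ⟨m, by ring⟩
  right_inv i := by
    obtain ⟨m, hm⟩ := lab_eq_iff.1 (lab_coe (lab n ((i : ℕ) - k)))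
    dsimp only
    rw [hm, lab_eq_coe_iff]
    exact ⟨m, by ring⟩

theorem rotPerm_lab (k x : ℤ) : rotPerm n k (lab n x) = lab n (x + k) := by
  obtain ⟨m, hm⟩ := lab_eq_iff.1 (lab_coe (lab n x))
  change lab n (_ + k) = _
  rw [hm, lab_eq_iff]
  exact ⟨m, by ring⟩

theorem exists_lab_eq (i : Fin n) : ∃ x : ℤ, lab n x = i := ⟨(i : ℕ), lab_coe i⟩

theorem rotPerm_add (k l : ℤ) : rotPerm n (k + l) = rotPerm n k * rotPerm n l := by
  ext i
  obtain ⟨x, rfl⟩ := exists_lab_eq i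
  rw [Equiv.Perm.mul_apply, rotPerm_lab, rotPerm_lab, rotPerm_lab]
  congr 2
  ring

theorem rotPerm_zero : rotPerm n 0 = 1 := by
  ext i
  obtain ⟨x, rfl⟩ := exists_lab_eq i
  rw [rotPerm_lab, add_zero, Equiv.Perm.one_apply]

theorem rotPerm_congr {k l : ℤ} (hkl : (k : ZMod n) = l) : rotPerm n k = rotPerm n l := by
  ext i
  obtain ⟨x, rfl⟩ := exists_lab_eq i
  obtain ⟨m, hm⟩ := (ZMod.intCast_eq_intCast_iff_dvd_sub _ _ _).1 hkl
  rw [rotPerm_lab, rotPerm_lab, lab_eq_iff.2 ⟨-m, show x + k = x + l + -m * n by linarith⟩]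

theorem rotPerm_one : rotPerm n 1 = finRotate n := by
  obtain ⟨m, rfl⟩ : ∃ m, n = m + 1 := ⟨n - 1, (Nat.succ_pred (NeZero.ne n)).symm⟩
  ext i
  have h1 := lab_val (n := m + 1) ((i : ℕ) + 1)
  change ((lab (m + 1) ((i : ℕ) + 1) : Fin (m + 1)) : ℕ) = _
  rw [finRotate_apply, Fin.val_add, Fin.val_one', Nat.add_mod_mod]
  exact_mod_cast h1

/-- The action of `ℤ / n` on the labels by rotation. -/
def rotHom (n : ℕ) [NeZero n] : Multiplicative (ZMod n) →* Equiv.Perm (Fin n) where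
  toFun g := rotPerm n (g.toAdd.cast : ℤ)
  map_one' := by rw [toAdd_one, ZMod.cast_zero, rotPerm_zero]
  map_mul' g g' := by
    rw [← rotPerm_add]
    exact rotPerm_congr (by simp)

theorem rotHom_ofAdd (k : ℤ) : rotHom n (Multiplicative.ofAdd (k : ZMod n)) = rotPerm n k :=
  rotPerm_congr (by simp)

theorem exists_rotHom_eq (g : Multiplicative (ZMod n)) : ∃ k : ℤ, rotHom n g = rotPerm n k :=
  ⟨_, rfl⟩

theorem partRel_mapPart (k : ℤ) (P : Finpartition (Finset.univ : Finset (Fin n))) (x y : ℤ) :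
    partRel (mapPart (rotPerm n k) P) (x + k) (y + k) ↔ partRel P x y := by
  have hB : P.part (lab n x) ∈ P.parts := P.part_mem.2 (Finset.mem_univ _)
  have hx : lab n x ∈ P.part (lab n x) := P.mem_part (Finset.mem_univ _)
  have hiff : ∀ z, lab n (z + k) ∈ (P.part (lab n x)).map (rotPerm n k).toEmbedding ↔
      lab n z ∈ P.part (lab n x) := by
    intro z
    rw [← rotPerm_lab]
    exact Finset.mem_map' (rotPerm n k).toEmbedding
  rw [partRel_iff_of_mem (map_mem_mapPart_parts.2 hB) ((hiff x).2 hx), hiff,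
    ← partRel_iff_of_mem hB hx]

theorem IsRationalNC.rotate {a b : ℕ} {P : Finpartition (Finset.univ : Finset (Fin n))}
    {κ : Fin a → ℤ} (G : IsRationalNC a b n (partRel P) κ) (k : ℤ) :
    IsRationalNC a b n (partRel (mapPart (rotPerm n k) P)) fun i => κ i + k := by
  have hR : ∀ x y, partRel (mapPart (rotPerm n k) P) x y ↔
      partRel P (x - k) (y - k) := by
    intro x y
    rw [← partRel_mapPart k P, sub_add_cancel, sub_add_cancel]
  have hgap : ∀ y x, gapCount (partRel (mapPart (rotPerm n k) P)) (fun i => κ i + k) y x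
      = gapCount (partRel P) κ (y - k) (x - k) := by
    intro y x
    rw [gapCount, gapCount]
    congr 1
    ext i
    simp only [Finset.mem_filter, Finset.mem_univ, true_and]
    constructor
    · rintro ⟨z, h1, h2, h3⟩
      rw [hR, add_sub_cancel_right] at h3
      exact ⟨z - k, by omega, by omega, h3⟩
    · rintro ⟨z, h1, h2, h3⟩
      exact ⟨z + k, by omega, by omega, (partRel_mapPart k P _ _).2 h3⟩
  have hcons : ∀ y x : ℤ, (∀ z, y < z → z < x →
      ¬ partRel (mapPart (rotPerm n k) P) y z) →
      ∀ z, y - k < z → z < x - k → ¬ partRel P (y - k) z := by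
    intro y x hno z h1 h2 h3
    refine hno (z + k) (by omega) (by omega) ?_
    rwa [hR, add_sub_cancel_right]
  refine ⟨⟨⟨fun x => rfl, fun h1 => h1.symm, fun h1 h2 => h1.trans h2⟩, fun x => ?_,
    fun y z x t h1 h2 h3 h4 h5 h6 => ?_⟩, fun y x h1 h2 h3 => ?_, fun y x h1 h2 h3 => ?_⟩
  · rw [hR, add_sub_right_comm]
    exact G.per _
  · rw [hR] at *
    exact G.noncrossing (y - k) (z - k) (x - k) (t - k) (by omega) (by omega) (by omega)
      (by omega) h5 h6
  · have := G.gap_le (y - k) (x - k) (by omega) ((hR y x).1 h2) (hcons y x h3)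
    rw [hgap]
    simpa using this
  · have := G.gap_lt (y - k) (x - k) (by omega) ((hR y x).1 h2) (hcons y x h3)
    rw [hgap]
    simpa using this

end Rotate

section Action

variable {a b : ℕ} [NeZero (b - 1)]

theorem isRationalNC_rotHom (h : RationalParams a b (b - 1)) (x : NCParkingFunction a b)
    (g : Multiplicative (ZMod (b - 1))) : ∃ κ : Fin a → ℤ,
      IsRationalNC a b (b - 1) (partRel (mapPart (rotHom (b - 1) g) x.part)) κ ∧
      ∀ i, lab (b - 1) (κ i) = rotHom (b - 1) g (lab (b - 1) (x.spot i)) := by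
  obtain ⟨k, hk⟩ := exists_rotHom_eq g
  exact ⟨_, hk ▸ (x.isRationalNC h).rotate k, fun i => by rw [hk, rotPerm_lab]⟩

/-- Relabelling by `w` and rotation by `g`. -/
def actFun (h : RationalParams a b (b - 1))
    (s : Equiv.Perm (Fin a) × Multiplicative (ZMod (b - 1))) (x : NCParkingFunction a b) :
    NCParkingFunction a b where
  part := mapPart (rotHom (b - 1) s.2) x.part
  label B := (x.label (B.map (rotHom (b - 1) s.2)⁻¹.toEmbedding)).map s.1.toEmbedding
  part_mem := by
    obtain ⟨κ, G, -⟩ := isRationalNC_rotHom h x s.2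
    exact G.mem_rationalNC h
  label_cover i := by
    obtain ⟨B, ⟨hB, hi⟩, huniq⟩ := x.label_cover (s.1⁻¹ i)
    refine ⟨B.map (rotHom (b - 1) s.2).toEmbedding, ⟨map_mem_mapPart_parts.2 hB, ?_⟩, ?_⟩
    · rw [← map_mul_perm, inv_mul_cancel, map_one_perm, Finset.mem_map]
      exact ⟨_, hi, by simp⟩
    · rintro C ⟨hC, hi⟩
      obtain ⟨B', hB', rfl⟩ := Finset.mem_image.1 hC
      rw [← map_mul_perm, inv_mul_cancel, map_one_perm, Finset.mem_map] at hi
      obtain ⟨j, hj, rfl⟩ := hi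
      rw [huniq B' ⟨hB', by simpa using hj⟩]
  label_card C hC := by
    obtain ⟨κ, G, hκ⟩ := isRationalNC_rotHom h x s.2
    obtain ⟨B, hB, rfl⟩ := Finset.mem_image.1 hC
    rw [blockRank_eq h G hC, Finset.card_map, ← map_mul_perm, inv_mul_cancel, map_one_perm]
    congr 2
    ext i
    rw [x.mem_label_iff hB, Finset.mem_filter, hκ]
    simp
  label_of_notMem C hC := by
    rw [x.label_of_notMem, Finset.map_empty]
    intro hB
    refine hC ?_
    have := (map_mem_mapPart_parts (σ := rotHom (b - 1) s.2)).2 hB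
    rwa [← map_mul_perm, mul_inv_cancel, map_one_perm] at this

/-- The action of `𝔖_a × ℤ / (b - 1)` on noncrossing parking functions. -/
@[reducible]
def parkingAction (h : RationalParams a b (b - 1)) :
    MulAction (Equiv.Perm (Fin a) × Multiplicative (ZMod (b - 1))) (NCParkingFunction a b) where
  smul := actFun h
  one_smul x := by
    refine NCParkingFunction.ext ?_ (funext fun B => ?_)
    · change mapPart (rotHom (b - 1) 1) x.part = _
      rw [map_one, mapPart_one]
    · change (x.label (B.map (rotHom (b - 1) 1)⁻¹.toEmbedding)).map
        (1 : Equiv.Perm (Fin a)).toEmbedding = _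
      rw [map_one, inv_one, map_one_perm, map_one_perm]
  mul_smul s t x := by
    refine NCParkingFunction.ext ?_ (funext fun B => ?_)
    · change mapPart (rotHom (b - 1) (s.2 * t.2)) x.part = mapPart _ (mapPart _ _)
      rw [map_mul, mapPart_mul]
    · change (x.label (B.map (rotHom (b - 1) (s.2 * t.2))⁻¹.toEmbedding)).map
        (s.1 * t.1).toEmbedding =
          Finset.map _ (Finset.map _ (x.label (Finset.map _ (Finset.map _ B))))
      rw [map_mul, mul_inv_rev, map_mul_perm, map_mul_perm]

end Action

/-! ### Fixed points of a nontrivial rotation -/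

section FixedPoints

variable {a b : ℕ} [NeZero (b - 1)]

theorem partRel_spot_of_mem (x : NCParkingFunction a b) {i : Fin a} {z : ℤ}
    (hi : i ∈ x.label (x.part.part (lab (b - 1) z))) : partRel x.part (x.spot i) z :=
  partRel_iff_mem.2 ((x.mem_label_iff (x.part.part_mem.2 (Finset.mem_univ _))).1 hi)

/-- A noncrossing parking function is fixed if its partition is invariant under the rotation and `w`
moves the labels of each block to the rotated block. -/
theorem actFun_eq_self_iff (h : RationalParams a b (b - 1)) (w : Equiv.Perm (Fin a))
    {g : Multiplicative (ZMod (b - 1))} {e : ℤ} (hg : rotHom (b - 1) g = rotPerm (b - 1) e)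
    (x : NCParkingFunction a b) : actFun h (w, g) x = x ↔
      (∀ y z, partRel x.part (y + e) (z + e) ↔ partRel x.part y z) ∧
      ∀ i, partRel x.part (x.spot (w i)) (x.spot i + e) := by
  have hmem : ∀ i, w i ∈ (actFun h (w, g) x).label
      ((x.part.part (lab (b - 1) (x.spot i))).map (rotPerm (b - 1) e).toEmbedding) := by
    intro i
    change w i ∈ (x.label _).map w.toEmbedding
    simp only [hg]
    rw [← map_mul_perm, inv_mul_cancel, map_one_perm]
    exact Finset.mem_map_of_mem _ ((x.mem_label_iff (x.part.part_mem.2 (Finset.mem_univ _))).2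
      (x.part.mem_part (Finset.mem_univ _)))
  have hB : ∀ i, (x.part.part (lab (b - 1) (x.spot i))).map (rotPerm (b - 1) e).toEmbedding ∈
      (actFun h (w, g) x).part.parts := by
    intro i
    change _ ∈ (mapPart (rotHom (b - 1) g) x.part).parts
    rw [hg]
    exact map_mem_mapPart_parts.2 (x.part.part_mem.2 (Finset.mem_univ _))
  have hlab : ∀ i, lab (b - 1) (x.spot i + e) ∈
      (x.part.part (lab (b - 1) (x.spot i))).map (rotPerm (b - 1) e).toEmbedding := by
    intro i
    rw [← rotPerm_lab]
    exact Finset.mem_map_of_mem _ (x.part.mem_part (Finset.mem_univ _))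
  constructor
  · intro hx
    have hpart : mapPart (rotPerm (b - 1) e) x.part = x.part := by
      rw [← hg]
      exact congrArg NCParkingFunction.part hx
    refine ⟨fun y z => ?_, fun i => ?_⟩
    · have := partRel_mapPart e x.part y z
      rwa [hpart] at this
    · have h1 := hmem i
      have h2 := hB i
      rw [hx] at h1 h2
      exact (partRel_iff_of_mem h2 ((x.mem_label_iff h2).1 h1)).2 (hlab i)
  · rintro ⟨h1, h2⟩
    have hpart : mapPart (rotPerm (b - 1) e) x.part = x.part :=
      eq_of_partRel_iff fun y z => by
        have := partRel_mapPart e x.part (y - e) (z - e)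
        have h3 := h1 (y - e) (z - e)
        rw [sub_add_cancel, sub_add_cancel] at this h3
        rw [this, h3]
    have hpart' : (actFun h (w, g) x).part = x.part := by
      change mapPart (rotHom (b - 1) g) x.part = x.part
      rw [hg, hpart]
    refine NCParkingFunction.ext_of_common hpart' fun i => ?_
    obtain ⟨j, rfl⟩ := w.surjective i
    refine ⟨_, hB j, hmem j, ?_⟩
    have h3 := hB j
    rw [hpart'] at h3
    exact (x.mem_label_iff h3).2 ((partRel_iff_of_mem h3 (hlab j)).1 (h2 j).symm)

theorem partRel_spot_ncOfLabelling (h : RationalParams a b (b - 1))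
    (F : Fin a → Option (Fin (b - 1))) (i : Fin a) :
    partRel (treePart h F) ((ncOfLabelling h F).spot i) (home b F i) := by
  refine partRel_spot_of_mem (ncOfLabelling h F) ?_
  exact (mem_ofPlacement_label h (isRationalNC_home h F)
    (Finpartition.part_mem _ |>.2 (Finset.mem_univ _)) i).2
    (Finpartition.mem_part _ (Finset.mem_univ _))

/-- A labelling that is equivariant for the permutation `w` of the labels and the rotation of the
positions by `e`. -/
def IsEquivariant (w : Equiv.Perm (Fin a)) (e : ℤ) (F : Fin a → Option (Fin (b - 1))) : Prop :=
  ∀ i, F (w i) = (F i).map (rotPerm (b - 1) e)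

theorem IsEquivariant.labelCount_add {w : Equiv.Perm (Fin a)} {e : ℤ}
    {F : Fin a → Option (Fin (b - 1))} (hF : IsEquivariant w e F) (x : ℤ) :
    labelCount F (x + e) = labelCount F x := by
  rw [labelCount, labelCount, eq_comm]
  refine Finset.card_equiv w fun i => ?_
  simp only [Finset.mem_filter, Finset.mem_univ, true_and]
  rw [hF i, ← rotPerm_lab, Option.map_eq_some_iff]
  constructor
  · intro hi
    exact ⟨_, hi, rfl⟩
  · rintro ⟨p, hp, hp'⟩
    rwa [← (rotPerm (b - 1) e).injective hp']

theorem IsEquivariant.exists_shift (h : RationalParams a b (b - 1)) {w : Equiv.Perm (Fin a)}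
    {e : ℤ} (he : 0 < e) (hen : e < (b - 1 : ℕ)) {F : Fin a → Option (Fin (b - 1))}
    (hF : IsEquivariant w e F) : ∃ δ, ∀ x, labelWalk b F (x + e) = labelWalk b F x + δ := by
  obtain ⟨δ, -, hδ⟩ := (labelWalk_isWalk b F).exists_shift h he (by omega) hF.labelCount_add
  exact ⟨δ, hδ⟩

theorem IsEquivariant.treeRel_add (h : RationalParams a b (b - 1)) {w : Equiv.Perm (Fin a)}
    {e : ℤ} (he : 0 < e) (hen : e < (b - 1 : ℕ)) {F : Fin a → Option (Fin (b - 1))}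
    (hF : IsEquivariant w e F) {x y : ℤ} :
    TreeRel (b - 1) (labelWalk b F) (x + e) (y + e) ↔
      TreeRel (b - 1) (labelWalk b F) x y := by
  obtain ⟨δ, hδ⟩ := hF.exists_shift h he hen
  refine exists_congr fun k => ?_
  rw [add_right_comm]
  constructor
  · intro hs p
    have := hs (p + e)
    rwa [PeriodicWalk.enc_translate hδ, PeriodicWalk.enc_translate hδ] at this
  · intro hs p
    have := hs (p - e)
    rwa [← PeriodicWalk.enc_translate hδ, ← PeriodicWalk.enc_translate hδ (x := y + k * _),
      sub_add_cancel] at this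

theorem IsEquivariant.isRoot_add (h : RationalParams a b (b - 1)) {w : Equiv.Perm (Fin a)}
    {e : ℤ} (he : 0 < e) (hen : e < (b - 1 : ℕ)) {F : Fin a → Option (Fin (b - 1))}
    (hF : IsEquivariant w e F) {x : ℤ} (hx : IsRoot (labelWalk b F) x) :
    IsRoot (labelWalk b F) (x + e) := by
  obtain ⟨δ, hδ⟩ := hF.exists_shift h he hen
  intro p hp
  rw [← sub_add_cancel p e, PeriodicWalk.enc_translate hδ] at hp
  exact hx _ hp

/-- Equivariant labellings give fixed points. -/
theorem IsEquivariant.actFun_eq (h : RationalParams a b (b - 1)) {w : Equiv.Perm (Fin a)}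
    {g : Multiplicative (ZMod (b - 1))} {e : ℤ} (hg : rotHom (b - 1) g = rotPerm (b - 1) e)
    (he : 0 < e) (hen : e < (b - 1 : ℕ)) {F : Fin a → Option (Fin (b - 1))}
    (hF : IsEquivariant w e F) : actFun h (w, g) (ncOfLabelling h F) = ncOfLabelling h F := by
  have hinv : ∀ y z, partRel (treePart h F) (y + e) (z + e) ↔ partRel (treePart h F) y z :=
    fun y z => by rw [partRel_treePart, partRel_treePart, hF.treeRel_add h he hen]
  refine (actFun_eq_self_iff h w hg _).2 ⟨hinv, fun i => ?_⟩
  have h1 := partRel_spot_ncOfLabelling h F (w i)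
  have h2 := (hinv _ _).2 (partRel_spot_ncOfLabelling h F i)
  refine h1.trans (Eq.trans ?_ h2.symm)
  change partRel (treePart h F) _ _
  rw [partRel_treePart]
  cases hi : F i with
  | some p =>
    have hi' : F (w i) = some (rotPerm (b - 1) e p) := by rw [hF i, hi, Option.map_some]
    refine PeriodicWalk.treeRel_of_lab_eq ?_
    rw [lab_home hi', ← rotPerm_lab, lab_home hi]
  | none =>
    have hi' : F (w i) = none := by rw [hF i, hi, Option.map_none]
    exact PeriodicWalk.treeRel_of_same
      ((isRoot_home h hi').same (hF.isRoot_add h he hen (isRoot_home h hi)))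

/-- The classes of an equivariant labelling that carry positioned labels have clusters shorter
than half a period. -/
theorem IsEquivariant.exists_cluster (h : RationalParams a b (b - 1)) {w : Equiv.Perm (Fin a)}
    {e : ℤ} (he : 0 < e) (hen : e < (b - 1 : ℕ)) {F : Fin a → Option (Fin (b - 1))}
    (hF : IsEquivariant w e F) {i : Fin a} {p : Fin (b - 1)} (hi : F i = some p) {y : ℤ}
    (hR : partRel (treePart h F) (home b F i) y) :
    ∃ k : ℤ, home b F i ≤ y + k * (b - 1 : ℕ) ∧ y + k * (b - 1 : ℕ) < home b F i + e ∧
      y + k * (b - 1 : ℕ) < home b F i + ((b - 1 : ℕ) - e) := by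
  have W := labelWalk_isWalk b F
  rw [partRel_treePart] at hR
  obtain ⟨k, hk⟩ := hR
  have hc : 0 < labelCount F (home b F i) := by
    rw [labelCount, Finset.card_pos]
    exact ⟨i, by simp [hi, lab_home hi]⟩
  have hp := W.isParent_of_same h hk (W.isParent_pred h hc)
  have hper : ∀ x, labelCount F (x + ((b - 1 : ℕ) - e)) = labelCount F x := fun x => by
    rw [← hF.labelCount_add, ← W.periodic x]
    congr 1
    ring
  have h1 := W.le_add_of_isParent h he (by omega) hF.labelCount_add hp
  have h2 := W.le_add_of_isParent h (e := (b - 1 : ℕ) - e) (by omega) (by omega) hper hp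
  have h3 := hp.1
  exact ⟨k, by omega, by omega, by omega⟩

/-- The noncrossing parking function determines the equivariant labelling: each positioned label
sits at the beginning of the only cluster of its class shorter than half a period. -/
theorem IsEquivariant.injective (h : RationalParams a b (b - 1)) {w : Equiv.Perm (Fin a)}
    {e : ℤ} (he : 0 < e) (hen : e < (b - 1 : ℕ)) {F F' : Fin a → Option (Fin (b - 1))}
    (hF : IsEquivariant w e F) (hF' : IsEquivariant w e F')
    (heq : ncOfLabelling h F = ncOfLabelling h F') : F = F' := by
  have hP : treePart h F = treePart h F' := congrArg NCParkingFunction.part heq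
  have hrel : ∀ i, partRel (treePart h F) (home b F i) (home b F' i) := by
    intro i
    have h1 := partRel_spot_ncOfLabelling h F i
    have h2 := partRel_spot_ncOfLabelling h F' i
    rw [← hP, ← heq] at h2
    exact h1.symm.trans h2
  -- a positioned label of one labelling cannot be central for another one
  have key : ∀ {F F' : Fin a → Option (Fin (b - 1))}, IsEquivariant w e F →
      IsEquivariant w e F' → treePart h F = treePart h F' → ∀ i p,
      partRel (treePart h F) (home b F i) (home b F' i) → F i = some p → F' i ≠ none := by
    intro F F' hF hF' hP i p hrel hi hi'
    have hr := isRoot_home h hi'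
    have h1 : partRel (treePart h F) (home b F' i) (home b F' i + e) := by
      rw [hP, partRel_treePart]
      exact PeriodicWalk.treeRel_of_same (hr.same (hF'.isRoot_add h he hen hr))
    have h2 : partRel (treePart h F) (home b F i + e) (home b F' i + e) := by
      rw [partRel_treePart, hF.treeRel_add h he hen, ← partRel_treePart h]
      exact hrel
    obtain ⟨k, h3, h4, -⟩ := hF.exists_cluster h he hen hi (hrel.trans (h1.trans h2.symm))
    rcases le_or_gt 0 k with hk | hk
    · have : 0 ≤ k * ((b - 1 : ℕ) : ℤ) := mul_nonneg hk (by positivity)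
      omega
    · have : k * ((b - 1 : ℕ) : ℤ) ≤ -1 * ((b - 1 : ℕ) : ℤ) :=
        mul_le_mul_of_nonneg_right (by omega) (by positivity)
      omega
  funext i
  cases hi : F i with
  | none =>
    cases hi' : F' i with
    | none => rfl
    | some p' => exact absurd hi (key hF' hF hP.symm i p' (hP ▸ (hrel i).symm) hi')
  | some p =>
    cases hi' : F' i with
    | none => exact absurd hi' (key hF hF' hP i p (hrel i) hi)
    | some p' =>
      obtain ⟨k, h1, h2, h3⟩ := hF.exists_cluster h he hen hi (hrel i)
      obtain ⟨l, h4, h5, h6⟩ := hF'.exists_cluster h he hen hi' (hP ▸ (hrel i).symm)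
      have h7 : k + l = 0 := by
        rcases lt_trichotomy (k + l) 0 with hk | hk | hk
        · nlinarith
        · exact hk
        · nlinarith
      have h8 : k * ((b - 1 : ℕ) : ℤ) + l * ((b - 1 : ℕ) : ℤ) = 0 := by rw [← add_mul, h7, zero_mul]
      rw [← lab_home (b := b) hi, ← lab_home (b := b) hi', lab_eq_iff.2
        ⟨k, show home b F i = home b F' i + k * (b - 1 : ℕ) by omega⟩]

end FixedPoints

/-! ### The centre of a partition that is invariant under rotation -/

section Center

variable {n : ℕ} {R : ℤ → ℤ → Prop}

theorem exists_next {Q : ℤ → Prop} {z x : ℤ} (hzx : z < x) (hx : Q x) :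
    ∃ y, z < y ∧ y ≤ x ∧ Q y ∧ ∀ w, z < w → w < y → ¬ Q w := by
  obtain ⟨y, h1, h2, h3, h4⟩ := exists_last (Q := fun w => Q (-w)) (z := -x) (x := -z)
    (by omega) (by simpa using hx)
  exact ⟨-y, by omega, by omega, h3, fun w hw1 hw2 hw3 =>
    h4 (-w) (by omega) (by omega) (by simpa using hw3)⟩

/-- `f` starts a cluster of the class of `y` that contains `y` and is shorter than half a
period. -/
structure IsShortStart (n : ℕ) (R : ℤ → ℤ → Prop) (e f y : ℤ) : Prop where
  le : f ≤ y
  lt : y < f + n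
  rel : R f y
  short : ∀ t, R y t → f ≤ t → t < f + n → t < f + e ∧ t < f + (n - e)

theorem IsShortStart.unique (N : IsNoncrossing n R) {e f f' y : ℤ} (h : IsShortStart n R e f y)
    (h' : IsShortStart n R e f' y) : f = f' := by
  have key : ∀ {f f' : ℤ}, IsShortStart n R e f y → IsShortStart n R e f' y → ¬ f < f' := by
    intro f f' h h' hlt
    have h1 := h.short f' (N.equiv.symm h'.rel) hlt.le (by have := h.lt; have := h'.le; omega)
    have h2 := h'.short (f + n) (N.equiv.trans (N.equiv.symm h.rel) (N.per f))
      (by have := h.lt; have := h'.le; omega) (by omega)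
    omega
  exact le_antisymm (not_lt.1 (key h' h)) (not_lt.1 (key h h'))

theorem IsShortStart.of_rel (N : IsNoncrossing n R) {e f y z : ℤ} (h : IsShortStart n R e f y)
    (hz : R y z) (h1 : f ≤ z) (h2 : z < f + n) : IsShortStart n R e f z :=
  ⟨h1, h2, N.equiv.trans h.rel hz, fun t ht => h.short t (N.equiv.trans hz ht)⟩

theorem IsShortStart.add {e f y d : ℤ}
    (hinv : ∀ y z, R (y + d) (z + d) ↔ R y z) (h : IsShortStart n R e f y) :
    IsShortStart n R e (f + d) (y + d) :=
  ⟨by have := h.le; omega, by have := h.lt; omega, (hinv _ _).2 h.rel, fun t ht h1 h2 => by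
    rw [← sub_add_cancel t d, hinv] at ht
    have := h.short (t - d) ht (by omega) (by omega)
    omega⟩

theorem IsNoncrossing.rel_add_mul (N : IsNoncrossing n R) (k y z : ℤ) :
    R (y + k * n) (z + k * n) ↔ R y z :=
  ⟨fun hR => N.equiv.trans (N.rel_add k y) (N.equiv.trans hR (N.equiv.symm (N.rel_add k z))),
    fun hR => N.equiv.trans (N.equiv.symm (N.rel_add k y)) (N.equiv.trans hR (N.rel_add k z))⟩

/-- If a class is not mapped to itself by the rotation by `e`, then its image lies in a single gap
of the class, which is therefore longer than half a period. -/
theorem exists_isShortStart (N : IsNoncrossing n R) {e : ℤ} (he : 0 < e) (hen : e < n)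
    (hinv : ∀ y z, R (y + e) (z + e) ↔ R y z) {y : ℤ} (hy : ¬ R y (y + e)) :
    ∃ f, IsShortStart n R e f y := by
  obtain ⟨u, hu1, hu2, hu3, hu4⟩ := exists_last (Q := R y) (z := y) (x := y + e) (by omega)
    (N.equiv.refl y)
  obtain ⟨v, hv1, hv2, hv3, hv4⟩ := exists_next (Q := R y) (z := y + e) (x := y + n) (by omega)
    (N.per y)
  have hgap : ∀ z, u < z → z < v → ¬ R u z := by
    intro z h1 h2 h3
    have h4 := N.equiv.trans hu3 h3
    rcases lt_trichotomy z (y + e) with h5 | rfl | h5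
    · exact hu4 z h1 h5 h4
    · exact hy h4
    · exact hv4 z h5 h2 h4
  have huv := N.equiv.trans (N.equiv.symm hu3) hv3
  have hn : 0 < n := by omega
  have hlong : u + e < v ∧ u + (n - e) < v := by
    constructor
    · obtain ⟨k, h1, h2⟩ := N.exists_translate_mem_gap hn huv hgap hu2 hv1
        ((hinv y u).2 hu3)
      rcases le_or_gt 0 k with hk | hk
      · have : 0 ≤ k * (n : ℤ) := mul_nonneg hk (by positivity)
        omega
      · have : k * (n : ℤ) ≤ -1 * n := mul_le_mul_of_nonneg_right (by omega) (by positivity)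
        omega
    · obtain ⟨k, h1, h2⟩ := N.exists_translate_mem_gap hn huv hgap hu2 hv1
        ((hinv y v).2 hv3)
      rcases le_or_gt 0 k with hk | hk
      · have : 0 ≤ k * (n : ℤ) := mul_nonneg hk (by positivity)
        omega
      · have : k * (n : ℤ) ≤ -1 * n := mul_le_mul_of_nonneg_right (by omega) (by positivity)
        omega
  refine ⟨v - n, by omega, by omega, ?_, fun t ht h1 h2 => ?_⟩
  · have := N.per (v - n)
    rw [sub_add_cancel] at this
    exact N.equiv.trans this (N.equiv.symm hv3)
  · have : t ≤ u := by
      by_contra! hlt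
      exact hgap t hlt (by omega) (N.equiv.trans (N.equiv.symm hu3) ht)
    omega

open Classical in
/-- The first element of the short cluster of `y`, if there is one. -/
noncomputable def shortStart (n : ℕ) (R : ℤ → ℤ → Prop) (e y : ℤ) : ℤ :=
  if hf : ∃ f, IsShortStart n R e f y then hf.choose else y

theorem isShortStart_shortStart (N : IsNoncrossing n R) {e : ℤ} (he : 0 < e) (hen : e < n)
    (hinv : ∀ y z, R (y + e) (z + e) ↔ R y z) {y : ℤ} (hy : ¬ R y (y + e)) :
    IsShortStart n R e (shortStart n R e y) y := by
  have hf := exists_isShortStart N he hen hinv hy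
  rw [shortStart, dif_pos hf]
  exact hf.choose_spec

/-- Two classes that the rotation by `e` maps to themselves coincide. -/
theorem rel_of_invariant (N : IsNoncrossing n R) {e : ℤ} (he : 0 < e) (hen : e < n)
    (hinv : ∀ y z, R (y + e) (z + e) ↔ R y z) {y z : ℤ} (hy : R y (y + e)) (hz : R z (z + e)) :
    R y z := by
  by_contra hne
  have hn : 0 < n := by omega
  have hn' : (0 : ℤ) < n := by exact_mod_cast hn
  -- a translate of `y` to the left of `z`
  obtain ⟨y', hy1, hy2⟩ : ∃ y', R y y' ∧ y' < z := by
    refine ⟨y + (-(|y - z| + 1)) * n, N.rel_add _ _, ?_⟩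
    have h1 : (|y - z| + 1) * 1 ≤ (|y - z| + 1) * n :=
      mul_le_mul_of_nonneg_left (by omega) (by positivity)
    have h2 := le_abs_self (y - z)
    linarith
  obtain ⟨u, -, hu2, hu3, hu4⟩ := exists_last (Q := R y) hy2 hy1
  have hzn : z < u + n := by
    by_contra! hle
    rcases hle.lt_or_eq with hlt | heq
    · exact hu4 (u + n) (by omega) hlt (N.equiv.trans hu3 (N.per u))
    · exact hne (heq ▸ N.equiv.trans hu3 (N.per u))
  obtain ⟨v, hv1, hv2, hv3, hv4⟩ := exists_next (Q := R y) (z := z) (x := u + n) hzn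
    (N.equiv.trans hu3 (N.per u))
  have hgap : ∀ t, u < t → t < v → ¬ R u t := by
    intro t h1 h2 h3
    have h4 := N.equiv.trans hu3 h3
    rcases lt_trichotomy t z with h5 | rfl | h5
    · exact hu4 t h1 h5 h4
    · exact hne h4
    · exact hv4 t h5 h2 h4
  have hinvR : ∀ t, R y t → R y (t + e) := fun t ht =>
    N.equiv.trans hy ((hinv _ _).2 ht)
  have hue : v ≤ u + e := by
    by_contra! hlt
    exact hgap (u + e) (by omega) hlt (N.equiv.trans (N.equiv.symm hu3) (hinvR u hu3))
  obtain ⟨k, h1, h2⟩ := N.exists_translate_mem_gap hn (N.equiv.trans (N.equiv.symm hu3) hv3)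
    hgap hu2 hv1 hz
  have hk : k < 0 := by
    by_contra! hk
    have : 0 ≤ k * (n : ℤ) := mul_nonneg hk (by positivity)
    omega
  have hk1 : k * (n : ℤ) ≤ -1 * n := mul_le_mul_of_nonneg_right (by omega) (by positivity)
  have h3 : R u (v + e + (-1) * n) := N.equiv.trans (N.equiv.symm hu3)
    (N.equiv.trans (hinvR v hv3) (N.rel_add (-1) _))
  exact hgap _ (by omega) (by omega) h3

/-- An invariant partition has a centre. -/
theorem isCenter_shortStart (N : IsNoncrossing n R) {e : ℤ} (he : 0 < e) (hen : e < n)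
    (hinv : ∀ y z, R (y + e) (z + e) ↔ R y z) :
    IsCenter n R (fun y => R y (y + e)) (shortStart n R e) := by
  have hS : ∀ {y}, ¬ R y (y + e) → IsShortStart n R e (shortStart n R e y) y :=
    isShortStart_shortStart N he hen hinv
  have hn : 0 < n := by omega
  have hcen : ∀ x y, R x y → R x (x + e) → R y (y + e) := fun x y hxy hx =>
    N.equiv.trans (N.equiv.symm hxy) (N.equiv.trans hx ((hinv _ _).2 hxy))
  refine ⟨fun x y => rel_of_invariant N he hen hinv, hcen, fun x hx => (hS hx).le,
    fun x hx => (hS hx).lt, fun x hx => (hS hx).rel, fun x z hx h1 h2 => ?_,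
    fun x y hx hxy => ?_, fun x hx k => ?_⟩
  · have hx' := hS hx
    have hxn := hx'.lt
    have hshort := hx'.short x (N.equiv.refl x) hx'.le hx'.lt
    by_cases hxz : R x z
    · have hz : ¬ R z (z + e) := fun hz => hx (hcen z x (N.equiv.symm hxz) hz)
      exact ⟨hz, ((hx'.of_rel N hxz h1 (by omega)).unique N (hS hz)).le⟩
    · have hzx : z ≠ x := by rintro rfl; exact hxz (N.equiv.refl z)
      have hfz : shortStart n R e x ≠ z := fun he' => hxz (he' ▸ N.equiv.symm hx'.rel)
      obtain ⟨u, hu1, hu2, hu3, hu4⟩ := exists_last (Q := R x) (z := shortStart n R e x) (x := z)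
        (by omega) (N.equiv.symm hx'.rel)
      obtain ⟨v, hv1, hv2, hv3, hv4⟩ := exists_next (Q := R x) (z := z) (x := x) (by omega)
        (N.equiv.refl x)
      have hgap : ∀ t, u < t → t < v → ¬ R u t := by
        intro t h3 h4 h5
        have h6 := N.equiv.trans hu3 h5
        rcases lt_trichotomy t z with h7 | rfl | h7
        · exact hu4 t h3 h7 h6
        · exact hxz h6
        · exact hv4 t h7 h4 h6
      have huv := N.equiv.trans (N.equiv.symm hu3) hv3
      have hz : ¬ R z (z + e) := by
        intro hz
        obtain ⟨k, h3, h4⟩ := N.exists_translate_mem_gap hn huv hgap hu2 hv1 hz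
        rcases le_or_gt 0 k with hk | hk
        · have : 0 ≤ k * (n : ℤ) := mul_nonneg hk (by positivity)
          omega
        · have : k * (n : ℤ) ≤ -1 * n := mul_le_mul_of_nonneg_right (by omega) (by positivity)
          omega
      refine ⟨hz, ?_⟩
      have hz' := hS hz
      have hzs := hz'.short z (N.equiv.refl z) hz'.le hz'.lt
      by_contra! hlt
      obtain ⟨k, h3, h4⟩ := N.exists_translate_mem_gap hn huv hgap hu2 hv1
        (N.equiv.symm hz'.rel)
      rcases le_or_gt k 0 with hk | hk
      · have : k * (n : ℤ) ≤ 0 * n := mul_le_mul_of_nonneg_right hk (by positivity)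
        omega
      · have : 1 * (n : ℤ) ≤ k * n := mul_le_mul_of_nonneg_right (by omega) (by positivity)
        omega
  · have hx' := hS hx
    have hy : ¬ R y (y + e) := fun hy => hx (hcen y x (N.equiv.symm hxy) hy)
    set f := shortStart n R e x
    have h1 := Int.emod_add_mul_ediv (y - f) n
    have h2 := Int.emod_nonneg (y - f) (b := n) (by omega)
    have h3 := Int.emod_lt_of_pos (y - f) (b := n) (by omega)
    set k := (y - f) / n
    have h4 : R x (y + -k * n) := N.equiv.trans hxy (N.rel_add _ _)
    have h5 : y + -k * n = f + (y - f) % n := by linarith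
    have h6 := hx'.of_rel N h4 (by omega) (by omega)
    have h7 := h6.add (N.rel_add_mul k)
    rw [show y + -k * n + k * n = y by ring] at h7
    exact ⟨k, (hS hy).unique N h7⟩
  · have h1 := (hS hx).add (N.rel_add_mul k)
    have hy : ¬ R (x + k * n) (x + k * n + e) := fun hy =>
      hx (hcen _ _ (N.equiv.symm (N.rel_add k x)) hy)
    exact (hS hy).unique N h1

end Center

section FixedPoints

variable {a b : ℕ} [NeZero (b - 1)]

/-- Every fixed point comes from an equivariant labelling: the labels of the invariant block have no
position, and the other labels sit at the beginning of the short clusters. -/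
theorem exists_isEquivariant (h : RationalParams a b (b - 1)) {w : Equiv.Perm (Fin a)}
    {g : Multiplicative (ZMod (b - 1))} {e : ℤ} (hg : rotHom (b - 1) g = rotPerm (b - 1) e)
    (he : 0 < e) (hen : e < (b - 1 : ℕ)) {x : NCParkingFunction a b}
    (hx : actFun h (w, g) x = x) :
    ∃ F : Fin a → Option (Fin (b - 1)), IsEquivariant w e F ∧ ncOfLabelling h F = x := by
  classical
  obtain ⟨hinv, hspot⟩ := (actFun_eq_self_iff h w hg x).1 hx
  have N := (x.isRationalNC h).toIsNoncrossing
  have C := isCenter_shortStart N he hen hinv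
  set R := partRel x.part
  set s := shortStart (b - 1) R e
  set F : Fin a → Option (Fin (b - 1)) := fun i =>
    if R (x.spot i) (x.spot i + e) then none else some (lab (b - 1) (s (x.spot i)))
  refine ⟨F, fun i => ?_, ncOfLabelling_eq_of_isCenter h x C (fun i hi => if_pos hi)
    fun i hi => if_neg hi⟩
  by_cases hi : R (x.spot i) (x.spot i + e)
  · have h1 : F i = none := if_pos hi
    have h2 : F (w i) = none := if_pos (C.central_of_rel _ _
      (N.equiv.trans hi (N.equiv.symm (hspot i))) hi)
    rw [h1, h2, Option.map_none]
  · have hie : ¬ R (x.spot i + e) (x.spot i + e + e) := by rwa [hinv]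
    have hwi := C.not_central_of_rel N hie (N.equiv.symm (hspot i))
    have h1 : F i = some (lab (b - 1) (s (x.spot i))) := if_neg hi
    have h2 : F (w i) = some (lab (b - 1) (s (x.spot (w i)))) := if_neg hwi
    rw [h1, h2, Option.map_some, rotPerm_lab]
    have h3 := (isShortStart_shortStart N he hen hinv hi).add hinv
    have h4 := (isShortStart_shortStart N he hen hinv hie).unique N h3
    obtain ⟨k, hk⟩ := C.start_of_rel _ _ hie (N.equiv.symm (hspot i))
    rw [hk, lab_add_mul]
    exact congrArg (fun t => some (lab (b - 1) t)) h4

/-- The fixed points of a nontrivial rotation are counted by the equivariant labellings. -/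
theorem card_fixed_of_rotation (h : RationalParams a b (b - 1)) (w : Equiv.Perm (Fin a))
    {g : Multiplicative (ZMod (b - 1))} {e : ℤ} (hg : rotHom (b - 1) g = rotPerm (b - 1) e)
    (he : 0 < e) (hen : e < (b - 1 : ℕ)) :
    Nat.card {x : NCParkingFunction a b // actFun h (w, g) x = x} =
      Nat.card {F : Fin a → Option (Fin (b - 1)) // IsEquivariant w e F} := by
  refine (Nat.card_congr (Equiv.ofBijective
    (fun F => ⟨ncOfLabelling h F.1, F.2.actFun_eq h hg he hen⟩) ⟨fun F F' hFF => ?_, ?_⟩)).symm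
  · exact Subtype.ext (F.2.injective h he hen F'.2 (congrArg Subtype.val hFF))
  · rintro ⟨x, hx⟩
    obtain ⟨F, hF, rfl⟩ := exists_isEquivariant h hg he hen hx
    exact ⟨⟨F, hF⟩, rfl⟩

end FixedPoints

/-! ### Fixed points of the trivial rotation -/

section DyckLabellings

variable {a b n : ℕ} [NeZero n]

/-- A label of a parking function sits at the first element of its block. -/
theorem IsDyck.windowStart_eq (h : RationalParams a b n) {F : Fin a → Option (Fin n)}
    (hF : IsDyck b F) {i : Fin a} {p : Fin n} (hi : F i = some p) :
    windowStart (treePart h F) (p : ℕ) = (p : ℕ) := by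
  have W := labelWalk_isWalk b F
  have hpn := p.2
  have hc : 0 < labelCount F (p : ℕ) :=
    Finset.card_pos.2 ⟨i, Finset.mem_filter.2 ⟨Finset.mem_univ _, by rw [lab_coe, hi]⟩⟩
  have hpar := W.isParent_pred h hc
  have C := isCenter_windowStart (isRationalNC_home h F).toIsNoncrossing
  have hle := C.start_le (p : ℕ) id
  have h0 : 0 ≤ windowStart (treePart h F) (p : ℕ) := by
    rw [windowStart, Int.emod_eq_of_lt (by omega) (by omega)]
    omega
  have hrel := partRel_treePart h F |>.1 (C.rel_start (p : ℕ) id)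
  set s := windowStart (treePart h F) (p : ℕ)
  by_contra hne
  obtain ⟨k, hk⟩ := hrel
  have hs := W.isParent_of_same h hk.symm (W.isParent_add h k hpar)
  have h1 := hs.1
  have h2 := W.le_add_of_isParent h (e := n) (by omega) (by have := h.eq; omega) W.periodic hs
  -- the parent of `s` is a negative position, so the walk is larger at `-1` than at `s`
  rcases lt_trichotomy k (-1) with hlt | rfl | hlt
  · have : k * (n : ℤ) ≤ -2 * n := mul_le_mul_of_nonneg_right (by omega) (by positivity)
    omega
  · have h3 := hs.2.2 (-1) (by omega) (by omega)
    have h4 := hF.2 s h0 (by omega)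
    rw [labelWalk_neg_one] at h3
    omega
  · have : 0 ≤ k * (n : ℤ) := mul_nonneg (by omega) (by positivity)
    omega

end DyckLabellings

section TrivialRotation

variable {a b : ℕ} [NeZero (b - 1)]

/-- A rational parking function is determined by its noncrossing parking function. -/
theorem IsDyck.injective (h : RationalParams a b (b - 1)) {F F' : Fin a → Option (Fin (b - 1))}
    (hF : IsDyck b F) (hF' : IsDyck b F') (heq : ncOfLabelling h F = ncOfLabelling h F') :
    F = F' := by
  have hP : treePart h F = treePart h F' := congrArg NCParkingFunction.part heq
  have N := (isRationalNC_home h F).toIsNoncrossing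
  funext i
  obtain ⟨p, hp⟩ := Option.ne_none_iff_exists'.1 (hF.1 i)
  obtain ⟨q, hq⟩ := Option.ne_none_iff_exists'.1 (hF'.1 i)
  have h1 := partRel_spot_ncOfLabelling h F i
  have h2 := partRel_spot_ncOfLabelling h F' i
  rw [← hP, ← heq] at h2
  have h3 : partRel (treePart h F) (p : ℕ) (q : ℕ) := by
    have := h1.symm.trans h2
    have e1 : home b F i = (p : ℕ) := by simp only [home, hp]
    have e2 : home b F' i = (q : ℕ) := by simp only [home, hq]
    rwa [e1, e2] at this
  obtain ⟨k, hk⟩ := (isCenter_windowStart N).start_of_rel _ _ id h3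
  rw [hF.windowStart_eq h hp, hP, hF'.windowStart_eq h hq] at hk
  have h4 := lab_eq_iff.2 ⟨k, hk⟩
  rw [lab_coe, lab_coe] at h4
  rw [hp, hq, h4]

/-- Without rotation, the fixed points of `w` are the rational parking functions that are constant
on the cycles of `w`. -/
theorem card_fixed_of_no_rotation (h : RationalParams a b (b - 1)) (w : Equiv.Perm (Fin a))
    {g : Multiplicative (ZMod (b - 1))} (hg : rotHom (b - 1) g = rotPerm (b - 1) 0) :
    Nat.card {x : NCParkingFunction a b // actFun h (w, g) x = x} =
      Nat.card {F : Fin a → Option (Fin (b - 1)) // IsDyck b F ∧ ∀ i, F (w i) = F i} := by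
  have hfix : ∀ F : {F : Fin a → Option (Fin (b - 1)) // IsDyck b F ∧ ∀ i, F (w i) = F i},
      actFun h (w, g) (ncOfLabelling h F.1) = ncOfLabelling h F.1 := by
    refine fun F => (actFun_eq_self_iff h w hg _).2
      ⟨fun y z => by rw [add_zero, add_zero], fun i => ?_⟩
    rw [add_zero]
    have h1 : home b F.1 (w i) = home b F.1 i := by simp only [home, F.2.2 i]
    have h2 := partRel_spot_ncOfLabelling h F.1 (w i)
    rw [h1] at h2
    exact h2.trans (partRel_spot_ncOfLabelling h F.1 i).symm
  refine (Nat.card_congr (Equiv.ofBijective (fun F => ⟨ncOfLabelling h F.1, hfix F⟩)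
    ⟨fun F F' hFF => ?_, ?_⟩)).symm
  · exact Subtype.ext (F.2.1.injective h F'.2.1 (congrArg Subtype.val hFF))
  · rintro ⟨x, hx⟩
    have G := x.isRationalNC h
    have C := isCenter_windowStart G.toIsNoncrossing
    have hspot := ((actFun_eq_self_iff h w hg x).1 hx).2
    refine ⟨⟨minLabelling x.part x.spot, isDyck_minLabelling h G, fun i => ?_⟩,
      Subtype.ext (ncOfLabelling_eq_of_isCenter h x C (fun _ hc => hc.elim) fun _ _ => rfl)⟩
    have h1 := hspot i
    rw [add_zero] at h1
    obtain ⟨k, hk⟩ := C.start_of_rel _ _ id h1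
    rw [minLabelling, minLabelling, hk, lab_add_mul]

end TrivialRotation

/-! ### The cycle lemma -/

section CycleLemma

variable {a b : ℕ} [NeZero b]

/-- The walk of a labelling by residues modulo `b`. -/
noncomputable def cyclicWalk (G : Fin a → Fin b) : ℤ → ℤ := labelWalk b fun i => some (G i)

/-- Up to translation by `b`, the walk has its only minimum at `m`. -/
def IsStrictMin (G : Fin a → Fin b) (m : ℤ) : Prop :=
  ∀ x, ¬ (b : ℤ) ∣ x - m → cyclicWalk G m < cyclicWalk G x

theorem cyclicWalk_isWalk (G : Fin a → Fin b) :
    PeriodicWalk a b b (labelCount fun i => some (G i)) (cyclicWalk G) := labelWalk_isWalk b _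

theorem sum_Ioc_labelCount (G : Fin a → Fin b) (x : ℤ) :
    ∑ z ∈ Finset.Ioc x (x + b), labelCount (fun i => some (G i)) z = a := by
  have hb : (0 : ℤ) < b := by exact_mod_cast Nat.pos_of_ne_zero (NeZero.ne b)
  rw [sum_labelCount _ (by intro y hy z hz; rw [Finset.mem_Ioc] at hy hz; omega),
    Finset.filter_true_of_mem, Finset.card_univ, Fintype.card_fin]
  intro i _
  have h1 := Int.emod_nonneg ((G i : ℕ) - (x + 1)) hb.ne'
  have h2 := Int.emod_lt_of_pos ((G i : ℕ) - (x + 1)) hb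
  have h3 := Int.emod_add_mul_ediv ((G i : ℕ) - (x + 1)) b
  refine ⟨x + 1 + ((G i : ℕ) - (x + 1)) % b, Finset.mem_Ioc.2 ⟨by omega, by omega⟩, ?_⟩
  rw [← lab_coe (G i), Option.some_inj, lab_eq_iff]
  refine ⟨((lab b (G i : ℕ) : ℕ) - (x + 1) : ℤ) / b, ?_⟩
  rw [lab_coe]
  linarith

theorem cyclicWalk_add_mul (G : Fin a → Fin b) (x k : ℤ) :
    cyclicWalk G (x + k * b) = cyclicWalk G x := by
  have h1 : ∀ x, cyclicWalk G (x + b) = cyclicWalk G x + 0 := by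
    intro x
    have h2 := (cyclicWalk_isWalk G).sub_eq (y := x) (x := x + b) (by omega)
    rw [sum_Ioc_labelCount] at h2
    linarith
  simpa using PeriodicWalk.shift_mul h1 k x

theorem cyclicWalk_rotate (G : Fin a → Fin b) (t : ℤ) :
    ∃ δ, ∀ x, cyclicWalk (fun i => rotPerm b t (G i)) (x + t) = cyclicWalk G x + δ := by
  have hc : ∀ x, labelCount (fun i => some (rotPerm b t (G i))) (x + t) =
      labelCount (fun i => some (G i)) x := by
    intro x
    rw [labelCount, labelCount]
    congr 1
    ext i
    simp only [Finset.mem_filter, Finset.mem_univ, true_and, Option.some_inj]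
    rw [← rotPerm_lab, (rotPerm b t).injective.eq_iff]
  have hstep : ∀ x, cyclicWalk (fun i => rotPerm b t (G i)) (x + 1 + t) - cyclicWalk G (x + 1) =
      cyclicWalk (fun i => rotPerm b t (G i)) (x + t) - cyclicWalk G x := by
    intro x
    rw [(cyclicWalk_isWalk _).step (x + 1 + t), (cyclicWalk_isWalk _).step (x + 1), hc,
      show x + 1 + t - 1 = x + t by ring, show x + 1 - 1 = x by ring]
    ring
  refine ⟨cyclicWalk (fun i => rotPerm b t (G i)) (0 + t) - cyclicWalk G 0, fun x => ?_⟩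
  suffices cyclicWalk (fun i => rotPerm b t (G i)) (x + t) - cyclicWalk G x =
    cyclicWalk (fun i => rotPerm b t (G i)) (0 + t) - cyclicWalk G 0 by linarith
  induction x using Int.induction_on with
  | zero => rfl
  | succ i ih => rw [hstep, ih]
  | pred i ih =>
    rw [← ih, ← hstep (-i - 1), show -(i : ℤ) - 1 + 1 = -i by ring]

theorem isStrictMin_rotate {G : Fin a → Fin b} {t m : ℤ} :
    IsStrictMin (fun i => rotPerm b t (G i)) (m + t) ↔ IsStrictMin G m := by
  obtain ⟨δ, hδ⟩ := cyclicWalk_rotate G t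
  constructor
  · intro hm x hx
    have := hm (x + t) (by rwa [add_sub_add_right_eq_sub])
    rw [hδ, hδ] at this
    omega
  · intro hm x hx
    have := hm (x - t) (by rwa [sub_right_comm, sub_sub])
    rw [← sub_add_cancel x t, hδ, hδ]
    omega

theorem IsStrictMin.dvd_sub {G : Fin a → Fin b} {m m' : ℤ} (h : IsStrictMin G m)
    (h' : IsStrictMin G m') : (b : ℤ) ∣ m' - m := by
  by_contra hd
  exact lt_asymm (h m' hd) (h' m (by rwa [← neg_sub, dvd_neg]))

/-- The values of the walk over one period are distinct modulo `b`, as `a` and `b` are coprime. -/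
theorem exists_isStrictMin (hcop : Nat.Coprime a b) (G : Fin a → Fin b) :
    ∃ m, IsStrictMin G m := by
  have hb : (0 : ℤ) < b := by exact_mod_cast Nat.pos_of_ne_zero (NeZero.ne b)
  obtain ⟨m, -, hmin⟩ := Finset.exists_min_image (Finset.Ico (0 : ℤ) b) (cyclicWalk G)
    ⟨0, Finset.mem_Ico.2 ⟨le_rfl, hb⟩⟩
  have hmin' : ∀ x, cyclicWalk G m ≤ cyclicWalk G x := by
    intro x
    have h1 := Int.emod_add_mul_ediv x b
    have h2 := hmin (x % b) (Finset.mem_Ico.2 ⟨Int.emod_nonneg x hb.ne',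
      Int.emod_lt_of_pos x hb⟩)
    rwa [← cyclicWalk_add_mul G (x % b) (x / b), mul_comm, h1] at h2
  have hc : IsCoprime (b : ℤ) (a : ℤ) := (Nat.isCoprime_iff_coprime.2 hcop).symm
  have key : ∀ y x, y ≤ x → cyclicWalk G y = cyclicWalk G x → (b : ℤ) ∣ x - y := by
    intro y x hyx he
    have := (cyclicWalk_isWalk G).sub_eq hyx
    exact hc.dvd_of_dvd_mul_left ⟨_, sub_eq_zero.1 (by
      rw [← neg_eq_zero, neg_sub, ← this, he, sub_self])⟩
  refine ⟨m, fun x hx => lt_of_le_of_ne (hmin' x) fun he => hx ?_⟩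
  rcases le_total m x with hle | hle
  · exact key m x hle he
  · rw [← neg_sub, dvd_neg]
    exact key x m hle he.symm

/-- Every labelling by residues is, in exactly one way, a translate of one with its minimum
at `-1`. -/
theorem card_eq_mul_card_isStrictMin (hcop : Nat.Coprime a b) (w : Equiv.Perm (Fin a)) :
    Nat.card {G : Fin a → Fin b // ∀ i, G (w i) = G i} =
      Nat.card {G : Fin a → Fin b // IsStrictMin G (-1) ∧ ∀ i, G (w i) = G i} * b := by
  have hb : (0 : ℤ) < b := by exact_mod_cast Nat.pos_of_ne_zero (NeZero.ne b)
  have hcard : Nat.card ({G : Fin a → Fin b // IsStrictMin G (-1) ∧ ∀ i, G (w i) = G i} × Fin b) =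
      Nat.card {G : Fin a → Fin b // IsStrictMin G (-1) ∧ ∀ i, G (w i) = G i} * b := by
    rw [Nat.card_prod, Nat.card_fin]
  rw [← hcard]
  refine (Nat.card_congr (Equiv.ofBijective (fun p => ⟨fun i => rotPerm b (p.2 : ℕ) (p.1.1 i),
    fun i => congrArg _ (p.1.2.2 i)⟩) ⟨?_, ?_⟩)).symm
  · rintro ⟨⟨G, hG, hGw⟩, t⟩ ⟨⟨G', hG', hGw'⟩, t'⟩ heq
    have heq' : (fun i => rotPerm b (t : ℕ) (G i)) = fun i => rotPerm b (t' : ℕ) (G' i) :=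
      congrArg Subtype.val heq
    have h1 := (isStrictMin_rotate (t := (t : ℕ))).2 hG
    have h2 := (isStrictMin_rotate (t := (t' : ℕ))).2 hG'
    rw [← heq'] at h2
    obtain ⟨k, hk⟩ := h1.dvd_sub h2
    have h3 : lab b (t' : ℕ) = lab b (t : ℕ) := lab_eq_iff.2 ⟨k, by linarith⟩
    rw [lab_coe, lab_coe] at h3
    subst h3
    have h4 : G = G' := funext fun i => (rotPerm b _).injective (congrFun heq' i)
    subst h4
    rfl
  · rintro ⟨G, hGw⟩
    obtain ⟨m, hm⟩ := exists_isStrictMin hcop G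
    have h1 := Int.emod_nonneg (m + 1) hb.ne'
    have h2 := Int.emod_lt_of_pos (m + 1) hb
    have h3 := Int.emod_add_mul_ediv (m + 1) b
    set t := (m + 1) % b
    refine ⟨⟨⟨fun i => rotPerm b (-(m + 1)) (G i), ?_, fun i => congrArg _ (hGw i)⟩,
      lab b (m + 1)⟩, Subtype.ext (funext fun i => ?_)⟩
    · have := (isStrictMin_rotate (t := -(m + 1))).2 hm
      rwa [show m + -(m + 1) = -1 by ring] at this
    · change rotPerm b (lab b (m + 1) : ℕ) (rotPerm b (-(m + 1)) (G i)) = G i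
      rw [← Equiv.Perm.mul_apply, ← rotPerm_add, lab_val, rotPerm_congr (l := 0), rotPerm_zero]
      · rfl
      · simp

/-- Labellings with central labels as labellings by residues modulo `n + 1`. -/
def optionEquiv (n : ℕ) : Option (Fin n) ≃ Fin (n + 1) := finSuccEquivLast.symm

theorem optionEquiv_some {n : ℕ} (p : Fin n) : (optionEquiv n (some p) : ℕ) = p := by
  simp [optionEquiv]

theorem optionEquiv_none (n : ℕ) : (optionEquiv n none : ℕ) = n := by
  simp [optionEquiv]

/-- Rational parking functions are the labellings by residues whose walk has its minimum at `-1`. -/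
theorem isDyck_iff_isStrictMin {n : ℕ} [NeZero n] (h : RationalParams a (n + 1) n)
    (F : Fin a → Option (Fin n)) :
    IsDyck (n + 1) F ↔ IsStrictMin (fun i => optionEquiv n (F i)) (-1) := by
  set G : Fin a → Fin (n + 1) := fun i => optionEquiv n (F i) with hG
  have hval : ∀ x : ℤ, 0 ≤ x → x < n → optionEquiv n (some (lab n x)) = lab (n + 1) x := by
    intro x h0 hx
    have h1 := lab_val (n := n) x
    have h2 := lab_val (n := n + 1) x
    rw [Int.emod_eq_of_lt h0 (by omega)] at h1 h2
    apply Fin.ext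
    rw [optionEquiv_some]
    omega
  have hcount : ∀ x : ℤ, 0 ≤ x → x < n →
      labelCount F x = labelCount (fun i => some (G i)) x := by
    intro x h0 hx
    rw [labelCount, labelCount]
    congr 1
    ext i
    simp only [Finset.mem_filter, Finset.mem_univ, true_and, Option.some_inj, hG]
    rw [← hval x h0 hx, (optionEquiv n).injective.eq_iff]
  have hwalk : ∀ x : ℤ, 0 ≤ x → x < n → labelWalk (n + 1) F x = cyclicWalk G x := by
    intro x h0 hx
    rw [cyclicWalk, labelWalk_eq _ _ (by omega), labelWalk_eq _ _ (by omega)]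
    congr 3
    refine Finset.sum_congr rfl fun z hz => ?_
    rw [Finset.mem_Ioc] at hz
    exact hcount z (by omega) (by omega)
  have hzero : cyclicWalk G (-1) = 0 := labelWalk_neg_one _ _
  constructor
  · intro hF x hx
    have hn1 : (0 : ℤ) < n + 1 := by positivity
    have h1 := Int.emod_nonneg x hn1.ne'
    have h2 := Int.emod_lt_of_pos x hn1
    have h3 := Int.emod_add_mul_ediv x (n + 1)
    have h4 : x % ((n : ℤ) + 1) ≠ n := by
      intro he
      exact hx ⟨x / (n + 1) + 1, by push_cast; linarith⟩
    have h5 := hF.2 (x % ((n : ℤ) + 1)) h1 (by omega)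
    rw [hwalk _ h1 (by omega), ← cyclicWalk_add_mul G _ (x / (n + 1))] at h5
    rw [hzero]
    convert h5 using 2
    push_cast
    linarith
  · intro hG1
    have hpos : ∀ x : ℤ, 0 ≤ x → x < n → 0 < cyclicWalk G x := by
      intro x h0 hx
      rw [← hzero]
      refine hG1 x fun hd => ?_
      have := Int.le_of_dvd (by omega) hd
      push_cast at this
      omega
    refine ⟨fun i hi => ?_, fun x h0 hx => by rw [hwalk x h0 hx]; exact hpos x h0 hx⟩
    -- a label at the position `n` would make the walk negative at `n - 1`
    have h1 := (cyclicWalk_isWalk G).step n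
    have h2 : cyclicWalk G n = 0 := by
      have := cyclicWalk_add_mul G (-1) 1
      rw [hzero] at this
      rwa [show (-1 : ℤ) + 1 * ((n + 1 : ℕ) : ℤ) = n by push_cast; ring] at this
    have hn := h.n_pos
    have h3 := hpos (n - 1) (by omega) (by omega)
    have h4 : 0 < labelCount (fun i => some (G i)) n := by
      refine Finset.card_pos.2 ⟨i, Finset.mem_filter.2 ⟨Finset.mem_univ _, ?_⟩⟩
      have h5 := lab_val (n := n + 1) n
      rw [Int.emod_eq_of_lt (by omega) (by omega)] at h5
      rw [Option.some_inj, hG]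
      apply Fin.ext
      change ((optionEquiv n (F i) : Fin (n + 1)) : ℕ) = _
      rw [hi, optionEquiv_none]
      omega
    have h5 : ((n + 1 : ℕ) : ℤ) * 1 ≤
        ((n + 1 : ℕ) : ℤ) * labelCount (fun i => some (G i)) n :=
      mul_le_mul_of_nonneg_left (by exact_mod_cast h4) (by positivity)
    have h6 := h.lt
    omega

/-- The cycle lemma for the labellings that are constant on the cycles of `w`. -/
theorem card_isDyck_mul {n : ℕ} [NeZero n] (h : RationalParams a b n) (w : Equiv.Perm (Fin a)) :
    Nat.card {F : Fin a → Option (Fin n) // IsDyck b F ∧ ∀ i, F (w i) = F i} * b =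
      Nat.card {F : Fin a → Option (Fin n) // ∀ i, F (w i) = F i} := by
  obtain rfl := h.eq
  have h1 : ∀ F : Fin a → Option (Fin n), (∀ i, F (w i) = F i) ↔
      ∀ i, optionEquiv n (F (w i)) = optionEquiv n (F i) := fun F =>
    forall_congr' fun i => (optionEquiv n).injective.eq_iff.symm
  rw [Nat.card_congr ((Equiv.arrowCongr (Equiv.refl (Fin a)) (optionEquiv n)).subtypeEquiv
      (q := fun G => IsStrictMin G (-1) ∧ ∀ i, G (w i) = G i) fun F =>
      and_congr (isDyck_iff_isStrictMin h F) (h1 F)),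
    Nat.card_congr ((Equiv.arrowCongr (Equiv.refl (Fin a)) (optionEquiv n)).subtypeEquiv
      (q := fun G => ∀ i, G (w i) = G i) h1), card_eq_mul_card_isStrictMin h.coprime w]

end CycleLemma

/-! ### Equivariant functions and cycles -/

section Cycles

variable {α X : Type*} {w : Equiv.Perm α}

/-- The cycles of a permutation, fixed points included. -/
abbrev CycleSet (w : Equiv.Perm α) : Type _ := Quotient (Equiv.Perm.SameCycle.setoid w)

/-- The length of a cycle. -/
noncomputable def CycleSet.length (o : CycleSet w) : ℕ := MulAction.period w o.out

theorem zpow_apply_of_equivariant {τ : Equiv.Perm X} {F : α → X} (hF : ∀ i, F (w i) = τ (F i))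
    (k : ℤ) (i : α) : F ((w ^ k) i) = (τ ^ k) (F i) := by
  induction k using Int.induction_on generalizing i with
  | zero => rfl
  | succ k ih => rw [zpow_add_one, zpow_add_one, Equiv.Perm.mul_apply, ih, hF]; rfl
  | pred k ih =>
    have h1 : F (w⁻¹ i) = τ⁻¹ (F i) := by
      rw [Equiv.Perm.eq_inv_iff_eq, ← hF]
      exact congrArg F (w.apply_symm_apply i)
    rw [zpow_sub_one, zpow_sub_one, Equiv.Perm.mul_apply, ih, h1]
    rfl

theorem zpow_eq_of_dvd {τ : Equiv.Perm X} {c : X} {l : ℕ} (hc : (τ ^ l) c = c) {k : ℤ}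
    (hk : (l : ℤ) ∣ k) : (τ ^ k) c = c := by
  obtain ⟨m, rfl⟩ := hk
  rw [zpow_mul, zpow_natCast]
  exact Equiv.Perm.zpow_apply_eq_self_of_apply_eq_self hc m

theorem CycleSet.zpow_out_iff (o : CycleSet w) (k : ℤ) :
    (w ^ k) o.out = o.out ↔ (o.length : ℤ) ∣ k :=
  MulAction.zpow_smul_eq_iff_period_dvd (j := k) (g := w) (a := o.out)

/-- An equivariant function takes on a cycle of length `l` values that are fixed by `τ ^ l`. -/
theorem pow_length_of_equivariant {τ : Equiv.Perm X} {F : α → X} (hF : ∀ i, F (w i) = τ (F i))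
    (o : CycleSet w) : (τ ^ o.length) (F o.out) = F o.out := by
  rw [← zpow_natCast, ← zpow_apply_of_equivariant hF, (o.zpow_out_iff _).2 dvd_rfl]

theorem exists_zpow_out (w : Equiv.Perm α) (i : α) :
    ∃ k : ℤ, (w ^ k) (Quotient.mk (Equiv.Perm.SameCycle.setoid w) i).out = i :=
  Quotient.exact (Quotient.out_eq (Quotient.mk (Equiv.Perm.SameCycle.setoid w) i))

/-- An equivariant function is determined by its values at representatives of the cycles. -/
theorem eq_of_equivariant {τ : Equiv.Perm X} {F G : α → X} (hF : ∀ i, F (w i) = τ (F i))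
    (hG : ∀ i, G (w i) = τ (G i)) (hFG : ∀ o : CycleSet w, F o.out = G o.out) : F = G := by
  funext i
  obtain ⟨k, hk⟩ := exists_zpow_out w i
  rw [← hk, zpow_apply_of_equivariant hF, zpow_apply_of_equivariant hG, hFG]

/-- The values at representatives of the cycles are arbitrary, up to the condition of
`pow_length_of_equivariant`. -/
theorem exists_equivariant {τ : Equiv.Perm X} {c : CycleSet w → X}
    (hc : ∀ o, (τ ^ o.length) (c o) = c o) :
    ∃ F : α → X, (∀ i, F (w i) = τ (F i)) ∧ ∀ o : CycleSet w, F o.out = c o := by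
  choose k hk using exists_zpow_out w
  have key : ∀ (o : CycleSet w) (m l : ℤ), (w ^ m) o.out = (w ^ l) o.out →
      (τ ^ m) (c o) = (τ ^ l) (c o) := by
    intro o m l hml
    have h1 : (w ^ (-l + m)) o.out = o.out := by
      rw [zpow_add, Equiv.Perm.mul_apply, hml, ← Equiv.Perm.mul_apply, ← zpow_add, neg_add_cancel]
      rfl
    have h2 := zpow_eq_of_dvd (hc o) ((o.zpow_out_iff _).1 h1)
    rw [zpow_add, Equiv.Perm.mul_apply, zpow_neg, Equiv.Perm.inv_eq_iff_eq] at h2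
    exact h2
  refine ⟨fun i => (τ ^ k i) (c (Quotient.mk _ i)), fun i => ?_, fun o => ?_⟩
  · have h1 : Quotient.mk (Equiv.Perm.SameCycle.setoid w) (w i) = Quotient.mk _ i :=
      Quotient.sound ⟨-1, by simp⟩
    have h2 := hk (w i)
    change (τ ^ k (w i)) (c (Quotient.mk _ (w i))) = τ ((τ ^ k i) (c (Quotient.mk _ i)))
    rw [h1] at h2 ⊢
    rw [← Equiv.Perm.mul_apply, ← zpow_one_add]
    refine key _ _ _ ?_
    rw [h2, zpow_one_add, Equiv.Perm.mul_apply, hk]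
  · have h1 : Quotient.mk (Equiv.Perm.SameCycle.setoid w) o.out = o := Quotient.out_eq o
    have h2 := hk o.out
    change (τ ^ k o.out) (c (Quotient.mk _ o.out)) = c o
    rw [h1] at h2 ⊢
    exact key o _ 0 h2

theorem card_equivariant (τ : Equiv.Perm X) [Fintype (CycleSet w)] :
    Nat.card {F : α → X // ∀ i, F (w i) = τ (F i)} =
      ∏ o : CycleSet w, Nat.card {x : X // (τ ^ o.length) x = x} := by
  rw [← Nat.card_pi]
  refine Nat.card_congr (Equiv.ofBijective
    (fun F o => ⟨F.1 o.out, pow_length_of_equivariant F.2 o⟩) ⟨fun F G hFG => ?_, fun c => ?_⟩)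
  · exact Subtype.ext (eq_of_equivariant F.2 G.2 fun o => congrArg Subtype.val (congrFun hFG o))
  · obtain ⟨F, hF, hFc⟩ := exists_equivariant (c := fun o => (c o).1) fun o => (c o).2
    exact ⟨⟨F, hF⟩, funext fun o => Subtype.ext (hFc o)⟩

end Cycles

section CountEquivariant

variable {n : ℕ} [NeZero n]

theorem optionCongr_rotPerm_pow (e : ℤ) (l : ℕ) :
    (Equiv.optionCongr (rotPerm n e)) ^ l = Equiv.optionCongr (rotPerm n (l * e)) := by
  induction l with
  | zero =>
    rw [Nat.cast_zero, zero_mul, rotPerm_zero, pow_zero]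
    exact Equiv.optionCongr_refl.symm
  | succ l ih =>
    rw [pow_succ, ih, Nat.cast_succ, add_mul, one_mul, rotPerm_add]
    ext x : 1
    cases x <;> rfl

theorem rotPerm_eq_self_iff (k : ℤ) (p : Fin n) : rotPerm n k p = p ↔ (n : ℤ) ∣ k := by
  change lab n ((p : ℕ) + k) = p ↔ _
  rw [lab_eq_coe_iff]
  exact exists_congr fun m => by rw [add_right_inj, mul_comm]

open Classical in
theorem card_fixed_rotPerm (k : ℤ) :
    Nat.card {x : Option (Fin n) // Equiv.optionCongr (rotPerm n k) x = x} =
      if (n : ℤ) ∣ k then n + 1 else 1 := by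
  split_ifs with hk
  · have h1 : ∀ x : Option (Fin n), Equiv.optionCongr (rotPerm n k) x = x := by
      rintro (_ | p)
      · rfl
      · exact congrArg some ((rotPerm_eq_self_iff k p).2 hk)
    rw [Nat.card_congr (Equiv.subtypeUnivEquiv h1), Finite.card_option, Nat.card_fin]
  · rw [Nat.card_eq_one_iff_unique]
    refine ⟨⟨?_⟩, ⟨⟨none, rfl⟩⟩⟩
    rintro ⟨_ | p, hp⟩ ⟨_ | q, hq⟩
    · rfl
    · exact absurd ((rotPerm_eq_self_iff k q).1 (Option.some.inj hq)) hk
    · exact absurd ((rotPerm_eq_self_iff k p).1 (Option.some.inj hp)) hk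
    · exact absurd ((rotPerm_eq_self_iff k p).1 (Option.some.inj hp)) hk

/-- A cycle of length `l` has `n + 1` choices if rotating `l` times by `e` is trivial. Otherwise none
of its labels can have a position. -/
theorem card_equivariant_labelling {a : ℕ} (w : Equiv.Perm (Fin a)) (e : ℤ) :
    Nat.card {F : Fin a → Option (Fin n) // ∀ i, F (w i) = (F i).map (rotPerm n e)} =
      (n + 1) ^ Nat.card {o : CycleSet w // (n : ℤ) ∣ o.length * e} := by
  classical
  let _ : Fintype (CycleSet w) := Fintype.ofFinite _
  have h1 := card_equivariant (w := w) (Equiv.optionCongr (rotPerm n e))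
  have h2 : ∀ o : CycleSet w, Nat.card {x // ((Equiv.optionCongr (rotPerm n e)) ^ o.length) x = x}
      = if (n : ℤ) ∣ o.length * e then n + 1 else 1 := fun o => by
    rw [optionCongr_rotPerm_pow, card_fixed_rotPerm]
  refine h1.trans ?_
  rw [Finset.prod_congr rfl fun o _ => h2 o, Finset.prod_ite, Finset.prod_const,
    Finset.prod_const_one, mul_one, Nat.card_eq_fintype_card, Fintype.card_subtype]

end CountEquivariant

/-! ### Eigenspaces of a permutation -/

section Eigenspaces

variable {a : ℕ}

theorem mem_eigenspace_coordinateRep {w : Equiv.Perm (Fin a)} {μ : ℂ} {f : Fin a → ℂ} :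
    f ∈ Module.End.eigenspace (coordinateRep a w) μ ↔ ∀ i, f (w⁻¹ i) = μ * f i := by
  rw [Module.End.mem_eigenspace_iff, funext_iff]
  rfl

/-- An eigenvector is an equivariant function for the multiplication by `μ⁻¹`. -/
theorem finrank_eigenspace_coordinateRep (w : Equiv.Perm (Fin a)) {μ : ℂ} (hμ : μ ≠ 0) :
    Module.finrank ℂ (Module.End.eigenspace (coordinateRep a w) μ) =
      Nat.card {o : CycleSet w // μ ^ o.length = 1} := by
  classical
  let _ : Fintype {o : CycleSet w // μ ^ o.length = 1} := Fintype.ofFinite _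
  set τ : Equiv.Perm ℂ := (Equiv.mulLeft₀ μ hμ)⁻¹ with hτ
  have hmem : ∀ f : Fin a → ℂ, f ∈ Module.End.eigenspace (coordinateRep a w) μ ↔
      ∀ i, f (w i) = τ (f i) := by
    intro f
    rw [mem_eigenspace_coordinateRep]
    refine (w⁻¹).forall_congr fun i => ?_
    rw [hτ, Equiv.Perm.eq_inv_iff_eq, show w (w⁻¹ i) = i from w.apply_symm_apply i]
    exact eq_comm
  have hpow : ∀ (l : ℕ) (x : ℂ), (τ ^ l) x = x ↔ μ ^ l = 1 ∨ x = 0 := by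
    intro l x
    have h1 : ((Equiv.mulLeft₀ μ hμ) ^ l) x = μ ^ l * x := by
      induction l with
      | zero => simp
      | succ l ih => rw [pow_succ', Equiv.Perm.mul_apply, ih, pow_succ', mul_assoc]; rfl
    rw [hτ, inv_pow, Equiv.Perm.inv_eq_iff_eq, h1, eq_comm, mul_left_eq_self₀]
  let Φ : Module.End.eigenspace (coordinateRep a w) μ →ₗ[ℂ]
      ({o : CycleSet w // μ ^ o.length = 1} → ℂ) :=
    { toFun := fun f o => f.1 o.1.out
      map_add' := fun _ _ => rfl
      map_smul' := fun _ _ => rfl }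
  have hΦ : Function.Bijective Φ := by
    constructor
    · intro f g hfg
      have hf := (hmem f.1).1 f.2
      have hg := (hmem g.1).1 g.2
      refine Subtype.ext (eq_of_equivariant hf hg fun o => ?_)
      rcases (hpow _ _).1 (pow_length_of_equivariant hf o) with h1 | h1
      · exact congrFun hfg ⟨o, h1⟩
      · rcases (hpow _ _).1 (pow_length_of_equivariant hg o) with h2 | h2
        · exact congrFun hfg ⟨o, h2⟩
        · rw [h1, h2]
    · intro c
      obtain ⟨f, hf, hfc⟩ := exists_equivariant (w := w) (τ := τ)
        (c := fun o => if ho : μ ^ o.length = 1 then c ⟨o, ho⟩ else 0) fun o => by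
          rw [hpow]
          by_cases ho : μ ^ o.length = 1
          · exact Or.inl ho
          · exact Or.inr (dif_neg ho)
      exact ⟨⟨f, (hmem f).2 hf⟩, funext fun o => (hfc o.1).trans (dif_pos o.2)⟩
  rw [(LinearEquiv.ofBijective Φ hΦ).finrank_eq, Module.finrank_fintype_fun_eq_card,
    Nat.card_eq_fintype_card]

/-- The constant functions. -/
abbrev constants (a : ℕ) : Submodule ℂ (Fin a → ℂ) :=
  Submodule.span ℂ {(fun _ => 1 : Fin a → ℂ)}

theorem mem_constants_iff {f : Fin a → ℂ} : f ∈ constants a ↔ ∃ k : ℂ, ∀ i, f i = k := by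
  rw [Submodule.mem_span_singleton]
  refine exists_congr fun k => ?_
  rw [funext_iff]
  exact forall_congr' fun i => by simp [eq_comm]

/-- The eigenspaces of a permutation map onto its eigenspaces on the reflection
representation. -/
theorem range_eigenspace_coordinateRep (ha : 0 < a) (w : Equiv.Perm (Fin a)) (μ : ℂ) :
    LinearMap.range ((constants a).mkQ ∘ₗ
      (Module.End.eigenspace (coordinateRep a w) μ).subtype) =
      Module.End.eigenspace (reflectionRep a w) μ := by
  apply le_antisymm
  · rintro _ ⟨f, rfl⟩
    rw [Module.End.mem_eigenspace_iff]
    have hf := Module.End.mem_eigenspace_iff.1 f.2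
    change (constants a).mkQ (coordinateRep a w f.1) = μ • (constants a).mkQ f.1
    rw [hf, map_smul]
  · intro v hv
    obtain ⟨f, rfl⟩ := (constants a).mkQ_surjective v
    rw [Module.End.mem_eigenspace_iff] at hv
    have h1 : (constants a).mkQ (coordinateRep a w f) = (constants a).mkQ (μ • f) := by
      rw [map_smul]
      exact hv
    rw [← sub_eq_zero, ← map_sub, ← LinearMap.mem_ker, Submodule.ker_mkQ,
      mem_constants_iff] at h1
    obtain ⟨k, hk⟩ := h1
    have hk' : ∀ i, f (w⁻¹ i) - μ * f i = k := hk
    by_cases hμ : μ = 1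
    · -- the sum of `w f - f` over all coordinates vanishes
      have h2 : ∑ i, (f (w⁻¹ i) - f i) = 0 := by
        rw [Finset.sum_sub_distrib, Equiv.sum_comp w⁻¹ f, sub_self]
      have h3 : (a : ℂ) * k = 0 := by
        rw [← h2, Finset.sum_congr rfl fun i _ => (by simpa [hμ] using hk' i : f (w⁻¹ i) - f i = k)]
        simp
      have h4 : k = 0 := (mul_eq_zero.1 h3).resolve_left (by exact_mod_cast ha.ne')
      exact ⟨⟨f, mem_eigenspace_coordinateRep.2 fun i => sub_eq_zero.1 ((hk' i).trans h4)⟩, rfl⟩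
    · have hμ' : μ - 1 ≠ 0 := sub_ne_zero.2 hμ
      refine ⟨⟨f + fun _ => k / (μ - 1), mem_eigenspace_coordinateRep.2 fun i => ?_⟩, ?_⟩
      · have := hk' i
        change f (w⁻¹ i) + k / (μ - 1) = μ * (f i + k / (μ - 1))
        field_simp
        linear_combination (μ - 1) * this
      · change (constants a).mkQ (f + fun _ => k / (μ - 1)) = (constants a).mkQ f
        rw [map_add, add_eq_left, ← LinearMap.mem_ker, Submodule.ker_mkQ, mem_constants_iff]
        exact ⟨_, fun _ => rfl⟩

theorem reflectionMult_add_finrank_ker (ha : 0 < a) (w : Equiv.Perm (Fin a)) {μ : ℂ}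
    (hμ : μ ≠ 0) : reflectionMult w μ + Module.finrank ℂ (LinearMap.ker ((constants a).mkQ ∘ₗ
      (Module.End.eigenspace (coordinateRep a w) μ).subtype)) =
      Nat.card {o : CycleSet w // μ ^ o.length = 1} := by
  rw [reflectionMult, ← range_eigenspace_coordinateRep ha,
    LinearMap.finrank_range_add_finrank_ker, finrank_eigenspace_coordinateRep w hμ]

/-- No constant vector is an eigenvector for `μ ≠ 1`. -/
theorem reflectionMult_of_ne_one (ha : 0 < a) (w : Equiv.Perm (Fin a)) {μ : ℂ}
    (hμ : μ ≠ 0) (hμ1 : μ ≠ 1) :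
    reflectionMult w μ = Nat.card {o : CycleSet w // μ ^ o.length = 1} := by
  rw [← reflectionMult_add_finrank_ker ha w hμ, LinearMap.ker_eq_bot.2, finrank_bot, add_zero]
  rw [← LinearMap.ker_eq_bot, LinearMap.ker_eq_bot']
  intro f hf
  obtain ⟨k, hk⟩ : ∃ k : ℂ, ∀ i, f.1 i = k :=
    mem_constants_iff.1 ((Submodule.Quotient.mk_eq_zero _).1 hf)
  have hf' := mem_eigenspace_coordinateRep.1 f.2
  refine Subtype.ext (funext fun i => ?_)
  have h1 := hf' i
  rw [hk, hk, eq_comm, mul_left_eq_self₀] at h1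
  exact (hk i).trans (h1.resolve_left hμ1)

/-- The constant vectors account for one dimension of the invariants. -/
theorem reflectionMult_one (ha : 0 < a) (w : Equiv.Perm (Fin a)) :
    reflectionMult w 1 + 1 = Nat.card (CycleSet w) := by
  have h1 := reflectionMult_add_finrank_ker ha w one_ne_zero
  have hone : (fun _ => 1 : Fin a → ℂ) ∈ Module.End.eigenspace (coordinateRep a w) 1 :=
    mem_eigenspace_coordinateRep.2 fun i => (one_mul _).symm
  have h2 : LinearMap.ker ((constants a).mkQ ∘ₗ
      (Module.End.eigenspace (coordinateRep a w) 1).subtype) =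
      Submodule.span ℂ {⟨_, hone⟩} := by
    ext f
    rw [LinearMap.mem_ker, LinearMap.comp_apply, ← LinearMap.mem_ker, Submodule.ker_mkQ,
      Submodule.mem_span_singleton, Submodule.mem_span_singleton]
    exact exists_congr fun k => ⟨fun hk => Subtype.ext hk, congrArg Subtype.val⟩
  rw [h2, finrank_span_singleton] at h1
  · rw [h1]
    exact Nat.card_congr (Equiv.subtypeUnivEquiv fun o => one_pow _)
  · intro h0
    exact one_ne_zero (congrFun (congrArg Subtype.val h0) ⟨0, ha⟩ : (1 : ℂ) = 0)

end Eigenspaces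

/-! ### The permutation character -/

/-- The permutation character counts fixed points. -/
theorem character_ofMulAction {G X : Type*} [Group G] [MulAction G X] [Finite X] (g : G) :
    (Representation.ofMulAction ℂ G X).character g = Nat.card {x : X // g • x = x} := by
  classical
  let _ := Fintype.ofFinite X
  rw [Representation.character, LinearMap.trace_eq_matrix_trace ℂ (MonoidAlgebra.basis X ℂ),
    Matrix.trace, Nat.card_eq_fintype_card, Fintype.card_subtype, Finset.card_filter,
    Nat.cast_sum]
  refine Finset.sum_congr rfl fun x _ => ?_
  rw [Matrix.diag_apply, LinearMap.toMatrix_apply, MonoidAlgebra.basis_apply,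
    Representation.ofMulAction_single, Nat.cast_ite, Nat.cast_one, Nat.cast_zero]
  exact Finsupp.single_apply

/-! ### Counting fixed points -/

section Count

variable {a b : ℕ} [NeZero (b - 1)]

theorem finite_ncParkingFunction (a b : ℕ) : Finite (NCParkingFunction a b) := by
  refine Finite.of_injective (fun x => (x.part.parts, x.label)) fun x y hxy => ?_
  exact NCParkingFunction.ext (Finpartition.ext (congrArg Prod.fst hxy)) (congrArg Prod.snd hxy)

/-- A cycle of length `l` is compatible with the rotation by `g ^ d` if and only if it contributes
to the eigenvalue `ζ ^ d`. -/
theorem dvd_iff_pow_eq_one {n : ℕ} {g : Multiplicative (ZMod n)}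
    (hg : ∀ h, h ∈ Subgroup.zpowers g) {ζ : ℂ} (hζ : IsPrimitiveRoot ζ n) {d : ℕ} {e : ℤ}
    (he : g ^ d = Multiplicative.ofAdd (e : ZMod n)) (l : ℕ) :
    (n : ℤ) ∣ l * e ↔ (ζ ^ d) ^ l = 1 := by
  have h1 : (g ^ d) ^ l = Multiplicative.ofAdd ((l * e : ℤ) : ZMod n) := by
    rw [he, ← ofAdd_nsmul, nsmul_eq_mul, Int.cast_mul, Int.cast_natCast]
  have h2 : orderOf g = n :=
    (orderOf_eq_card_of_forall_mem_zpowers hg).trans (Nat.card_zmod n)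
  rw [← ZMod.intCast_zmod_eq_zero_iff_dvd, ← ofAdd_eq_one, ← h1, ← pow_mul, ← pow_mul,
    ← orderOf_dvd_iff_pow_eq_one, h2, hζ.pow_eq_one_iff_dvd]

/-- The number of fixed points. Without rotation, the cycle lemma removes one factor `b`, and this
is the one dimension by which the eigenspace for the eigenvalue `1` drops in the reflection
representation. -/
theorem card_fixed (h : RationalParams a b (b - 1)) (w : Equiv.Perm (Fin a))
    {g : Multiplicative (ZMod (b - 1))} (hg : ∀ h, h ∈ Subgroup.zpowers g) {ζ : ℂ}
    (hζ : IsPrimitiveRoot ζ (b - 1)) (d : ℕ) :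
    Nat.card {x : NCParkingFunction a b // actFun h (w, g ^ d) x = x} =
      b ^ reflectionMult w (ζ ^ d) := by
  have hb : b - 1 + 1 = b := h.eq.symm
  have hb0 : 0 < b := h.pos.trans h.lt
  have : NeZero b := ⟨hb0.ne'⟩
  have hμ : ζ ^ d ≠ 0 := pow_ne_zero _ (hζ.ne_zero (NeZero.ne _))
  obtain ⟨e, he0, hen, he⟩ : ∃ e : ℤ, 0 ≤ e ∧ e < (b - 1 : ℕ) ∧
      g ^ d = Multiplicative.ofAdd (e : ZMod (b - 1)) :=
    ⟨((g ^ d).toAdd.val : ℕ), by positivity, by exact_mod_cast ZMod.val_lt _, by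
      rw [Int.cast_natCast, ZMod.natCast_zmod_val, ofAdd_toAdd]⟩
  have hrot : rotHom (b - 1) (g ^ d) = rotPerm (b - 1) e := by rw [he, rotHom_ofAdd]
  have key := dvd_iff_pow_eq_one hg hζ he
  have hcount := card_equivariant_labelling (n := b - 1) w e
  rw [hb, Nat.card_congr (Equiv.subtypeEquivRight fun o : CycleSet w => key o.length)] at hcount
  rcases he0.lt_or_eq with he1 | rfl
  · have hμ1 : ζ ^ d ≠ 1 := fun h1 => by
      have h2 := (key 1).2 (by rw [pow_one, h1])
      rw [Nat.cast_one, one_mul] at h2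
      have := Int.le_of_dvd he1 h2
      omega
    rw [reflectionMult_of_ne_one h.pos w hμ hμ1, ← hcount]
    exact card_fixed_of_rotation h w hrot he1 hen
  · have hμ1 : ζ ^ d = 1 := by simpa using key 1
    refine Nat.eq_of_mul_eq_mul_right hb0 ?_
    rw [card_fixed_of_no_rotation h w hrot, card_isDyck_mul h w, hμ1, ← pow_succ,
      reflectionMult_one h.pos]
    have h1 : ∀ F : Fin a → Option (Fin (b - 1)),
        (∀ i, F (w i) = (F i).map (rotPerm (b - 1) 0)) ↔ ∀ i, F (w i) = F i := fun F => by
      rw [rotPerm_zero]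
      exact forall_congr' fun i => by rw [Equiv.Perm.coe_one, Option.map_id, id]
    rw [Nat.card_congr (Equiv.subtypeEquivRight h1)] at hcount
    rw [hcount, hμ1]
    exact congrArg (b ^ ·) (Nat.card_congr (Equiv.subtypeUnivEquiv fun o => one_pow _))

end Count

theorem mainTheorem4 (a b : ℕ) (ha : 0 < a) (hab : a < b) (hcop : Nat.Coprime a b) :
    ∃ _act : MulAction (Equiv.Perm (Fin a) × Multiplicative (ZMod (b - 1)))
        (NCParkingFunction a b),
      (∀ (w : Equiv.Perm (Fin a)) (x : NCParkingFunction a b),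
        ((w, (1 : Multiplicative (ZMod (b - 1)))) • x).part = x.part ∧
        ∀ B, ((w, (1 : Multiplicative (ZMod (b - 1)))) • x).label B =
          (x.label B).map w.toEmbedding) ∧
      (∀ x : NCParkingFunction a b,
        (((1 : Equiv.Perm (Fin a)), Multiplicative.ofAdd (1 : ZMod (b - 1))) • x).part.parts =
          x.part.parts.image rotSubset ∧
        ∀ B, (((1 : Equiv.Perm (Fin a)), Multiplicative.ofAdd (1 : ZMod (b - 1))) • x).label
          (rotSubset B) = x.label B) ∧
      ∀ (w : Equiv.Perm (Fin a)) (g : Multiplicative (ZMod (b - 1))) (d : ℕ),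
        (∀ h, h ∈ Subgroup.zpowers g) →
        (Representation.ofMulAction ℂ
            (Equiv.Perm (Fin a) × Multiplicative (ZMod (b - 1)))
            (NCParkingFunction a b)).character (w, g ^ d) =
          (b : ℂ) ^ reflectionMult w
            (Complex.exp (2 * Real.pi * Complex.I / ((b : ℂ) - 1)) ^ d) := by
  have : NeZero (b - 1) := ⟨by omega⟩
  have : Finite (NCParkingFunction a b) := finite_ncParkingFunction a b
  have h : RationalParams a b (b - 1) := ⟨ha, hab, hcop, by omega⟩
  have hrot : rotHom (b - 1) (Multiplicative.ofAdd (1 : ZMod (b - 1))) = finRotate (b - 1) := by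
    rw [← rotPerm_one, ← rotHom_ofAdd, Int.cast_one]
  refine ⟨parkingAction h, fun w x => ⟨?_, fun B => ?_⟩, fun x => ⟨?_, fun B => ?_⟩,
    fun w g d hg => ?_⟩
  · change mapPart (rotHom (b - 1) 1) x.part = x.part
    rw [map_one, mapPart_one]
  · change (x.label (B.map (rotHom (b - 1) 1)⁻¹.toEmbedding)).map w.toEmbedding = _
    rw [map_one, inv_one, map_one_perm]
  · change (mapPart (rotHom (b - 1) (Multiplicative.ofAdd 1)) x.part).parts = _
    rw [hrot, mapPart_parts]
    rfl
  · change (x.label ((B.map (finRotate (b - 1)).toEmbedding).map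
      (rotHom (b - 1) (Multiplicative.ofAdd 1))⁻¹.toEmbedding)).map
        (1 : Equiv.Perm (Fin a)).toEmbedding = _
    rw [hrot, ← map_mul_perm, inv_mul_cancel, map_one_perm, map_one_perm]
  · have hζ : IsPrimitiveRoot (Complex.exp (2 * Real.pi * Complex.I / ((b : ℂ) - 1))) (b - 1) := by
      have h1 := Complex.isPrimitiveRoot_exp (b - 1) (NeZero.ne _)
      rwa [Nat.cast_sub (by omega), Nat.cast_one] at h1
    let _ := parkingAction h
    rw [character_ofMulAction, ← Nat.cast_pow, ← card_fixed h w hg hζ d]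
    rfl
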